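/- Setting. Let $p$ be a prime, $F$ a finite extension of $\mathbb{Q}_p$ with ring of integers $\mathcal{O}_F$, maximal ideal $\mathfrak p_F$, uniformizer $\varpi$, residue field of cardinality $q$ and absolute ramification index $e$. Let $C$ be a finite extension of $\mathbb{Q}_p$ such that the set $S=\mathrm{Hom}_{\mathbb{Q}_p\text{-alg}}(F,C)$ has $[F:\mathbb{Q}_p]$ elements and such that $C$ contains a square root of $\sigma(\varpi)$ for every $\sigma\in S$; fix these square roots. Let $v_F$ be the $p$-adic valuation on $C$ and on $F$ normalized by $v_F(\varpi)=1$ (so $v_F(0)=\infty$). Put $G=GL_2(F)$, $K=GL_2(\mathcal{O}_F)$, $Z$ the center of $G$, $I\subset K$ the subgroup of matrices that are upper triangular modulo $\mathfrak{p}_F$, $\alpha=\begin{pmatrix}1&0\\0&\varpi\end{pmatrix}$, $\beta=\begin{pmatrix}0&1\\\varpi&0\end{pmatrix}$. Let $\underline{k}=(k_\sigma)_{\sigma\in S}\in\mathbb{Z}_{\ge0}^S$. For $\sigma\in S$ let $\underline\rho^\sigma_{k_\sigma}$ be the space of homogeneous polynomials of degree $k_\sigma$ in $x_\sigma,y_\sigma$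 over $C$, on which $g=\begin{pmatrix}a&b\\c&d\end{pmatrix}\in G$ acts by $$g\,(x_\sigma^{k_\sigma-i}y_\sigma^i)=\sigma(\varpi)^{-\frac{k_\sigma}{2}v_F(\det g)}\,(\sigma(a)x_\sigma+\sigma(c)y_\sigma)^{k_\sigma-i}(\sigma(b)x_\sigma+\sigma(d)y_\sigma)^i,$$ where $\sigma(\varpi)^{1/2}$ is the fixed square root. Let $\underline\rho=\underline\rho_{\underline k}=\bigotimes_{\sigma\in S}\underline\rho^\sigma_{k_\sigma}$, and let $\underline\rho^0\subset\underline\rho$ be the $\mathcal{O}_C$-lattice spanned by the tensors of polynomials with coefficients in $\mathcal{O}_C$. Let $\mathrm{ind}\,\underline\rho$ be the space of functions $f:G\to\underline\rho$ with $f(\kappa g)=\underline\rho(\kappa)f(g)$ for all $\kappa\in KZ$, $g\in G$, whose support is compact modulo $KZ$, and let $\mathrm{ind}\,\underline\rho^0$ be its subset of functions with values in $\underline\rho^0$. Let $U=\bigotimes_\sigma U_\sigma$ with $U_\sigma(x_\sigma^{k_\sigma-i}y_\sigma^i)=\sigma(\varpi)^{k_\sigma-i}x_\sigma^{k_\sigma-i}y_\sigma^i$,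 let $\psi:G\to\mathrm{End}_C(\underline\rho)$ be the function supported on $KZ\alpha^{-1}KZ$ with $\psi(\kappa_1\alpha^{-1}\kappa_2)=\underline\rho(\kappa_1)\circ U\circ\underline\rho(\kappa_2)$ for $\kappa_1,\kappa_2\in KZ$, and let $T$ be the Hecke operator $(Tf)(g)=\sum_{xKZ\in G/KZ}\psi(x)\bigl(f(x^{-1}g)\bigr)$ on $\mathrm{ind}\,\underline\rho$. For $m\ge0$ put $S_m^0=I\alpha^{-m}KZ$, $S_m^1=I\beta\alpha^{-m}KZ$. Say that $f\in\mathrm{ind}\,\underline\rho$ is supported on a set $X\subseteq G$ of the form $X=X\cdot KZ$ if $f(g)\neq0$ implies $g^{-1}\in X$. Let $B_N\subset\mathrm{ind}\,\underline\rho$ be the set of functions supported on $\bigcup_{m\le N}S_m^0\cup\bigcup_{m\le N-1}S_m^1$, and $B^0$ the set of functions supported on $\bigcup_{m\ge0}S^0_m$. For $a\in\mathcal{O}_C$, the pair $(\underline k,a)$ is called *separated* if for all sufficiently large integers $N>0$ there is an integer $\epsilon\ge0$, depending only on $N,\underline k,a$, such that for all integers $n\ge0$ and all $f\in B^0$ $$(T-a)f\in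 B_N+\varpi^n\,\mathrm{ind}\,\underline\rho^0\ \Longrightarrow\ f\in B_{N-1}+\varpi^{n-\epsilon}\,\mathrm{ind}\,\underline\rho^0,$$ where $\varpi$ is viewed in $C$ through any embedding $F\hookrightarrow C$. Theorem. Let $a\in\mathcal{O}_C$. Assume that $S^+=\{\sigma\in S\mid k_\sigma\neq0\}$ has exactly one element $\sigma$, and write $k=k_\sigma=dq+r$ with integers $d\ge 0$ and $0\le r<q$. Assume that one of the following holds: (i) $k\le\frac12q^2$, $r<q-d$ and $v_F(a)\in[0,1]$; (ii) $k\le\frac12q^2$, $2v_F(a)-1\le r<q-d$ and $v_F(a)\in[1,e]$; (iii) $k\le\min(pq-1,\frac12q^2)$, $d-1\le r$ and $v_F(a)\ge d$. Then $(\underline k,a)$ is separated. -/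

import Mathlib

noncomputable section

namespace BreuilSchneider

/-! ### Local fields -/

/-- The ring of integers `{x | ‖x‖ ≤ 1}` of an ultrametric normed field. -/
abbrev ringOfInt (K : Type*) [NormedField K] [IsUltrametricDist K] : ValuationSubring K :=
  (NormedField.valuation (K := K)).valuationSubring

/-- The number `q` of elements of the residue field of `F`. -/
def residueCard (F : Type*) [NormedField F] [IsUltrametricDist F] : ℕ :=
  Nat.card (IsLocalRing.ResidueField (ringOfInt F))

/-- The absolute ramification index `e` of `F`: the largest `n` such that `p` lies in the
`n`-th power of the maximal ideal of the ring of integers. -/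
def ramIndex (p : ℕ) (F : Type*) [NormedField F] [IsUltrametricDist F] : ℕ :=
  sSup {n : ℕ | (p : ringOfInt F) ∈ IsLocalRing.maximalIdeal (ringOfInt F) ^ n}

/-- `ϖ` is a uniformizer of `F`: it generates the maximal ideal of the ring of integers. -/
def IsUniformizer {F : Type*} [NormedField F] [IsUltrametricDist F] (ϖ : Fˣ) : Prop :=
  ∃ h : (ϖ : F) ∈ ringOfInt F,
    IsLocalRing.maximalIdeal (ringOfInt F) = Ideal.span {⟨(ϖ : F), h⟩}

/-- The valuation `v_F` on an extension `C` (or on `F` itself), normalized by `v_F(ϖ) = 1`, with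
`v_F(0) = ∞`. The norms of `F` and `C` both extend the one of `ℚ_p`. -/
def vF {F C : Type*} [NormedField F] [NormedField C] (ϖ : Fˣ) (x : C) : EReal :=
  open Classical in
  if x = 0 then ⊤ else ((Real.log ‖x‖ / Real.log ‖(ϖ : F)‖ : ℝ) : EReal)

/-- The valuation `v_F` on `F` as an integer: the `n` with `‖x‖ = ‖ϖ‖ ^ n` (only used at nonzero
`x`, for which such an `n` exists). -/
def ordF {F : Type*} [NormedField F] (ϖ : Fˣ) (x : F) : ℤ :=
  open Classical in
  if h : ∃ n : ℤ, ‖x‖ = ‖(ϖ : F)‖ ^ n then h.choose else 0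

/-! ### Subgroups and subsets of `G = GL₂(F)` -/

section Groups

variable {F : Type*} [NormedField F] [IsUltrametricDist F]

/-- `K = GL₂(O_F)`. -/
def maxCompact (F : Type*) [NormedField F] [IsUltrametricDist F] : Subgroup (GL (Fin 2) F) :=
  (Matrix.GeneralLinearGroup.map (n := Fin 2) (algebraMap (ringOfInt F) F)).range

/-- `KZ`, where `Z` is the center of `G`. -/
def KZ (F : Type*) [NormedField F] [IsUltrametricDist F] : Subgroup (GL (Fin 2) F) :=
  maxCompact F ⊔ Subgroup.center (GL (Fin 2) F)

/-- The Iwahori subgroup `I`: matrices of `K` that are upper triangular modulo the maximal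
ideal. -/
def iwahori (F : Type*) [NormedField F] [IsUltrametricDist F] : Set (GL (Fin 2) F) :=
  {g | ∃ h : GL (Fin 2) (ringOfInt F),
    (h : Matrix (Fin 2) (Fin 2) (ringOfInt F)) 1 0 ∈ IsLocalRing.maximalIdeal (ringOfInt F) ∧
    Matrix.GeneralLinearGroup.map (algebraMap (ringOfInt F) F) h = g}

/-- `α = (1 0; 0 ϖ)`. -/
def alpha (ϖ : Fˣ) : GL (Fin 2) F :=
  Matrix.GeneralLinearGroup.mkOfDetNeZero !![1, 0; 0, (ϖ : F)] (by simp)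

/-- `β = (0 1; ϖ 0)`. -/
def beta (ϖ : Fˣ) : GL (Fin 2) F :=
  Matrix.GeneralLinearGroup.mkOfDetNeZero !![0, 1; (ϖ : F), 0] (by simp)

/-- `S_m⁰ = I α⁻ᵐ KZ`. -/
def sphere0 (ϖ : Fˣ) (m : ℕ) : Set (GL (Fin 2) F) :=
  {g | ∃ i ∈ iwahori F, ∃ κ ∈ KZ F, g = i * (alpha ϖ)⁻¹ ^ m * κ}

/-- `S_m¹ = I β α⁻ᵐ KZ`. -/
def sphere1 (ϖ : Fˣ) (m : ℕ) : Set (GL (Fin 2) F) :=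
  {g | ∃ i ∈ iwahori F, ∃ κ ∈ KZ F, g = i * beta ϖ * (alpha ϖ)⁻¹ ^ m * κ}

/-- `B_N = B_N⁰ ∪ B_{N-1}¹`, where `B_M⁰` (resp. `B_M¹`) is the union of the `S_m⁰` (resp. `S_m¹`)
with `m ≤ M`; it is the set of vertices `g KZ` of the tree at distance at most `N` from `KZ`. -/
def ball (ϖ : Fˣ) (N : ℕ) : Set (GL (Fin 2) F) :=
  {g | (∃ m, m ≤ N ∧ g ∈ sphere0 ϖ m) ∨ (∃ m, m + 1 ≤ N ∧ g ∈ sphere1 ϖ m)}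

/-- `B⁰`: the union of all the `S_m⁰`. -/
def half0 (ϖ : Fˣ) : Set (GL (Fin 2) F) :=
  {g | ∃ m, g ∈ sphere0 ϖ m}

end Groups

/-! ### The representations `ρ_k` -/

section Sym

variable {C : Type*} [Field C]

/-- Homogeneous polynomials of degree `n` in `x = X 0` and `y = X 1`. -/
abbrev Sym (C : Type*) [Field C] (n : ℕ) : Submodule C (MvPolynomial (Fin 2) C) :=
  MvPolynomial.homogeneousSubmodule (Fin 2) C n

/-- The substitution `x ↦ a x + c y`, `y ↦ b x + d y` attached to the matrix `(a b; c d)`. -/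
def subst (A : Matrix (Fin 2) (Fin 2) C) : MvPolynomial (Fin 2) C →ₐ[C] MvPolynomial (Fin 2) C :=
  MvPolynomial.aeval fun j => ∑ i, MvPolynomial.C (A i j) * MvPolynomial.X i

theorem subst_mem (n : ℕ) (A : Matrix (Fin 2) (Fin 2) C) (P : MvPolynomial (Fin 2) C)
    (hP : P ∈ Sym C n) : (subst A).toLinearMap P ∈ Sym C n := by
  rw [MvPolynomial.mem_homogeneousSubmodule] at hP ⊢
  have h := hP.aeval (fun j => ∑ i, MvPolynomial.C (A i j) * MvPolynomial.X i) (n := 1)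
    (fun j => MvPolynomial.IsHomogeneous.sum _ _ _ fun i _ => by
      simpa using (MvPolynomial.isHomogeneous_C (Fin 2) (A i j)).mul
        (MvPolynomial.isHomogeneous_X C i))
  simpa [subst] using h

/-- The action of a matrix on homogeneous polynomials by substitution. -/
def symMap (n : ℕ) (A : Matrix (Fin 2) (Fin 2) C) : Sym C n →ₗ[C] Sym C n :=
  (subst A).toLinearMap.restrict (subst_mem n A)

end Sym

section Rep

variable {p : ℕ} [Fact p.Prime]
variable {F : Type*} [NormedField F] [NormedAlgebra ℚ_[p] F]
variable {C : Type*} [NormedField C] [NormedAlgebra ℚ_[p] C]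

/-- The space `⊗_σ ρ_{k_σ}^σ`, the tensor product being over all embeddings `σ : F → C`. -/
abbrev Wt (k : (F →ₐ[ℚ_[p]] C) → ℕ) : Type _ :=
  PiTensorProduct C fun σ : F →ₐ[ℚ_[p]] C => Sym C (k σ)

/-- The representation `⊗_σ (ρ_{k_σ}^σ ⊗ (σ ∘ χ)^{k_σ / 2})` of `G`, where
`χ(g) = ϖ ^ (-v_F(det g))` and where `sq σ` is the chosen square root of `σ(ϖ)`. -/
def rho (ϖ : Fˣ) (sq : (F →ₐ[ℚ_[p]] C) → C) (k : (F →ₐ[ℚ_[p]] C) → ℕ) (g : GL (Fin 2) F) :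
    Wt k →ₗ[C] Wt k :=
  PiTensorProduct.map fun σ =>
    (sq σ ^ (-ordF ϖ (g : Matrix (Fin 2) (Fin 2) F).det * (k σ : ℤ))) •
      symMap (k σ) ((g : Matrix (Fin 2) (Fin 2) F).map σ)

/-- The endomorphism `U = ⊗_σ U_{k_σ}^σ`, where `U_k^σ (x^{k-i} y^i) = σ(ϖ)^{k-i} x^{k-i} y^i`. -/
def heckeU (ϖ : Fˣ) (k : (F →ₐ[ℚ_[p]] C) → ℕ) : Wt k →ₗ[C] Wt k :=
  PiTensorProduct.map fun σ => symMap (k σ) !![σ ϖ, 0; 0, 1]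

variable [IsUltrametricDist C]

/-- The lattice `⊗_σ ρ_{k_σ}^{σ,0}`: the `O_C`-span of the pure tensors of polynomials with
coefficients in `O_C`. -/
def lattice (k : (F →ₐ[ℚ_[p]] C) → ℕ) : Submodule (ringOfInt C) (Wt k) :=
  Submodule.span (ringOfInt C)
    {t | ∃ P : (σ : F →ₐ[ℚ_[p]] C) → Sym C (k σ),
      (∀ σ m, MvPolynomial.coeff m (P σ : MvPolynomial (Fin 2) C) ∈ ringOfInt C) ∧
      t = PiTensorProduct.tprod C P}

variable [IsUltrametricDist F]

/-- The function `ψ : G → End(⊗_σ ρ_{k_σ}^σ)` supported on `KZ α⁻¹ KZ` with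
`ψ(κ₁ α⁻¹ κ₂) = ρ(κ₁) ∘ U ∘ ρ(κ₂)` for `κ₁, κ₂ ∈ KZ`. -/
def heckePsi (ϖ : Fˣ) (sq : (F →ₐ[ℚ_[p]] C) → C) (k : (F →ₐ[ℚ_[p]] C) → ℕ) (g : GL (Fin 2) F) :
    Wt k →ₗ[C] Wt k :=
  open Classical in
  if h : ∃ κ : KZ F × KZ F, g = κ.1 * (alpha ϖ)⁻¹ * κ.2 then
    rho ϖ sq k h.choose.1 ∘ₗ heckeU ϖ k ∘ₗ rho ϖ sq k h.choose.2
  else 0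

/-- The compact induction of `ρ` from `KZ` to `G`: functions `f : G → ⊗_σ ρ_{k_σ}^σ` with
`f(κ g) = ρ(κ) f(g)` for `κ ∈ KZ`, whose support is compact modulo `KZ`, i.e. contained in finitely
many cosets `KZ g` (as `KZ` is open). -/
def cInd (ϖ : Fˣ) (sq : (F →ₐ[ℚ_[p]] C) → C) (k : (F →ₐ[ℚ_[p]] C) → ℕ) :
    Set (GL (Fin 2) F → Wt k) :=
  {f | (∀ κ ∈ KZ F, ∀ g, f (κ * g) = rho ϖ sq k κ (f g)) ∧
    ∃ s : Set (GL (Fin 2) F), s.Finite ∧ ∀ g, f g ≠ 0 → ∃ κ ∈ KZ F, ∃ x ∈ s, g = κ * x}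

/-- `σ(ϖ)^m · ind ρ⁰` inside `ind ρ`, for `c = σ(ϖ)^m` in `C`. -/
def scaledLattice (ϖ : Fˣ) (sq : (F →ₐ[ℚ_[p]] C) → C) (k : (F →ₐ[ℚ_[p]] C) → ℕ) (c : C) :
    Set (GL (Fin 2) F → Wt k) :=
  {f | ∃ h ∈ cInd ϖ sq k, (∀ g, h g ∈ lattice k) ∧ f = c • h}

/-- The functions of `ind ρ` supported on the set `X` of vertices, the vertex `g KZ` corresponding
to the coset `KZ g⁻¹`. -/
def supportedOn (ϖ : Fˣ) (sq : (F →ₐ[ℚ_[p]] C) → C) (k : (F →ₐ[ℚ_[p]] C) → ℕ)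
    (X : Set (GL (Fin 2) F)) : Set (GL (Fin 2) F → Wt k) :=
  {f | f ∈ cInd ϖ sq k ∧ ∀ g, f g ≠ 0 → g⁻¹ ∈ X}

/-- The Hecke operator `(T f)(g) = ∑_{x KZ ∈ G/KZ} ψ(x) (f(x⁻¹ g))`. For `f` in the compact
induction the summand only depends on `x KZ`, and only finitely many summands are nonzero. -/
def heckeT (ϖ : Fˣ) (sq : (F →ₐ[ℚ_[p]] C) → C) (k : (F →ₐ[ℚ_[p]] C) → ℕ)
    (f : GL (Fin 2) F → Wt k) : GL (Fin 2) F → Wt k :=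
  fun g => ∑ᶠ x : GL (Fin 2) F ⧸ KZ F, heckePsi ϖ sq k x.out (f (x.out⁻¹ * g))

/-- The pair `(k, a)` is separated: for all large `N > 0` there is `ε ≥ 0` such that for all `n ≥ 0`
and all `f ∈ B⁰`, if `(T - a) f ∈ B_N + ϖⁿ ind ρ⁰` then `f ∈ B_{N-1} + ϖ^{n-ε} ind ρ⁰`. Here `ϖ` is
viewed in `C` through an embedding `ι` (the choice does not matter). -/
def IsSeparated (ϖ : Fˣ) (sq : (F →ₐ[ℚ_[p]] C) → C) (ι : F →ₐ[ℚ_[p]] C)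
    (k : (F →ₐ[ℚ_[p]] C) → ℕ) (a : C) : Prop :=
  ∃ N₀ : ℕ, ∀ N : ℕ, 0 < N → N₀ ≤ N → ∃ ε : ℕ, ∀ n : ℕ,
    ∀ f ∈ supportedOn ϖ sq k (half0 ϖ),
      (∃ b ∈ supportedOn ϖ sq k (ball ϖ N), ∃ h ∈ scaledLattice ϖ sq k (ι ϖ ^ n),
        heckeT ϖ sq k f - a • f = b + h) →
      ∃ b ∈ supportedOn ϖ sq k (ball ϖ (N - 1)),
        ∃ h ∈ scaledLattice ϖ sq k (ι ϖ ^ ((n : ℤ) - (ε : ℤ))), f = b + h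

end Rep

end BreuilSchneider

end

/-! The vertices of the half tree are indexed by words in the residue field, a word of length n
giving a matrix (ϖ^n x; 0 1). Only the tensor factor at σ is nontrivial, so setting x = 1, y = X
turns f into a finitely supported family of polynomials f(v) of degree at most k. At the child m ::
u of u, (T - a) f becomes f(u)(ϖX - τ_m) + ∑_l ϖ^k f(l :: m :: u)((X + τ_l)/ϖ) - a f(m :: u). After
division by ϖ^n, the hypothesis says that these polynomials are integral for u of length at least N.
Separatedness follows from a bound on f(v), for v of length at least N, depending only on the weight
and on a (`exists_bdd_of_isSol`). As f has finite support, such bounds can be propagated from the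
far vertices towards the root.

The main tool is expansion in powers of Θ = ∏ (X + τ_l). Since Θ(ϖX - τ_m) is ϖX times a polynomial
with unit constant term, integrality of all translates f(ϖX - τ_m) makes ϖ^s times the digit of
index s integral (`bdd_digits_of_shift`). For k < (d + 1)q at most ϖ^d is lost. Conversely the
coefficient of index i of a translate carries ϖ^i, and k ≤ q²/2 gives 2d ≤ q. Hence in degrees at
least q the contribution of u is negligible, and the equation compares a f(m :: u) with the sum over
its children alone.

If |a| ≤ |ϖ|^d, the term a f is negligible too, so the children's sum is small in degrees at least
q. By Lucas' congruences and τ^q ≈ τ its low coefficients are governed by the same moments of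
leading coefficients as the high ones, through a system invertible modulo p
(`norm_coeff_sum_lift_le`). The low coefficients are then small as well, and the bound on f(u)
closes up.

If a is larger, the congruence (X + τ)^q ≡ Θ + X + τ modulo p computes the Θ-digits of the
children's sum. Comparing them with the digits of a f(m :: u) bounds f(m :: u) by |a|⁻²
(`IsSol.estimates`). To continue, a sharper bound on the coefficients of index at least dq is
needed; these are values at 0 of low degree polynomials whose values at the integers d - s occur in
the other digits, and Newton's formula gives the bound (`IsSol.bdd_of_pow_le`).

For r = 0 and 0 < v(a) ≤ 1 this fails. If d ≥ 2, the equation one level closer to the root supplies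
the missing information (`IsSol.bdd_of_dvd`). If d = 1 and v(a) < 1, solutions at a given depth are
shown to be close to multiples of one polynomial near Θ, and the equation in degree q bounds the
multiplier (`IsSol.bdd_of_weight_eq_card`). -/

noncomputable section

namespace BreuilSchneider

open Polynomial

/-! ### Polynomials with bounded coefficients -/

section Bounded

variable {𝕜 : Type*} [NormedField 𝕜]

/-- All coefficients have norm at most `c`. -/
def Bdd (c : ℝ) (f : 𝕜[X]) : Prop := ∀ i, ‖f.coeff i‖ ≤ c

/-- The coefficients of index at most `D` have norm at most `c`. -/
def BddTo (D : ℕ) (c : ℝ) (f : 𝕜[X]) : Prop := ∀ i, i ≤ D → ‖f.coeff i‖ ≤ c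

theorem Bdd.bddTo {c : ℝ} {f : 𝕜[X]} (h : Bdd c f) (D : ℕ) : BddTo D c f := fun i _ => h i

theorem Bdd.nonneg {c : ℝ} {f : 𝕜[X]} (h : Bdd c f) : 0 ≤ c := (norm_nonneg _).trans (h 0)

theorem Bdd.mono {c c' : ℝ} {f : 𝕜[X]} (h : Bdd c f) (hc : c ≤ c') : Bdd c' f :=
  fun i => (h i).trans hc

theorem bdd_zero {c : ℝ} (hc : 0 ≤ c) : Bdd c (0 : 𝕜[X]) := fun i => by simpa using hc

theorem bdd_C {c : ℝ} {x : 𝕜} (hx : ‖x‖ ≤ c) : Bdd c (C x) := fun i => by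
  rw [coeff_C]
  split_ifs
  · exact hx
  · simpa using (norm_nonneg x).trans hx

theorem bdd_X : Bdd 1 (X : 𝕜[X]) := fun i => by
  rw [coeff_X]
  split_ifs <;> simp

theorem bdd_one : Bdd 1 (1 : 𝕜[X]) := by
  simpa using bdd_C (x := (1 : 𝕜)) (c := 1) (by simp)

theorem Bdd.C_mul {c : ℝ} {f : 𝕜[X]} (h : Bdd c f) (x : 𝕜) : Bdd (‖x‖ * c) (C x * f) := fun i => by
  rw [coeff_C_mul, norm_mul]
  exact mul_le_mul_of_nonneg_left (h i) (norm_nonneg x)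

/-- A polynomial of degree less than `(d + 1) deg Θ` has a `Θ`-adic expansion. -/
theorem exists_digits {Θ : 𝕜[X]} {q : ℕ} (hm : Θ.Monic) (hd : Θ.natDegree = q) (hq : 0 < q)
    (d : ℕ) (f : 𝕜[X]) (hf : f.natDegree < (d + 1) * q) :
    ∃ x : ℕ → 𝕜[X], (∀ s, ∀ i, q ≤ i → (x s).coeff i = 0) ∧
      f = ∑ s ∈ Finset.range (d + 1), Θ ^ s * x s := by
  induction d generalizing f with
  | zero =>
    have hf' : f.natDegree < q := by simpa using hf
    exact ⟨fun _ => f, fun s i hi => coeff_eq_zero_of_natDegree_lt (hf'.trans_le hi), by simp⟩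
  | succ d ih =>
    obtain ⟨x, hx, hfx⟩ := ih (f /ₘ Θ) (by
      rw [natDegree_divByMonic _ hm, hd]
      have : (d + 1 + 1) * q = (d + 1) * q + q := by ring
      have : 0 < (d + 1) * q := by positivity
      omega)
    refine ⟨fun s => if s = 0 then f %ₘ Θ else x (s - 1), fun s i hi => ?_, ?_⟩
    · dsimp only
      split_ifs
      · refine coeff_eq_zero_of_natDegree_lt ?_
        have := natDegree_modByMonic_lt f hm (fun h => by simp [h] at hd; omega)
        omega
      · exact hx _ _ hi
    · rw [Finset.sum_range_succ']
      simp only [Nat.add_eq_zero_iff, one_ne_zero, and_false, if_false, Nat.add_sub_cancel, if_true,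
        pow_zero, _root_.one_mul]
      have e : ∑ s ∈ Finset.range (d + 1), Θ ^ (s + 1) * x s = Θ * (f /ₘ Θ) := by
        rw [hfx, Finset.mul_sum]
        exact Finset.sum_congr rfl fun s _ => by ring
      rw [e, add_comm, modByMonic_add_div]

variable [IsUltrametricDist 𝕜]

theorem norm_add_le_of_le {x y : 𝕜} {c : ℝ} (hx : ‖x‖ ≤ c) (hy : ‖y‖ ≤ c) : ‖x + y‖ ≤ c :=
  (IsUltrametricDist.norm_add_le_max x y).trans (max_le hx hy)

theorem norm_sub_le_of_le {x y : 𝕜} {c : ℝ} (hx : ‖x‖ ≤ c) (hy : ‖y‖ ≤ c) : ‖x - y‖ ≤ c := by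
  rw [sub_eq_add_neg]
  exact norm_add_le_of_le hx (by rwa [norm_neg])

theorem norm_sum_le_of_le {ι : Type*} {s : Finset ι} {f : ι → 𝕜} {c : ℝ} (hc : 0 ≤ c)
    (h : ∀ i ∈ s, ‖f i‖ ≤ c) : ‖∑ i ∈ s, f i‖ ≤ c :=
  IsUltrametricDist.norm_sum_le_of_forall_le_of_nonneg hc h

theorem norm_natCast_le (n : ℕ) : ‖(n : 𝕜)‖ ≤ 1 := IsUltrametricDist.norm_natCast_le_one 𝕜 n

theorem norm_intCast_le (n : ℤ) : ‖(n : 𝕜)‖ ≤ 1 := IsUltrametricDist.norm_intCast_le_one 𝕜 n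

theorem Bdd.add {c : ℝ} {f g : 𝕜[X]} (hf : Bdd c f) (hg : Bdd c g) : Bdd c (f + g) := fun i => by
  rw [coeff_add]; exact norm_add_le_of_le (hf i) (hg i)

theorem Bdd.sub {c : ℝ} {f g : 𝕜[X]} (hf : Bdd c f) (hg : Bdd c g) : Bdd c (f - g) := fun i => by
  rw [coeff_sub]; exact norm_sub_le_of_le (hf i) (hg i)

theorem Bdd.sum {ι : Type*} {s : Finset ι} {f : ι → 𝕜[X]} {c : ℝ} (hc : 0 ≤ c)
    (h : ∀ i ∈ s, Bdd c (f i)) : Bdd c (∑ i ∈ s, f i) := fun n => by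
  rw [finsetSum_coeff]
  exact norm_sum_le_of_le hc fun i hi => h i hi n

theorem Bdd.mul {c c' : ℝ} {f g : 𝕜[X]} (hf : Bdd c f) (hg : Bdd c' g) : Bdd (c * c') (f * g) := by
  intro n
  rw [coeff_mul]
  refine norm_sum_le_of_le (mul_nonneg hf.nonneg hg.nonneg) fun x _ => ?_
  rw [norm_mul]
  exact mul_le_mul (hf _) (hg _) (norm_nonneg _) hf.nonneg

theorem Bdd.mul_one {c : ℝ} {f g : 𝕜[X]} (hf : Bdd c f) (hg : Bdd 1 g) : Bdd c (f * g) := by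
  simpa using hf.mul hg

theorem Bdd.one_mul {c : ℝ} {f g : 𝕜[X]} (hf : Bdd 1 f) (hg : Bdd c g) : Bdd c (f * g) := by
  simpa using hf.mul hg

theorem Bdd.pow {f : 𝕜[X]} (hf : Bdd 1 f) (n : ℕ) : Bdd 1 (f ^ n) := by
  induction n with
  | zero => simpa using bdd_one
  | succ n ih => rw [pow_succ]; exact ih.mul_one hf

theorem Bdd.prod {ι : Type*} {s : Finset ι} {f : ι → 𝕜[X]} (h : ∀ i ∈ s, Bdd 1 (f i)) :
    Bdd 1 (∏ i ∈ s, f i) := by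
  classical
  induction s using Finset.induction_on with
  | empty => simpa using bdd_one
  | insert a s ha ih =>
    rw [Finset.prod_insert ha]
    exact (h _ (Finset.mem_insert_self _ _)).mul_one
      (ih fun i hi => h i (Finset.mem_insert_of_mem hi))

theorem bdd_X_add_C {x : 𝕜} (hx : ‖x‖ ≤ 1) : Bdd 1 (X + C x : 𝕜[X]) := bdd_X.add (bdd_C hx)

theorem Bdd.comp {c : ℝ} {f g : 𝕜[X]} (hf : Bdd c f) (hg : Bdd 1 g) : Bdd c (f.comp g) := by
  rw [comp_eq_sum_left, sum_def]
  refine Bdd.sum hf.nonneg fun i _ => ?_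
  exact (bdd_C (hf i)).mul_one (hg.pow i)

theorem Bdd.norm_eval_le {c : ℝ} {f : 𝕜[X]} (hf : Bdd c f) {x : 𝕜} (hx : ‖x‖ ≤ 1) :
    ‖f.eval x‖ ≤ c := by
  rw [eval_eq_sum, sum_def]
  refine norm_sum_le_of_le hf.nonneg fun i _ => ?_
  rw [norm_mul, norm_pow]
  exact (mul_le_of_le_one_right (norm_nonneg _) (pow_le_one₀ (norm_nonneg _) hx)).trans (hf i)

theorem Bdd.derivative {c : ℝ} {f : 𝕜[X]} (hf : Bdd c f) : Bdd c (derivative f) := fun i => by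
  rw [coeff_derivative, norm_mul]
  refine (mul_le_of_le_one_right (norm_nonneg _) ?_).trans (hf _)
  exact_mod_cast norm_natCast_le (𝕜 := 𝕜) (i + 1)

/-- Division by a polynomial with integral coefficients and unit constant term. -/
theorem bddTo_of_mul {u g : 𝕜[X]} (hu : Bdd 1 u) (hu0 : ‖u.coeff 0‖ = 1) {D : ℕ} {c : ℝ}
    (h : BddTo D c (u * g)) : BddTo D c g := by
  intro n
  induction n using Nat.strong_induction_on with
  | _ n ih =>
    intro hn
    have hc : 0 ≤ c := (norm_nonneg _).trans (h 0 (Nat.zero_le _))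
    have h1 := h n hn
    rw [coeff_mul, ← Finset.add_sum_erase _ _ (show (0, n) ∈ Finset.HasAntidiagonal.antidiagonal n by simp)] at h1
    have h2 : ‖∑ x ∈ (Finset.HasAntidiagonal.antidiagonal n).erase (0, n), u.coeff x.1 * g.coeff x.2‖ ≤ c := by
      refine norm_sum_le_of_le hc fun x hx => ?_
      obtain ⟨hx1, hx2⟩ := Finset.mem_erase.mp hx
      rw [Finset.HasAntidiagonal.mem_antidiagonal] at hx2
      have hlt : x.2 < n := by
        rcases Nat.lt_or_ge x.2 n with h | h
        · exact h
        · exact absurd (Prod.ext (show x.1 = 0 by omega) (show x.2 = n by omega)) hx1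
      rw [norm_mul]
      exact (mul_le_of_le_one_left (norm_nonneg _) (hu _)).trans (ih _ hlt (by omega))
    have h3 := norm_sub_le_of_le h1 h2
    rw [add_sub_cancel_right, norm_mul, hu0, _root_.one_mul] at h3
    exact h3

/-- If the coefficients of `g + Θ h` of index at least `q` are bounded, with `Θ` monic integral of
degree `q` and `g` of degree less than `q`, then those of `h` are. -/
theorem bdd_of_monic_mul {Θ g h : 𝕜[X]} {q : ℕ} (hΘ : Bdd 1 Θ) (hm : Θ.Monic)
    (hd : Θ.natDegree = q) (hg : ∀ i, q ≤ i → g.coeff i = 0) {c : ℝ} (hc : 0 ≤ c)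
    (H : ∀ i, q ≤ i → ‖(g + Θ * h).coeff i‖ ≤ c) : Bdd c h := by
  -- Descending induction on n: as Θ is monic of degree q, the coefficient of index q + n of Θ h is
  -- h_n plus a combination of coefficients of h of larger index.
  have key : ∀ j n, h.natDegree ≤ n + j → ‖h.coeff n‖ ≤ c := by
    intro j
    induction j using Nat.strong_induction_on with
    | _ j ih =>
      intro n hn
      have h1 := H (q + n) (by omega)
      rw [coeff_add, hg _ (by omega), zero_add, coeff_mul,
        ← Finset.add_sum_erase _ _ (show (q, n) ∈ Finset.HasAntidiagonal.antidiagonal (q + n) by simp)] at h1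
      have h2 : ‖∑ x ∈ (Finset.HasAntidiagonal.antidiagonal (q + n)).erase (q, n), Θ.coeff x.1 * h.coeff x.2‖ ≤ c := by
        refine norm_sum_le_of_le hc fun x hx => ?_
        obtain ⟨hx1, hx2⟩ := Finset.mem_erase.mp hx
        rw [Finset.HasAntidiagonal.mem_antidiagonal] at hx2
        rcases Nat.lt_trichotomy x.1 q with hlt | heq | hgt
        · rw [norm_mul]
          refine (mul_le_of_le_one_left (norm_nonneg _) (hΘ _)).trans ?_
          by_cases hx : h.natDegree < x.2
          · rw [coeff_eq_zero_of_natDegree_lt hx, norm_zero]; exact hc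
          · exact ih (h.natDegree - x.2) (by omega) x.2 (by omega)
        · exact absurd (Prod.ext heq (show x.2 = n by omega)) hx1
        · rw [coeff_eq_zero_of_natDegree_lt (by omega : Θ.natDegree < x.1)]; simpa using hc
      have h3 := norm_sub_le_of_le h1 h2
      have h4 : Θ.coeff q = 1 := by rw [← hd]; exact hm
      rw [add_sub_cancel_right, h4, _root_.one_mul] at h3
      exact h3
  exact fun n => key h.natDegree n (by omega)

/-- The digits of a `Θ`-adic expansion are bounded if the polynomial is. -/
theorem bdd_digits {Θ : 𝕜[X]} {q : ℕ} (hΘ : Bdd 1 Θ) (hm : Θ.Monic) (hd : Θ.natDegree = q)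
    {c : ℝ} (hc : 0 ≤ c) (d : ℕ) (x : ℕ → 𝕜[X]) (hx : ∀ s ≤ d, ∀ i, q ≤ i → (x s).coeff i = 0)
    (H : Bdd c (∑ s ∈ Finset.range (d + 1), Θ ^ s * x s)) : ∀ s ≤ d, Bdd c (x s) := by
  induction d generalizing x with
  | zero =>
    intro s hs
    obtain rfl : s = 0 := by omega
    simpa using H
  | succ d ih =>
    have e : ∑ s ∈ Finset.range (d + 1 + 1), Θ ^ s * x s =
        x 0 + Θ * ∑ s ∈ Finset.range (d + 1), Θ ^ s * x (s + 1) := by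
      rw [Finset.sum_range_succ', add_comm, Finset.mul_sum]
      congr 1
      · simp
      · exact Finset.sum_congr rfl fun s _ => by ring
    rw [e] at H
    have h1 := bdd_of_monic_mul hΘ hm hd (hx 0 (by omega)) hc fun i _ => H i
    have h0 : Bdd c (x 0) := by
      have := H.sub (hΘ.one_mul h1)
      rwa [add_sub_cancel_right] at this
    intro s hs
    rcases s with _ | s
    · exact h0
    · exact ih (fun s => x (s + 1)) (fun s hs => hx (s + 1) (by omega)) h1 s (by omega)

/-- The digits of positive index of a `Θ`-adic expansion are bounded if the coefficients of index
at least `deg Θ` are. -/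
theorem bdd_digits_of_high {Θ : 𝕜[X]} {q : ℕ} (hΘ : Bdd 1 Θ) (hm : Θ.Monic) (hd : Θ.natDegree = q)
    {c : ℝ} (hc : 0 ≤ c) (d : ℕ) (x : ℕ → 𝕜[X]) (hx : ∀ s ≤ d, ∀ i, q ≤ i → (x s).coeff i = 0)
    (H : ∀ i, q ≤ i → ‖(∑ s ∈ Finset.range (d + 1), Θ ^ s * x s).coeff i‖ ≤ c) :
    ∀ s, 1 ≤ s → s ≤ d → Bdd c (x s) := by
  rcases d with _ | d
  · intro s h1 h2; omega
  have e : ∑ s ∈ Finset.range (d + 1 + 1), Θ ^ s * x s =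
      x 0 + Θ * ∑ s ∈ Finset.range (d + 1), Θ ^ s * x (s + 1) := by
    rw [Finset.sum_range_succ', add_comm, Finset.mul_sum]
    congr 1
    · simp
    · exact Finset.sum_congr rfl fun s _ => by ring
  rw [e] at H
  have h1 := bdd_of_monic_mul hΘ hm hd (hx 0 (by omega)) hc H
  intro s hs hs'
  obtain ⟨s, rfl⟩ : ∃ t, s = t + 1 := ⟨s - 1, by omega⟩
  exact bdd_digits hΘ hm hd hc d (fun s => x (s + 1)) (fun s hs => hx (s + 1) (by omega)) h1 s
    (by omega)

end Bounded

end BreuilSchneider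
end

noncomputable section

namespace BreuilSchneider

open Polynomial

/-! ### Coset representatives and the two halves of the Hecke operator -/

/-- Representatives `τ` of a finite residue field `Λ` in an ultrametric field, approximately fixed
by the Frobenius. -/
structure TreeData (𝕜 : Type*) [NormedField 𝕜] (Λ : Type*) [Fintype Λ] where
  p : ℕ
  ϖ : 𝕜
  τ : Λ → 𝕜
  prime : p.Prime
  card : ∃ n, 0 < n ∧ Fintype.card Λ = p ^ n
  ϖ_pos : 0 < ‖ϖ‖
  ϖ_lt : ‖ϖ‖ < 1
  p_le : ‖(p : 𝕜)‖ ≤ ‖ϖ‖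
  norm_natCast : ∀ n : ℕ, ¬ p ∣ n → ‖(n : 𝕜)‖ = 1
  τ_le : ∀ l, ‖τ l‖ ≤ 1
  τ_sub : ∀ l m, l ≠ m → ‖τ l - τ m‖ = 1
  τ_frob : ∀ l, ‖τ l ^ Fintype.card Λ - τ l‖ ≤ ‖(p : 𝕜)‖
  sum_pow : ∀ j, j < Fintype.card Λ - 1 → ‖∑ l, τ l ^ j‖ ≤ ‖ϖ‖

section Shift

variable {𝕜 : Type*} [NormedField 𝕜]

/-- The polynomial `f(ω X - x)`. -/
def shift (ω x : 𝕜) (f : 𝕜[X]) : 𝕜[X] := f.comp (C ω * X - C x)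

theorem shift_add (ω x : 𝕜) (f g : 𝕜[X]) : shift ω x (f + g) = shift ω x f + shift ω x g := by
  simp [shift]

theorem shift_sub (ω x : 𝕜) (f g : 𝕜[X]) : shift ω x (f - g) = shift ω x f - shift ω x g := by
  simp [shift]

theorem shift_mul (ω x : 𝕜) (f g : 𝕜[X]) : shift ω x (f * g) = shift ω x f * shift ω x g := by
  simp [shift]

theorem shift_C_mul (ω x a : 𝕜) (f : 𝕜[X]) : shift ω x (C a * f) = C a * shift ω x f := by
  simp [shift]

theorem shift_coeff (ω x : 𝕜) (f : 𝕜[X]) (i : ℕ) :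
    (shift ω x f).coeff i = ω ^ i * (shift 1 x f).coeff i := by
  have : shift ω x f = (shift 1 x f).comp (C ω * X) := by
    simp [shift, comp_assoc]
  rw [this, comp_C_mul_X_coeff, mul_comm]

theorem shift_coeff_zero (ω x : 𝕜) (f : 𝕜[X]) : (shift ω x f).coeff 0 = f.eval (-x) := by
  simp [shift, coeff_zero_eq_eval_zero, eval_comp]

theorem shift_coeff_one (ω x : 𝕜) (f : 𝕜[X]) :
    (shift ω x f).coeff 1 = ω * (derivative f).eval (-x) := by
  have h := coeff_derivative (shift ω x f) 0
  simp only [zero_add, Nat.cast_zero, mul_one] at h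
  rw [← h, shift, derivative_comp, coeff_zero_eq_eval_zero, eval_mul, eval_comp]
  simp

/-- The polynomial `ϖ ^ k f((X + x) / ϖ)`. -/
def lift (k : ℕ) (ϖ x : 𝕜) (f : 𝕜[X]) : 𝕜[X] :=
  ∑ i ∈ Finset.range (k + 1), C (f.coeff i * ϖ ^ (k - i)) * (X + C x) ^ i

theorem lift_sub (k : ℕ) (ϖ x : 𝕜) (f g : 𝕜[X]) :
    lift k ϖ x (f - g) = lift k ϖ x f - lift k ϖ x g := by
  simp [lift, sub_mul, Finset.sum_sub_distrib]

theorem lift_C_mul (k : ℕ) (ϖ x a : 𝕜) (f : 𝕜[X]) :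
    lift k ϖ x (C a * f) = C a * lift k ϖ x f := by
  simp only [lift, coeff_C_mul, Finset.mul_sum, map_mul, mul_assoc]

theorem lift_coeff (k : ℕ) (ϖ x : 𝕜) (f : 𝕜[X]) (n : ℕ) :
    (lift k ϖ x f).coeff n =
      ∑ i ∈ Finset.range (k + 1), f.coeff i * ϖ ^ (k - i) * (x ^ (i - n) * (i.choose n : 𝕜)) := by
  simp [lift, finsetSum_coeff, coeff_X_add_C_pow, -map_mul, -map_pow]

theorem lift_coeff_top (k : ℕ) (ϖ x : 𝕜) (f : 𝕜[X]) : (lift k ϖ x f).coeff k = f.coeff k := by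
  rw [lift_coeff, Finset.sum_range_succ, Finset.sum_eq_zero]
  · simp
  · intro i hi
    rw [Nat.choose_eq_zero_of_lt (Finset.mem_range.mp hi)]; simp

variable [IsUltrametricDist 𝕜]

theorem Bdd.shift {c : ℝ} {f : 𝕜[X]} (hf : Bdd c f) {ω x : 𝕜} (hω : ‖ω‖ ≤ 1) (hx : ‖x‖ ≤ 1) :
    Bdd c (shift ω x f) := by
  refine hf.comp (Bdd.sub ?_ (bdd_C hx))
  simpa using (bdd_C hω).mul_one bdd_X

theorem Bdd.norm_shift_coeff_le {c : ℝ} {f : 𝕜[X]} (hf : Bdd c f) {ω x : 𝕜} (hx : ‖x‖ ≤ 1) (i : ℕ) :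
    ‖(BreuilSchneider.shift ω x f).coeff i‖ ≤ ‖ω‖ ^ i * c := by
  rw [shift_coeff, norm_mul, norm_pow]
  exact mul_le_mul_of_nonneg_left (hf.shift (by simp) hx i) (by positivity)

theorem bdd_lift {c : ℝ} (hc : 0 ≤ c) {k : ℕ} {ϖ x : 𝕜} (hx : ‖x‖ ≤ 1) {f : 𝕜[X]}
    (h : ∀ i ≤ k, ‖f.coeff i * ϖ ^ (k - i)‖ ≤ c) : Bdd c (lift k ϖ x f) :=
  Bdd.sum hc fun i hi => (bdd_C (h i (by simpa [Nat.lt_succ_iff] using hi))).mul_one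
    ((bdd_X_add_C hx).pow i)

theorem Bdd.lift {c : ℝ} {f : 𝕜[X]} (hf : Bdd c f) {k : ℕ} {ϖ x : 𝕜} (hϖ : ‖ϖ‖ ≤ 1) (hx : ‖x‖ ≤ 1) :
    Bdd c (lift k ϖ x f) := bdd_lift hf.nonneg hx fun i _ => by
  rw [norm_mul, norm_pow]
  exact (mul_le_of_le_one_right (norm_nonneg _) (pow_le_one₀ (norm_nonneg _) hϖ)).trans (hf i)

end Shift

/-! ### The polynomial Θ, and recovery of a polynomial from its translates -/

namespace TreeData

variable {𝕜 : Type*} [NormedField 𝕜] {Λ : Type*} [Fintype Λ]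
variable (S : TreeData 𝕜 Λ)

local notation "q" => Fintype.card Λ

theorem two_le_card (S : TreeData 𝕜 Λ) : 2 ≤ q := by
  obtain ⟨n, hn, h⟩ := S.card
  rw [h]
  exact S.prime.two_le.trans (Nat.le_self_pow hn.ne' _)

theorem p_dvd_card : S.p ∣ q := by
  obtain ⟨n, hn, h⟩ := S.card
  rw [h]
  exact dvd_pow_self _ hn.ne'

/-- The monic polynomial with roots `-τ`. -/
def Θ : 𝕜[X] := ∏ l, (X + C (S.τ l))

theorem Θ_monic : S.Θ.Monic := monic_prod_of_monic _ _ fun _ _ => monic_X_add_C _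

theorem Θ_natDegree : S.Θ.natDegree = q := by
  rw [Θ, natDegree_prod_of_monic _ _ fun _ _ => monic_X_add_C _]
  simp

theorem Θ_eval (m : Λ) : S.Θ.eval (-S.τ m) = 0 := by
  rw [Θ, eval_prod]
  exact Finset.prod_eq_zero (Finset.mem_univ m) (by simp)

/-- The cofactor of `ω X` in `Θ(ω X - τ m)`. -/
def cofactor [DecidableEq Λ] (ω : 𝕜) (m : Λ) : 𝕜[X] :=
  ∏ l ∈ Finset.univ.erase m, (C ω * X + C (S.τ l - S.τ m))

theorem shift_Θ [DecidableEq Λ] (ω : 𝕜) (m : Λ) :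
    shift ω (S.τ m) S.Θ = C ω * X * S.cofactor ω m := by
  rw [Θ, shift, prod_comp, ← Finset.mul_prod_erase _ _ (Finset.mem_univ m), cofactor]
  congr 1
  · simp
  · exact Finset.prod_congr rfl fun l _ => by simp; ring

theorem cofactor_coeff_zero [DecidableEq Λ] (ω : 𝕜) (m : Λ) : ‖(S.cofactor ω m).coeff 0‖ = 1 := by
  rw [cofactor, coeff_zero_prod, norm_prod]
  refine Finset.prod_eq_one fun l hl => ?_
  simpa using S.τ_sub l m (Finset.ne_of_mem_erase hl)

variable [IsUltrametricDist 𝕜]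

theorem norm_le_of_dvd {n : ℕ} (h : S.p ∣ n) : ‖(n : 𝕜)‖ ≤ ‖(S.p : 𝕜)‖ := by
  obtain ⟨m, rfl⟩ := h
  rw [Nat.cast_mul, norm_mul]
  exact mul_le_of_le_one_right (norm_nonneg _) (norm_natCast_le m)

theorem Θ_bdd : Bdd 1 S.Θ := Bdd.prod fun l _ => bdd_X_add_C (S.τ_le l)

theorem cofactor_bdd [DecidableEq Λ] {ω : 𝕜} (hω : ‖ω‖ ≤ 1) (m : Λ) : Bdd 1 (S.cofactor ω m) := by
  refine Bdd.prod fun l _ => Bdd.add ?_ (bdd_C (norm_sub_le_of_le (S.τ_le l) (S.τ_le m)))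
  simpa using (bdd_C hω).mul_one bdd_X

/-- A polynomial of degree less than `q` is bounded by its values at the representatives. -/
theorem bdd_of_eval {g : 𝕜[X]} (hg : ∀ i, q ≤ i → g.coeff i = 0) {c : ℝ}
    (h : ∀ m, ‖g.eval (-S.τ m)‖ ≤ c) : Bdd c g := by
  classical
  have hinj : Set.InjOn (fun m => -S.τ m) (Finset.univ : Finset Λ) := by
    intro l _ m _ hlm
    by_contra hne
    have := S.τ_sub l m hne
    rw [neg_injective hlm] at this
    simp at this
  have hdeg : g.degree < (Finset.univ : Finset Λ).card := by
    rw [degree_lt_iff_coeff_zero]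
    exact fun i hi => hg i (by simpa using hi)
  have hc : 0 ≤ c := by
    have : 0 < q := lt_of_lt_of_le (by norm_num) S.two_le_card
    obtain ⟨m⟩ := Fintype.card_pos_iff.mp this
    exact (norm_nonneg _).trans (h m)
  -- The Lagrange basis polynomials are integral because distinct representatives differ by units.
  rw [Lagrange.eq_interpolate hinj hdeg, Lagrange.interpolate_apply]
  refine Bdd.sum hc fun m _ => (bdd_C (h m)).mul_one ?_
  rw [Lagrange.basis]
  refine Bdd.prod fun l hl => ?_
  rw [Lagrange.basisDivisor]
  have e : -S.τ m - -S.τ l = S.τ l - S.τ m := by ring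
  refine (bdd_C ?_).mul_one (bdd_X.sub (bdd_C ?_))
  · rw [e, norm_inv, S.τ_sub l m (Finset.ne_of_mem_erase hl), inv_one]
  · rw [norm_neg]; exact S.τ_le l

/-- The digits of a polynomial are controlled by its translates. -/
theorem bdd_digits_of_shift {ω : 𝕜} (hω : ‖ω‖ ≤ 1) {c : ℝ} (d : ℕ) (x : ℕ → 𝕜[X])
    (hx : ∀ s ≤ d, ∀ i, q ≤ i → (x s).coeff i = 0)
    (H : ∀ m, BddTo d c (shift ω (S.τ m) (∑ s ∈ Finset.range (d + 1), S.Θ ^ s * x s))) :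
    ∀ s ≤ d, Bdd c (C (ω ^ s) * x s) := by
  classical
  induction d generalizing x with
  | zero =>
    intro s hs
    obtain rfl : s = 0 := by omega
    simp only [pow_zero, map_one, one_mul]
    refine S.bdd_of_eval (hx 0 le_rfl) fun m => ?_
    have := H m 0 le_rfl
    rw [shift_coeff_zero] at this
    simpa using this
  | succ d ih =>
    have e : ∑ s ∈ Finset.range (d + 1 + 1), S.Θ ^ s * x s =
        x 0 + S.Θ * ∑ s ∈ Finset.range (d + 1), S.Θ ^ s * x (s + 1) := by
      rw [Finset.sum_range_succ', add_comm, Finset.mul_sum]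
      congr 1
      · simp
      · exact Finset.sum_congr rfl fun s _ => by ring
    rw [e] at H
    -- Evaluation at -τ_m kills Θ, so only the digit of index 0 is seen.
    have h0 : Bdd c (x 0) := S.bdd_of_eval (hx 0 (by omega)) fun m => by
      have := H m 0 (by omega)
      rwa [shift_coeff_zero, eval_add, eval_mul, S.Θ_eval, zero_mul, add_zero] at this
    have h1 : ∀ m, BddTo d c (shift ω (S.τ m)
        (∑ s ∈ Finset.range (d + 1), S.Θ ^ s * (C ω * x (s + 1)))) := by
      intro m
      have e2 : ∑ s ∈ Finset.range (d + 1), S.Θ ^ s * (C ω * x (s + 1)) =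
          C ω * ∑ s ∈ Finset.range (d + 1), S.Θ ^ s * x (s + 1) := by
        rw [Finset.mul_sum]
        exact Finset.sum_congr rfl fun s _ => by ring
      rw [e2, shift_C_mul]
      -- Without the digit of index 0, the translate is ωX times the cofactor times the translate of
      -- the remaining sum. The cofactor is divided out, X lowers the range of indices from d + 1 to
      -- d, and ω is absorbed into the digits.
      refine bddTo_of_mul (S.cofactor_bdd hω m) (S.cofactor_coeff_zero ω m) fun i hi => ?_
      have h2 := norm_sub_le_of_le (H m (i + 1) (by omega)) (h0.shift hω (S.τ_le m) (i + 1))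
      rw [← coeff_sub, shift_add, add_sub_cancel_left, shift_mul, S.shift_Θ] at h2
      rw [show C ω * X * S.cofactor ω m * shift ω (S.τ m)
        (∑ s ∈ Finset.range (d + 1), S.Θ ^ s * x (s + 1)) = (S.cofactor ω m * (C ω * shift ω (S.τ m)
        (∑ s ∈ Finset.range (d + 1), S.Θ ^ s * x (s + 1)))) * X by ring, coeff_mul_X] at h2
      exact h2
    intro s hs
    rcases s with _ | s
    · simpa using h0
    · have := ih (fun s => C ω * x (s + 1)) (fun s hs i hi => by
        rw [coeff_C_mul, hx _ (by omega) i hi, mul_zero]) h1 s (by omega)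
      rwa [← mul_assoc, ← C_mul, ← pow_succ] at this

/-- The digit of index s is controlled up to ω^s and s ≤ d, so at most ω^d is lost. This is used
with ω = ϖ for crude bounds, and with ω = 1 when nothing may be lost. -/
theorem bdd_of_shift {ω : 𝕜} (hω : ‖ω‖ ≤ 1) {c : ℝ} (d : ℕ) {f : 𝕜[X]}
    (hf : f.natDegree < (d + 1) * q) (H : ∀ m, BddTo d c (shift ω (S.τ m) f)) :
    Bdd c (C (ω ^ d) * f) := by
  obtain ⟨x, hx, hfx⟩ := exists_digits S.Θ_monic S.Θ_natDegree
    (lt_of_lt_of_le (by norm_num) S.two_le_card) d f hf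
  rw [hfx] at H
  have h1 := S.bdd_digits_of_shift hω d x (fun s _ => hx s) H
  rw [hfx, Finset.mul_sum]
  refine Bdd.sum (h1 0 (by omega)).nonneg fun s hs => ?_
  rw [Finset.mem_range, Nat.lt_succ_iff] at hs
  rw [show C (ω ^ d) * (S.Θ ^ s * x s) = C (ω ^ (d - s)) * (S.Θ ^ s * (C (ω ^ s) * x s)) by
    rw [← Nat.sub_add_cancel hs, pow_add, C_mul, Nat.add_sub_cancel]; ring]
  refine (bdd_C (c := 1) ?_).one_mul ((S.Θ_bdd.pow s).one_mul (h1 s hs))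
  rw [norm_pow]
  exact pow_le_one₀ (norm_nonneg _) hω

/-- The leading terms cancel, so values at the points -τ_m suffice. They are ±(τ^q - τ) when q is
odd; for q even there is an extra 2τ, which is harmless since then p = 2. -/
theorem bdd_X_pow_sub_X_sub_Θ : Bdd ‖(S.p : 𝕜)‖ ((X : 𝕜[X]) ^ q - X - S.Θ) := by
  have h2 := S.two_le_card
  refine S.bdd_of_eval (fun i hi => ?_) fun m => ?_
  · rw [coeff_sub, coeff_sub, coeff_X_pow, coeff_X, if_neg (by omega : ¬ 1 = i)]
    split_ifs with h
    · subst h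
      have : S.Θ.coeff q = 1 := by
        have := S.Θ_monic
        rwa [Monic, leadingCoeff, S.Θ_natDegree] at this
      rw [this]; ring
    · rw [coeff_eq_zero_of_natDegree_lt (by rw [S.Θ_natDegree]; omega)]; ring
  · have e : ((X : 𝕜[X]) ^ q - X - S.Θ).eval (-S.τ m) =
        (-1) ^ q * (S.τ m ^ q - S.τ m) + ((-1) ^ q + 1) * S.τ m := by
      simp only [eval_sub, eval_pow, eval_X, S.Θ_eval]
      rw [neg_pow (S.τ m)]
      ring
    rw [e]
    refine norm_add_le_of_le ?_ ?_
    · rw [norm_mul, norm_pow, norm_neg, norm_one, one_pow, one_mul]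
      exact S.τ_frob m
    · rw [norm_mul]
      refine (mul_le_of_le_one_right (norm_nonneg _) (S.τ_le m)).trans ?_
      rcases Nat.even_or_odd q with he | ho
      · rw [he.neg_one_pow]
        have : S.p = 2 := by
          obtain ⟨n, hn, h⟩ := S.card
          rw [h, Nat.even_pow] at he
          exact S.prime.eq_two_or_odd'.resolve_right (by simpa using he.1)
        rw [this]
        norm_num
      · rw [ho.neg_one_pow]
        simp

/-- Modulo `p`, `(X + τ) ^ q` is `Θ + X + τ`. -/
theorem bdd_X_add_pow_sub (l : Λ) :
    Bdd ‖(S.p : 𝕜)‖ ((X + C (S.τ l)) ^ q - (S.Θ + (X + C (S.τ l)))) := by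
  have e : (X + C (S.τ l)) ^ q - (S.Θ + (X + C (S.τ l))) =
      ((X + C (S.τ l)) ^ q - X ^ q - C (S.τ l ^ q)) + (X ^ q - X - S.Θ) +
        C (S.τ l ^ q - S.τ l) := by
    simp only [map_sub]; ring
  rw [e]
  refine Bdd.add (Bdd.add (fun i => ?_) S.bdd_X_pow_sub_X_sub_Θ) (bdd_C (S.τ_frob l))
  have h2 := S.two_le_card
  rw [coeff_sub, coeff_sub, coeff_X_add_C_pow, coeff_X_pow, coeff_C]
  rcases Nat.lt_trichotomy i q with h | h | h
  · rw [if_neg h.ne]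
    split_ifs with h0
    · subst h0; simp
    · obtain ⟨n, hn, hc⟩ := S.card
      have hd : S.p ∣ (q).choose i := by
        rw [hc]
        exact S.prime.dvd_choose_pow h0 (by rw [← hc]; exact h.ne)
      rw [sub_zero, sub_zero, norm_mul]
      exact (mul_le_of_le_one_left (norm_nonneg _) (by
        rw [norm_pow]; exact pow_le_one₀ (norm_nonneg _) (S.τ_le l))).trans (S.norm_le_of_dvd hd)
  · subst h
    rw [if_neg (by omega : ¬ q = 0)]
    simp
  · rw [if_neg h.ne', if_neg (by omega), Nat.choose_eq_zero_of_lt h]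
    simp

end TreeData

end BreuilSchneider
end

/-! ### Lucas' congruences, and solutions of the eigenvalue equation on the tree of words -/

noncomputable section

namespace BreuilSchneider

open Polynomial

/-- Lucas' theorem in base p^n: the lowest base p digit is split off by the usual form, and
induction treats the rest. -/
theorem choose_modEq_of_prime_pow {p : ℕ} (hp : p.Prime) (n d r u w : ℕ) (hr : r < p ^ n)
    (hw : w < p ^ n) :
    (d * p ^ n + r).choose (u * p ^ n + w) ≡ d.choose u * r.choose w [MOD p] := by
  have := Fact.mk hp
  induction n generalizing r w with
  | zero =>
    obtain rfl : r = 0 := by simpa using hr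
    obtain rfl : w = 0 := by simpa using hw
    simpa using Nat.ModEq.refl _
  | succ n ih =>
    have e1 : ∀ a b : ℕ, (a * p ^ (n + 1) + b) % p = b % p := fun a b => by
      rw [pow_succ, ← mul_assoc, Nat.mul_add_mod']
    have e2 : ∀ a b : ℕ, (a * p ^ (n + 1) + b) / p = a * p ^ n + b / p := fun a b => by
      rw [pow_succ, ← mul_assoc, mul_comm _ p, Nat.mul_add_div hp.pos]
    have h1 := Choose.choose_modEq_choose_mod_mul_choose_div_nat (p := p)
      (n := d * p ^ (n + 1) + r) (k := u * p ^ (n + 1) + w)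
    rw [e1, e1, e2, e2] at h1
    have h2 := Choose.choose_modEq_choose_mod_mul_choose_div_nat (p := p) (n := r) (k := w)
    have h3 := ih (r / p) (w / p) (Nat.div_lt_of_lt_mul (by rwa [mul_comm, ← pow_succ]))
      (Nat.div_lt_of_lt_mul (by rwa [mul_comm, ← pow_succ]))
    calc _ ≡ (r % p).choose (w % p) * (d.choose u * (r / p).choose (w / p)) [MOD p] :=
          h1.trans (h3.mul_left _)
      _ = d.choose u * ((r % p).choose (w % p) * (r / p).choose (w / p)) := by ring
      _ ≡ _ [MOD p] := h2.symm.mul_left _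

/-- The hypothesis is applied with c the maximum of the norms; a positive maximum cannot be at most
δ times itself. This serves to invert systems known only up to a small perturbation. -/
theorem le_of_contraction {𝕜 ι : Type*} [NormedField 𝕜] (s : Finset ι) (y : ι → 𝕜) {e δ : ℝ}
    (he : 0 ≤ e) (hδ : δ < 1)
    (H : ∀ c, (∀ i ∈ s, ‖y i‖ ≤ c) → ∀ i ∈ s, ‖y i‖ ≤ max e (δ * c)) : ∀ i ∈ s, ‖y i‖ ≤ e := by
  intro i hi
  obtain ⟨j, hj, hmax⟩ := s.exists_max_image (fun i => ‖y i‖) ⟨i, hi⟩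
  have h := H _ hmax j hj
  refine (hmax i hi).trans ?_
  rcases le_max_iff.mp h with h | h
  · exact h
  · have : ‖y j‖ ≤ 0 := by nlinarith [norm_nonneg (y j)]
    exact this.trans he

namespace TreeData

variable {𝕜 : Type*} [NormedField 𝕜] {Λ : Type*} [Fintype Λ]
variable (S : TreeData 𝕜 Λ)

local notation "q" => Fintype.card Λ

/-- The contribution of the children of the vertex `v` to the Hecke operator. -/
def low (k : ℕ) (f : List Λ → 𝕜[X]) (v : List Λ) : 𝕜[X] :=
  ∑ l, lift k S.ϖ (S.τ l) (f (l :: v))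

/-- Finitely supported families of polynomials on the rooted tree of words which satisfy the
Hecke eigenvalue equation up to bounded polynomials beyond level `N`. -/
structure IsSol (N k : ℕ) (a : 𝕜) (f : List Λ → 𝕜[X]) : Prop where
  natDegree_le : ∀ v, (f v).natDegree ≤ k
  finite : ∃ M, ∀ v, M ≤ v.length → f v = 0
  eqn : ∀ m u, N ≤ u.length →
    Bdd 1 (shift S.ϖ (S.τ m) (f u) + S.low k f (m :: u) - C a * f (m :: u))

/-- Finite support starts a descending induction on the depth: all deeper levels are known when a
level is treated. -/
theorem IsSol.induction {S : TreeData 𝕜 Λ} {N k : ℕ} {a : 𝕜} {f : List Λ → 𝕜[X]}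
    (h : S.IsSol N k a f)
    {Q : ℕ → Prop} (N₁ : ℕ) (h0 : ∀ m, (∀ v, m ≤ v.length → f v = 0) → Q m)
    (step : ∀ m, N₁ ≤ m → (∀ j, m < j → Q j) → Q m) : ∀ m, N₁ ≤ m → Q m := by
  obtain ⟨M, hM⟩ := h.finite
  have key : ∀ n m, N₁ ≤ m → M ≤ m + n → Q m := by
    intro n
    induction n using Nat.strong_induction_on with
    | _ n ih =>
      intro m hm hn
      by_cases hMm : M ≤ m
      · exact h0 m fun v hv => hM v (hMm.trans hv)
      · refine step m hm fun j hj => ?_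
        by_cases hMj : M ≤ j
        · exact h0 j fun v hv => hM v (hMj.trans hv)
        · exact ih (M - j) (by omega) j (by omega) (by omega)
  exact fun m hm => key M m hm (by omega)

theorem low_C_mul (k : ℕ) (f : List Λ → 𝕜[X]) (v : List Λ) (x : 𝕜) :
    C x * S.low k f v = S.low k (fun v => C x * f v) v := by
  simp only [low, lift_C_mul, Finset.mul_sum]

variable [IsUltrametricDist 𝕜]

/-- Telescoping: two exponents differing by q - 1 give a multiple of x^q - x. This needs n ≥ 1, as
x^0 = 1 even for x = 0. -/
theorem norm_pow_add_sub_le {e : ℝ} {x : 𝕜} (hx : ‖x‖ ≤ 1) (h : ‖x ^ q - x‖ ≤ e) (n : ℕ)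
    (hn : 1 ≤ n) (j : ℕ) : ‖x ^ (n + j * (q - 1)) - x ^ n‖ ≤ e := by
  have hq : 1 ≤ q ∨ q = 0 := by omega
  rcases hq with hq | hq
  swap
  · simp only [hq, Nat.zero_sub, mul_zero, add_zero, sub_self, norm_zero]
    exact (norm_nonneg _).trans h
  induction j with
  | zero => simpa using (norm_nonneg _).trans h
  | succ j ih =>
    have e1 : x ^ (n + (j + 1) * (q - 1)) - x ^ n =
        x ^ (n - 1 + j * (q - 1)) * (x ^ q - x) + (x ^ (n + j * (q - 1)) - x ^ n) := by
      rw [mul_sub, ← pow_add, ← pow_succ,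
        show n - 1 + j * (q - 1) + q = n + (j + 1) * (q - 1) by
          obtain ⟨t, ht⟩ : ∃ t, q = t + 1 := ⟨q - 1, by omega⟩
          rw [ht, Nat.add_sub_cancel]
          have : (j + 1) * t = j * t + t := by ring
          omega,
        show n - 1 + j * (q - 1) + 1 = n + j * (q - 1) by omega]
      ring
    rw [e1]
    refine norm_add_le_of_le ?_ ih
    rw [norm_mul, norm_pow]
    exact (mul_le_of_le_one_left (norm_nonneg _) (pow_le_one₀ (norm_nonneg _) hx)).trans h

theorem norm_choose_sub_le {d r u w : ℕ} (hr : r < q) (hw : w < q) :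
    ‖(((d * q + r).choose (u * q + w) : ℕ) : 𝕜) - ((d.choose u : ℕ) : 𝕜) * ((r.choose w : ℕ) : 𝕜)‖ ≤
      ‖(S.p : 𝕜)‖ := by
  obtain ⟨n, -, h⟩ := S.card
  have h1 := choose_modEq_of_prime_pow S.prime n d r u w (by rwa [← h]) (by rwa [← h])
  rw [← h] at h1
  obtain ⟨x, hx⟩ := (Nat.modEq_iff_dvd.mp h1.symm)
  have h2 : (((d * q + r).choose (u * q + w) : ℕ) : 𝕜) - ((d.choose u : ℕ) : 𝕜) *
      ((r.choose w : ℕ) : 𝕜) = (S.p : 𝕜) * (x : 𝕜) := by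
    have := congrArg (Int.cast : ℤ → 𝕜) hx
    push_cast at this
    exact this
  rw [h2, norm_mul]
  exact mul_le_of_le_one_right (norm_nonneg _) (norm_intCast_le x)

/-- The system of equations satisfied by the moments of the leading coefficients is invertible. -/
theorem norm_le_of_binomial_system {d r w : ℕ} (hr : r < q) (hwd : w ≤ d) (hdr : d ≤ r + 1)
    (hdp : d < S.p) (y : ℕ → 𝕜) {e : ℝ}
    (H : ∀ w' < w, ‖∑ t ∈ Finset.range w,
      (((d * q + (r - t)).choose ((w - w') * q + w') : ℕ) : 𝕜) * y t‖ ≤ e) :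
    ∀ t ∈ Finset.range w, ‖y t‖ ≤ e := by
  rcases Nat.eq_zero_or_pos w with rfl | hw0
  · simp
  have he : 0 ≤ e := (norm_nonneg _).trans (H 0 hw0)
  have hpq : S.p ≤ q := Nat.le_of_dvd (by omega) S.p_dvd_card
  -- Lucas' congruence replaces each matrix entry by a product of two binomials with an error
  -- divisible by p, hence of norm at most |ϖ|; the contraction absorbs this error.
  refine le_of_contraction _ y he S.ϖ_lt fun c hc => ?_
  have hc0 : 0 ≤ c := (norm_nonneg _).trans (hc 0 (Finset.mem_range.mpr hw0))
  set c' := max e (‖S.ϖ‖ * c)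
  have hc' : 0 ≤ c' := he.trans (le_max_left _ _)
  have h1 : ∀ w' < w, ‖∑ t ∈ Finset.range w, (((r - t).choose w' : ℕ) : 𝕜) * y t‖ ≤ c' := by
    intro w' hw'
    have h2 : ‖∑ t ∈ Finset.range w, ((((d * q + (r - t)).choose ((w - w') * q + w') : ℕ) : 𝕜) -
        ((d.choose (w - w') : ℕ) : 𝕜) * (((r - t).choose w' : ℕ) : 𝕜)) * y t‖ ≤ c' := by
      refine norm_sum_le_of_le hc' fun t ht => ?_
      rw [norm_mul]
      exact (mul_le_mul ((S.norm_choose_sub_le (by omega) (by omega)).trans S.p_le) (hc t ht)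
        (norm_nonneg _) (norm_nonneg _)).trans (le_max_right _ _)
    have h3 := norm_sub_le_of_le ((H w' hw').trans (le_max_left e (‖S.ϖ‖ * c))) h2
    rw [← Finset.sum_sub_distrib] at h3
    have h4 : ∑ t ∈ Finset.range w, ((((d * q + (r - t)).choose ((w - w') * q + w') : ℕ) : 𝕜) * y t -
        ((((d * q + (r - t)).choose ((w - w') * q + w') : ℕ) : 𝕜) -
        ((d.choose (w - w') : ℕ) : 𝕜) * (((r - t).choose w' : ℕ) : 𝕜)) * y t) =
        ((d.choose (w - w') : ℕ) : 𝕜) *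
          ∑ t ∈ Finset.range w, (((r - t).choose w' : ℕ) : 𝕜) * y t := by
      rw [Finset.mul_sum]
      exact Finset.sum_congr rfl fun t _ => by ring
    -- The factor C(d, w - w') divides d!, so it is prime to p because d < p.
    rw [h4, norm_mul, S.norm_natCast, one_mul] at h3
    · exact h3
    · intro hdvd
      have h5 : S.p ∣ d.factorial := by
        rw [← Nat.choose_mul_factorial_mul_factorial (by omega : w - w' ≤ d), mul_assoc]
        exact Dvd.dvd.mul_right hdvd _
      rw [S.prime.dvd_factorial] at h5
      omega
  -- The remaining system says that the coefficients of index below w of ∑ y_t (1 + X)^(r - t) = (1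
  -- + X)^(r + 1 - w) Q(1 + X) are small. The first factor has constant term 1 and Q has degree
  -- below w, so Q(1 + X), and then Q, is small.
  set Q : 𝕜[X] := ∑ t ∈ Finset.range w, C (y t) * X ^ (w - 1 - t) with hQ
  have h2 : BddTo (w - 1) c' ((1 + X) ^ (r + 1 - w) * Q.comp (1 + X)) := by
    intro i hi
    have e1 : (1 + X) ^ (r + 1 - w) * Q.comp (1 + X) =
        ∑ t ∈ Finset.range w, C (y t) * (1 + X) ^ (r - t) := by
      rw [hQ, Polynomial.sum_comp, Finset.mul_sum]
      refine Finset.sum_congr rfl fun t ht => ?_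
      rw [Finset.mem_range] at ht
      simp only [mul_comp, C_comp, pow_comp, X_comp]
      rw [show r - t = (r + 1 - w) + (w - 1 - t) by omega, pow_add]
      ring
    rw [e1, finsetSum_coeff]
    simp only [coeff_C_mul, coeff_one_add_X_pow]
    have := h1 i (by omega)
    simpa only [mul_comm] using this
  have hX : Bdd 1 (1 + X : 𝕜[X]) := bdd_one.add bdd_X
  have h3 := bddTo_of_mul (hX.pow (r + 1 - w)) (by simp [coeff_one_add_X_pow]) h2
  have hdegQ : Q.natDegree ≤ w - 1 := natDegree_sum_le_of_forall_le _ _ fun t _ =>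
    (natDegree_C_mul_X_pow_le _ _).trans (by omega)
  have h4 : Bdd c' (Q.comp (1 + X)) := by
    intro i
    by_cases hi : i ≤ w - 1
    · exact h3 i hi
    · rw [coeff_eq_zero_of_natDegree_lt, norm_zero]
      · exact hc'
      · have h5 : (1 + X : 𝕜[X]).natDegree ≤ 1 := by
          rw [add_comm]; exact (natDegree_X_add_C (1 : 𝕜)).le
        have h6 : (Q.comp (1 + X)).natDegree ≤ (w - 1) * 1 :=
          natDegree_comp_le.trans (Nat.mul_le_mul hdegQ h5)
        omega
  have h5 : Bdd c' Q := by
    have h6 := h4.comp (g := X - 1) (bdd_X.sub bdd_one)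
    rw [comp_assoc] at h6
    simpa using h6
  intro t ht
  have h6 := h5 (w - 1 - t)
  rw [Finset.mem_range] at ht
  rw [hQ, finsetSum_coeff, Finset.sum_eq_single t] at h6
  · simpa using h6
  · intro b hb hbt
    rw [Finset.mem_range] at hb
    rw [coeff_C_mul_X_pow, if_neg (by omega)]
  · intro h; exact absurd (Finset.mem_range.mpr ht) h

end TreeData

end BreuilSchneider
end

/-! ### Eigenvalues of valuation at least d -/

noncomputable section

namespace BreuilSchneider

open Polynomial

namespace TreeData

variable {𝕜 : Type*} [NormedField 𝕜] [IsUltrametricDist 𝕜] {Λ : Type*} [Fintype Λ]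
variable (S : TreeData 𝕜 Λ)

local notation "q" => Fintype.card Λ

/-- If the coefficients of index at least `q` of a sum of lifts are small, then so are those of
small positive index. -/
theorem norm_coeff_sum_lift_le {k d r : ℕ} (hk : k = d * q + r) (hr : r < q) (hdr : d ≤ r + 1)
    (hdp : d < S.p) (hd2 : 2 * d ≤ q)
    (hfrob : ∀ l, ‖S.τ l ^ q - S.τ l‖ ≤ ‖S.ϖ‖ ^ d)
    (b : Λ → 𝕜[X]) (hb : ∀ l, Bdd 1 (b l))
    (H : ∀ i, q ≤ i → ‖(∑ l, lift k S.ϖ (S.τ l) (b l)).coeff i‖ ≤ ‖S.ϖ‖ ^ d)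
    {w : ℕ} (hw0 : 1 ≤ w) (hwd : w ≤ d) :
    ‖(∑ l, lift k S.ϖ (S.τ l) (b l)).coeff w‖ ≤ ‖S.ϖ‖ ^ w := by
  have hq2 := S.two_le_card
  have hpi0 := S.ϖ_pos.le
  have hpi1 := S.ϖ_lt.le
  have hdw : ‖S.ϖ‖ ^ d ≤ ‖S.ϖ‖ ^ w := pow_le_pow_of_le_one hpi0 hpi1 hwd
  have hwk : w ≤ k := by
    have : d * 1 ≤ d * q := Nat.mul_le_mul_left _ (by omega)
    omega
  have hdq : (d - w) * q + w * q = d * q := by rw [← add_mul]; congr 1; omega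
  -- A single exponent for all the indices n = (w - w')q + w': there k - t - n = x t + w'(q - 1),
  -- and multiples of q - 1 are removed by the Frobenius congruence.
  set x : ℕ → ℕ := fun t => (d - w) * q + (r - t)
  set y : ℕ → 𝕜 := fun t => S.ϖ ^ t * ∑ l, (b l).coeff (k - t) * S.τ l ^ x t with hy
  -- Modulo ϖ^w these coefficients are combinations of the moments y_t with t < w; the terms with t
  -- ≥ w carry ϖ^t.
  have key : ∀ w' ≤ w, ‖(∑ l, lift k S.ϖ (S.τ l) (b l)).coeff ((w - w') * q + w') -
      ∑ t ∈ Finset.range w, (((d * q + (r - t)).choose ((w - w') * q + w') : ℕ) : 𝕜) * y t‖ ≤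
      ‖S.ϖ‖ ^ w := by
    intro w' hw'
    set n := (w - w') * q + w' with hn
    have e1 : (∑ l, lift k S.ϖ (S.τ l) (b l)).coeff n = ∑ t ∈ Finset.range (w + (k + 1 - w)),
        ∑ l, (b l).coeff (k - t) * S.ϖ ^ t * (S.τ l ^ (k - t - n) * ((k - t).choose n : 𝕜)) := by
      rw [finsetSum_coeff]
      simp only [lift_coeff]
      rw [Finset.sum_comm, ← Finset.sum_range_reflect, show w + (k + 1 - w) = k + 1 by omega]
      refine Finset.sum_congr rfl fun t ht => ?_
      rw [Finset.mem_range] at ht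
      rw [show k + 1 - 1 - t = k - t by omega, show k - (k - t) = t by omega]
    rw [e1, Finset.sum_range_add, add_sub_right_comm, ← Finset.sum_sub_distrib]
    refine norm_add_le_of_le ?_ ?_
    · refine norm_sum_le_of_le (by positivity) fun t ht => ?_
      rw [Finset.mem_range] at ht
      have hkt : d * q + (r - t) = k - t := by omega
      rw [hkt, hy]
      simp only
      rw [Finset.mul_sum, Finset.mul_sum, ← Finset.sum_sub_distrib]
      refine norm_sum_le_of_le (by positivity) fun l _ => ?_
      rcases Nat.lt_or_ge (k - t) n with hlt | hge
      · rw [Nat.choose_eq_zero_of_lt hlt]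
        simp only [Nat.cast_zero, mul_zero, zero_mul, sub_self, norm_zero]
        positivity
      have hexp : k - t - n = x t + w' * (q - 1) := by
        have h1 : (w - w') * q + w' * q = w * q := by rw [← add_mul]; congr 1; omega
        have h2 : w' * (q - 1) + w' = w' * q := by
          obtain ⟨s, hs⟩ : ∃ s, q = s + 1 := ⟨q - 1, by omega⟩
          rw [hs, Nat.add_sub_cancel]; ring
        simp only [x]
        omega
      rw [hexp, show (b l).coeff (k - t) * S.ϖ ^ t * (S.τ l ^ (x t + w' * (q - 1)) *
          ((k - t).choose n : 𝕜)) - ((k - t).choose n : 𝕜) *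
          (S.ϖ ^ t * ((b l).coeff (k - t) * S.τ l ^ x t)) =
        ((b l).coeff (k - t)) * (S.ϖ ^ t * ((k - t).choose n : 𝕜)) *
          (S.τ l ^ (x t + w' * (q - 1)) - S.τ l ^ x t) by ring, norm_mul, norm_mul, norm_mul]
      by_cases hx : 1 ≤ x t
      · refine (mul_le_of_le_one_left (norm_nonneg _) ?_).trans
          ((norm_pow_add_sub_le (S.τ_le l) (hfrob l) _ hx w').trans hdw)
        refine mul_le_one₀ (hb l _) (by positivity) (mul_le_one₀ ?_ (norm_nonneg _)
          (norm_natCast_le _))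
        rw [norm_pow]; exact pow_le_one₀ hpi0 hpi1
      · rcases Nat.eq_zero_or_pos w' with h0 | hpos
        · subst h0
          simp only [zero_mul, add_zero, sub_self, norm_zero, mul_zero]
          positivity
        -- For exponent 0 the Frobenius congruence is not available. Then t = r = w - 1, the term
        -- already carries ϖ^(w - 1), and the binomial is divisible by p, as C(0, w') = 0.
        · have hx0 : (d - w) * q + (r - t) = 0 := by simp only [x] at hx; omega
          have hrt : r - t = 0 := by omega
          have hwt : w = t + 1 := by
            have : (d - w) * q = 0 := by omega
            rcases Nat.mul_eq_zero.mp this with h | h <;> omega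
          have hC : ‖((k - t).choose n : 𝕜)‖ ≤ ‖S.ϖ‖ := by
            have h1 := S.norm_choose_sub_le (d := d) (r := r - t) (u := w - w') (w := w')
              (by omega) (by omega)
            rw [hrt, Nat.choose_eq_zero_of_lt hpos, Nat.cast_zero, mul_zero, sub_zero, ← hn,
              ← hrt, hkt] at h1
            exact h1.trans S.p_le
          have h2 : ‖S.τ l ^ (x t + w' * (q - 1)) - S.τ l ^ x t‖ ≤ 1 :=
            norm_sub_le_of_le (by rw [norm_pow]; exact pow_le_one₀ (norm_nonneg _) (S.τ_le l))
              (by rw [norm_pow]; exact pow_le_one₀ (norm_nonneg _) (S.τ_le l))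
          refine (mul_le_of_le_one_right (by positivity) h2).trans
            ((mul_le_of_le_one_left (by positivity) (hb l _)).trans ?_)
          rw [hwt, pow_succ, norm_pow]
          exact mul_le_mul_of_nonneg_left hC (by positivity)
    · refine norm_sum_le_of_le (by positivity) fun t _ => ?_
      refine norm_sum_le_of_le (by positivity) fun l _ => ?_
      rw [norm_mul, norm_mul, norm_mul, norm_pow, norm_pow]
      calc _ ≤ 1 * ‖S.ϖ‖ ^ (w + t) * (1 * 1) := by
            refine mul_le_mul (mul_le_mul_of_nonneg_right (hb l _) (by positivity))
              (mul_le_mul (pow_le_one₀ (norm_nonneg _) (S.τ_le l)) (norm_natCast_le _)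
                (norm_nonneg _) zero_le_one) (by positivity) (by positivity)
        _ ≤ _ := by
            rw [one_mul, mul_one, mul_one]
            exact pow_le_pow_of_le_one hpi0 hpi1 (by omega)
  -- For w' < w the index is at least q, where smallness is assumed; the w equations determine the w
  -- moments. The case w' = w then gives the coefficient of index w itself.
  have hyw := S.norm_le_of_binomial_system hr hwd hdr hdp y (e := ‖S.ϖ‖ ^ w) fun w' hw' => by
    have h1 : q ≤ (w - w') * q + w' := by
      have : 1 * q ≤ (w - w') * q := Nat.mul_le_mul_right _ (by omega)
      omega
    have h2 := norm_sub_le_of_le ((H _ h1).trans hdw) (key w' hw'.le)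
    rwa [sub_sub_cancel] at h2
  have h1 := key w le_rfl
  rw [Nat.sub_self, zero_mul, zero_add] at h1
  have h2 : ‖∑ t ∈ Finset.range w, (((d * q + (r - t)).choose w : ℕ) : 𝕜) * y t‖ ≤ ‖S.ϖ‖ ^ w :=
    norm_sum_le_of_le (by positivity) fun t ht => by
      rw [norm_mul]
      exact (mul_le_of_le_one_left (norm_nonneg _) (norm_natCast_le _)).trans (hyw t ht)
  have h3 := norm_add_le_of_le h1 h2
  rwa [sub_add_cancel] at h3

/-- Boundedness of the solutions when the eigenvalue is small. -/
theorem IsSol.bdd_of_norm_le_pow {S : TreeData 𝕜 Λ} {N k d r : ℕ} {a : 𝕜} {f : List Λ → 𝕜[X]}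
    (h : S.IsSol N k a f) (hk : k = d * q + r) (hr : r < q) (hdr : d ≤ r + 1)
    (hdp : d < S.p) (hd2 : 2 * d ≤ q) (ha : ‖a‖ ≤ ‖S.ϖ‖ ^ d)
    (hfrob : ∀ l, ‖S.τ l ^ q - S.τ l‖ ≤ ‖S.ϖ‖ ^ d) :
    ∀ v, N ≤ v.length → Bdd 1 (C (S.ϖ ^ d) * f v) := by
  have hpi0 := S.ϖ_pos.le
  have hpi1 := S.ϖ_lt.le
  have main : ∀ m, N ≤ m → ∀ u : List Λ, u.length = m → Bdd 1 (C (S.ϖ ^ d) * f u) := by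
    refine h.induction (Q := fun m => ∀ u : List Λ, u.length = m → Bdd 1 (C (S.ϖ ^ d) * f u)) N
      (fun m hm u hu => by rw [hm u hu.ge, mul_zero]; exact bdd_zero zero_le_one) ?_
    intro n hn ih u hu
    set F : List Λ → 𝕜[X] := fun v => C (S.ϖ ^ d) * f v with hF
    have hF1 : ∀ v, n < v.length → Bdd 1 (F v) := fun v hv => ih _ hv v rfl
    have hsum : ∀ m, Bdd (‖S.ϖ‖ ^ d) (shift S.ϖ (S.τ m) (F u) + S.low k F (m :: u)) := by
      intro m
      have h1 := (h.eqn m u (by omega)).C_mul (S.ϖ ^ d)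
      rw [mul_one, norm_pow] at h1
      have h2 : Bdd (‖S.ϖ‖ ^ d) (C a * F (m :: u)) := by
        have := (hF1 (m :: u) (by simp; omega)).C_mul a
        rw [mul_one] at this
        exact this.mono ha
      have h3 := h1.add h2
      rw [mul_sub, mul_add, S.low_C_mul, ← shift_C_mul] at h3
      have e : C (S.ϖ ^ d) * (C a * f (m :: u)) = C a * F (m :: u) := by simp only [hF]; ring
      rw [e, sub_add_cancel] at h3
      exact h3
    have hH : ∀ m, Bdd 1 (S.low k F (m :: u)) := fun m =>
      Bdd.sum zero_le_one fun l _ => (hF1 _ (by simp; omega)).lift hpi1 (S.τ_le l)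
    have hpid : ‖S.ϖ‖ ^ d ≤ 1 := pow_le_one₀ hpi0 hpi1
    have hG : ∀ m, Bdd 1 (shift S.ϖ (S.τ m) (F u)) := fun m => by
      have := ((hsum m).mono hpid).sub (hH m)
      rwa [add_sub_cancel_right] at this
    have hdeg : (F u).natDegree < (d + 1) * q := by
      refine lt_of_le_of_lt ((natDegree_C_mul_le _ _).trans (h.natDegree_le u)) ?_
      rw [hk, add_mul]; omega
    -- A bound losing ϖ^d is enough in degrees i ≥ q: the translate carries ϖ^i, and i - d ≥ d since
    -- 2d ≤ q.
    have hcrude := S.bdd_of_shift hpi1 d hdeg fun m => (hG m).bddTo d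
    have hhigh : ∀ m i, q ≤ i → ‖(S.low k F (m :: u)).coeff i‖ ≤ ‖S.ϖ‖ ^ d := by
      intro m i hi
      have h1 : ‖(shift S.ϖ (S.τ m) (F u)).coeff i‖ ≤ ‖S.ϖ‖ ^ d := by
        have h2 := hcrude.norm_shift_coeff_le (ω := S.ϖ) (S.τ_le m) i
        rw [shift_C_mul, coeff_C_mul, norm_mul, norm_pow, mul_one] at h2
        have h3 : ‖S.ϖ‖ ^ i ≤ ‖S.ϖ‖ ^ d * ‖S.ϖ‖ ^ d := by
          rw [← pow_add]; exact pow_le_pow_of_le_one hpi0 hpi1 (by omega)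
        exact le_of_mul_le_mul_left (h2.trans h3) (pow_pos S.ϖ_pos d)
      have h2 := norm_sub_le_of_le (hsum m i) h1
      rwa [coeff_add, add_sub_cancel_left] at h2
    -- The coefficient of index w of F(u)(ϖX - τ_m) is ϖ^w times that of F(u)(X - τ_m). Its bound by
    -- |ϖ|^w therefore lets ω = ϖ be replaced by ω = 1, where recovering F(u) loses nothing.
    have hlow : ∀ m, BddTo d 1 (shift 1 (S.τ m) (F u)) := by
      intro m w hw
      have h1 : ‖(S.low k F (m :: u)).coeff w‖ ≤ ‖S.ϖ‖ ^ w := by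
        rcases Nat.eq_zero_or_pos w with rfl | hw0
        · simpa using hH m 0
        · exact S.norm_coeff_sum_lift_le hk hr hdr hdp hd2 hfrob _
            (fun l => hF1 _ (by simp; omega)) (hhigh m) hw0 hw
      have h2 := norm_sub_le_of_le ((hsum m w).trans (pow_le_pow_of_le_one hpi0 hpi1 hw)) h1
      rw [coeff_add, add_sub_cancel_right, shift_coeff, norm_mul, norm_pow] at h2
      exact le_of_mul_le_mul_left (by simpa using h2) (pow_pos S.ϖ_pos w)
    have h3 := S.bdd_of_shift (ω := 1) (by simp) d hdeg hlow
    rw [one_pow, map_one, one_mul] at h3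
    exact h3
  exact fun v hv => main _ hv v rfl

end TreeData

end BreuilSchneider
end

/-! ### Tame families and Θ-adic digits of the sum over the children -/

noncomputable section

namespace BreuilSchneider

open Polynomial

theorem Bdd.of_C_mul {𝕜 : Type*} [NormedField 𝕜] {c : ℝ} {x : 𝕜} {f : 𝕜[X]} (hx : x ≠ 0)
    (h : Bdd c (C x * f)) : Bdd (‖x‖⁻¹ * c) f := fun i => by
  have := h i
  rw [coeff_C_mul, norm_mul] at this
  rwa [inv_mul_eq_div, le_div_iff₀ (norm_pos_iff.mpr hx), mul_comm]

theorem Bdd.pow_sub_pow {𝕜 : Type*} [NormedField 𝕜] [IsUltrametricDist 𝕜] {e : ℝ} {f g : 𝕜[X]}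
    (hf : Bdd 1 f) (hg : Bdd 1 g) (h : Bdd e (f - g)) (n : ℕ) : Bdd e (f ^ n - g ^ n) := by
  induction n with
  | zero => simpa using bdd_zero h.nonneg
  | succ n ih =>
    rw [show f ^ (n + 1) - g ^ (n + 1) = f ^ n * (f - g) + (f ^ n - g ^ n) * g by ring]
    exact ((hf.pow n).one_mul h).add (ih.mul_one hg)

namespace TreeData

variable {𝕜 : Type*} [NormedField 𝕜] {Λ : Type*} [Fintype Λ]
variable (S : TreeData 𝕜 Λ)

local notation "q" => Fintype.card Λ

/-- The bounds propagated towards the root when the eigenvalue `a` is not too small. -/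
structure Tame (k m : ℕ) (a : 𝕜) (g : 𝕜[X]) : Prop where
  bdd : Bdd (‖a‖⁻¹ * ‖a‖⁻¹) g
  lead : ∀ i ≤ k, ‖g.coeff i * S.ϖ ^ (k - i)‖ ≤ ‖a‖⁻¹
  tail : ∀ i < m, ‖g.coeff i * S.ϖ ^ (k - i)‖ ≤ 1

/-- The `Θ`-adic digit of index `s` of the contribution of the children of `v`, up to a binomial
coefficient. -/
def digit (d r s : ℕ) (f : List Λ → 𝕜[X]) (v : List Λ) : 𝕜[X] :=
  ∑ l, ∑ j ∈ Finset.range (r + 1),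
    C ((f (l :: v)).coeff (d * q + j) * S.ϖ ^ (r - j)) * (X + C (S.τ l)) ^ (d - s + j)

theorem natDegree_digit_le (d r s : ℕ) (f : List Λ → 𝕜[X]) (v : List Λ) :
    (S.digit d r s f v).natDegree ≤ d - s + r := by
  refine natDegree_sum_le_of_forall_le _ _ fun l _ => natDegree_sum_le_of_forall_le _ _
    fun j hj => (natDegree_C_mul_le _ _).trans ?_
  rw [Finset.mem_range] at hj
  refine (natDegree_pow_le.trans (Nat.mul_le_mul_left _ (natDegree_X_add_C _).le)).trans ?_
  omega

variable [IsUltrametricDist 𝕜]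

/-- Raise (X + τ)^q ≡ Θ + (X + τ) to the power d and expand in powers of Θ. -/
theorem bdd_X_add_pow_sub_sum (d j : ℕ) (l : Λ) :
    Bdd ‖(S.p : 𝕜)‖ ((X + C (S.τ l)) ^ (d * q + j) - ∑ s ∈ Finset.range (d + 1),
      S.Θ ^ s * ((d.choose s : 𝕜[X]) * (X + C (S.τ l)) ^ (d - s + j))) := by
  have h1 := ((bdd_X_add_C (S.τ_le l)).pow q).pow_sub_pow
    (S.Θ_bdd.add (bdd_X_add_C (S.τ_le l))) (S.bdd_X_add_pow_sub l) d
  have h2 := h1.mul_one ((bdd_X_add_C (S.τ_le l)).pow j)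
  rw [sub_mul, ← pow_mul, mul_comm q d, ← pow_add, add_pow S.Θ, Finset.sum_mul] at h2
  convert h2 using 3
  rw [pow_add]
  ring

theorem Tame.bdd_digit {S : TreeData 𝕜 Λ} {k d r : ℕ} {a : 𝕜} {f : List Λ → 𝕜[X]} {v : List Λ}
    (hk : k = d * q + r) (h : ∀ l, S.Tame k (d * q) a (f (l :: v))) (s : ℕ) :
    Bdd ‖a‖⁻¹ (S.digit d r s f v) := by
  have hA : 0 ≤ ‖a‖⁻¹ := by positivity
  refine Bdd.sum hA fun l _ => Bdd.sum hA fun j hj => ?_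
  rw [Finset.mem_range] at hj
  have := (h l).lead (d * q + j) (by omega)
  rw [show k - (d * q + j) = r - j by omega] at this
  exact (bdd_C this).mul_one ((bdd_X_add_C (S.τ_le l)).pow _)

theorem Tame.bdd_low {S : TreeData 𝕜 Λ} {k m : ℕ} {a : 𝕜} {f : List Λ → 𝕜[X]} {v : List Λ}
    (h : ∀ l, S.Tame k m a (f (l :: v))) : Bdd ‖a‖⁻¹ (S.low k f v) :=
  Bdd.sum (by positivity) fun l _ => bdd_lift (by positivity) (S.τ_le l) (h l).lead

/-- The `Θ`-adic expansion of the contribution of the children of `v`. -/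
theorem Tame.bdd_low_sub {S : TreeData 𝕜 Λ} {k d r : ℕ} {a : 𝕜} {f : List Λ → 𝕜[X]} {v : List Λ}
    (hk : k = d * q + r) (hp : ‖(S.p : 𝕜)‖ ≤ ‖a‖) (h : ∀ l, S.Tame k (d * q) a (f (l :: v))) :
    Bdd 1 (S.low k f v - ∑ s ∈ Finset.range (d + 1),
      S.Θ ^ s * ((d.choose s : 𝕜[X]) * S.digit d r s f v)) := by
  have e : S.low k f v - ∑ s ∈ Finset.range (d + 1),
      S.Θ ^ s * ((d.choose s : 𝕜[X]) * S.digit d r s f v) =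
      ∑ l, (∑ i ∈ Finset.range (d * q),
        C ((f (l :: v)).coeff i * S.ϖ ^ (k - i)) * (X + C (S.τ l)) ^ i +
      ∑ j ∈ Finset.range (r + 1), C ((f (l :: v)).coeff (d * q + j) * S.ϖ ^ (r - j)) *
        ((X + C (S.τ l)) ^ (d * q + j) - ∑ s ∈ Finset.range (d + 1),
          S.Θ ^ s * ((d.choose s : 𝕜[X]) * (X + C (S.τ l)) ^ (d - s + j)))) := by
    have e1 : ∑ s ∈ Finset.range (d + 1), S.Θ ^ s * ((d.choose s : 𝕜[X]) * S.digit d r s f v) =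
        ∑ l, ∑ j ∈ Finset.range (r + 1), C ((f (l :: v)).coeff (d * q + j) * S.ϖ ^ (r - j)) *
          ∑ s ∈ Finset.range (d + 1),
          S.Θ ^ s * ((d.choose s : 𝕜[X]) * (X + C (S.τ l)) ^ (d - s + j)) := by
      simp only [digit, Finset.mul_sum]
      rw [Finset.sum_comm]
      refine Finset.sum_congr rfl fun l _ => ?_
      rw [Finset.sum_comm]
      refine Finset.sum_congr rfl fun j _ => Finset.sum_congr rfl fun s _ => ?_
      ring
    rw [e1, low, ← Finset.sum_sub_distrib]
    refine Finset.sum_congr rfl fun l _ => ?_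
    rw [lift, show k + 1 = d * q + (r + 1) by omega, Finset.sum_range_add, add_sub_assoc,
      ← Finset.sum_sub_distrib]
    congr 1
    refine Finset.sum_congr rfl fun j hj => ?_
    rw [Finset.mem_range] at hj
    rw [show k - (d * q + j) = r - j by omega]
    ring
  rw [e]
  -- Indices below dq contribute integrally by `Tame.tail`. For the others, bounded by |a|⁻¹, the
  -- error of the congruence modulo p compensates since |p| ≤ |a|.
  refine Bdd.sum zero_le_one fun l _ => Bdd.add ?_ ?_
  · refine Bdd.sum zero_le_one fun i hi => ?_
    exact (bdd_C ((h l).tail i (Finset.mem_range.mp hi))).mul_one ((bdd_X_add_C (S.τ_le l)).pow i)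
  · refine Bdd.sum zero_le_one fun j hj => ?_
    rw [Finset.mem_range] at hj
    have h1 := (h l).lead (d * q + j) (by omega)
    rw [show k - (d * q + j) = r - j by omega] at h1
    refine ((bdd_C h1).mul (S.bdd_X_add_pow_sub_sum d j l)).mono ?_
    by_cases ha : ‖a‖ = 0
    · simp [ha]
    · calc ‖a‖⁻¹ * ‖(S.p : 𝕜)‖ ≤ ‖a‖⁻¹ * ‖a‖ := mul_le_mul_of_nonneg_left hp (by positivity)
        _ = 1 := inv_mul_cancel₀ ha

/-- The conditions on the weight and the eigenvalue under which tameness gives a first estimate at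
the next vertices. -/
structure Admissible (k d r : ℕ) (a : 𝕜) : Prop where
  weight : k = d * q + r
  one_le : 1 ≤ d
  add_lt : d + r < q
  two_mul_le : 2 * d ≤ q
  ne_zero : a ≠ 0
  norm_le : ‖a‖ ≤ 1
  norm_p_le : ‖(S.p : 𝕜)‖ ≤ ‖a‖
  norm_pow_le : ‖S.ϖ‖ ^ (q - d) ≤ ‖a‖

/-- The estimates at the children of `u` when the vertices further down are tame. -/
structure Estimates (d r : ℕ) (a : 𝕜) (k : ℕ) (f : List Λ → 𝕜[X]) (u : List Λ) : Prop where
  child : ∀ m, Bdd (‖a‖⁻¹ * ‖a‖⁻¹) (f (m :: u))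
  coeff : ∀ m i, q ≤ i → ‖a * (f (m :: u)).coeff i - (S.low k f (m :: u)).coeff i‖ ≤ 1
  shift_add_digit : ∀ m, Bdd 1 (shift S.ϖ (S.τ m) (f u) + S.digit d r 0 f (m :: u))
  shift : ∀ m, Bdd ‖a‖⁻¹ (shift S.ϖ (S.τ m) (f u))
  digit : ∀ m s, 1 ≤ s → s ≤ d →
    Bdd ((‖S.ϖ‖ ^ s)⁻¹) ((d.choose s : 𝕜[X]) * S.digit d r s f (m :: u))

/-- The equation is used at two levels. At the grandchildren of u it bounds the translates of f(m ::
u), hence the Θ-digits of a f(m :: u). At the children of u it compares, in degrees at least q,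
these digits with those of the sum over the children of m :: u. -/
theorem IsSol.estimates {S : TreeData 𝕜 Λ} {N k d r : ℕ} {a : 𝕜} {f : List Λ → 𝕜[X]}
    (h : S.IsSol N k a f) (had : S.Admissible k d r a) {u : List Λ} (hu : N ≤ u.length)
    (ht : ∀ w : List Λ, u.length + 2 ≤ w.length → S.Tame k (d * q) a (f w)) :
    S.Estimates d r a k f u := by
  obtain ⟨hk, -, hdr, hd2, ha, hA1, hp, hqd⟩ := had
  have hpi0 := S.ϖ_pos.le
  have hpi1 := S.ϖ_lt.le
  have hApos : 0 < ‖a‖ := norm_pos_iff.mpr ha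
  have hA : 1 ≤ ‖a‖⁻¹ := (one_le_inv₀ hApos).mpr hA1
  have hAA : ‖a‖ * (‖a‖⁻¹ * ‖a‖⁻¹) = ‖a‖⁻¹ := by
    rw [← mul_assoc, mul_inv_cancel₀ hApos.ne', one_mul]
  have hdeg : ∀ v, (f v).natDegree < (d + 1) * q := fun v =>
    (h.natDegree_le v).trans_lt (by rw [hk, add_mul]; omega)
  have hchild : ∀ m l, S.Tame k (d * q) a (f (l :: m :: u)) := fun m l => ht _ (by simp)
  have hlow : ∀ m, Bdd ‖a‖⁻¹ (S.low k f (m :: u)) := fun m => Tame.bdd_low (hchild m)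
  have c1 : ∀ m m', Bdd ‖a‖⁻¹ (BreuilSchneider.shift S.ϖ (S.τ m') (f (m :: u))) := by
    intro m m'
    have h1 := (h.eqn m' (m :: u) (by simp; omega)).mono hA
    have h2 : Bdd ‖a‖⁻¹ (S.low k f (m' :: m :: u)) :=
      Tame.bdd_low (m := d * q) fun l => ht _ (by simp)
    have h3 : Bdd ‖a‖⁻¹ (C a * f (m' :: m :: u)) := by
      have := (hchild m m').bdd.C_mul a
      rwa [hAA] at this
    have h4 := (h1.add h3).sub h2
    rwa [sub_add_cancel, add_sub_cancel_right] at h4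
  have ha1 : ∀ m m', Bdd 1 (BreuilSchneider.shift S.ϖ (S.τ m') (C a * f (m :: u))) := by
    intro m m'
    rw [shift_C_mul]
    have := (c1 m m').C_mul a
    rwa [mul_inv_cancel₀ hApos.ne'] at this
  have hdega : ∀ v, (C a * f v).natDegree < (d + 1) * q := fun v =>
    (natDegree_C_mul_le _ _).trans_lt (hdeg v)
  -- The first term bounds a f(m :: u), recovered from its translates, and the second the sum over
  -- the children of m :: u.
  set c := max ((‖S.ϖ‖ ^ d)⁻¹) ‖a‖⁻¹ with hc
  have h1c : 1 ≤ c := hA.trans (le_max_right _ _)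
  have hfu : ∀ m, Bdd c (BreuilSchneider.shift S.ϖ (S.τ m) (f u)) := by
    intro m
    have h1 := S.bdd_of_shift hpi1 d (hdega (m :: u)) fun m' => (ha1 m m').bddTo d
    have h2 := h1.of_C_mul (pow_ne_zero _ (norm_pos_iff.mp S.ϖ_pos))
    rw [norm_pow, mul_one] at h2
    have h3 := (((h.eqn m u hu).mono h1c).add (h2.mono (le_max_left _ _))).sub
      ((hlow m).mono (le_max_right _ _))
    rwa [sub_add_cancel, add_sub_cancel_right] at h3
  -- Recovering f(u) costs another ϖ^d, and the index gives back ϖ^q; what is left is integral by 2d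
  -- ≤ q and |ϖ|^(q - d) ≤ |a|.
  have hhigh : ∀ m i, q ≤ i → ‖(BreuilSchneider.shift S.ϖ (S.τ m) (f u)).coeff i‖ ≤ 1 := by
    intro m i hi
    have h1 := (S.bdd_of_shift hpi1 d (hdeg u) fun m => (hfu m).bddTo d).of_C_mul
      (pow_ne_zero _ (norm_pos_iff.mp S.ϖ_pos))
    rw [norm_pow] at h1
    have h2 := h1.norm_shift_coeff_le (ω := S.ϖ) (S.τ_le m) i
    refine h2.trans ?_
    have h3 : ‖S.ϖ‖ ^ i * ((‖S.ϖ‖ ^ d)⁻¹ * c) ≤ ‖S.ϖ‖ ^ (q - d) * c := by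
      have : ‖S.ϖ‖ ^ i ≤ ‖S.ϖ‖ ^ (q - d) * ‖S.ϖ‖ ^ d := by
        rw [← pow_add]; exact pow_le_pow_of_le_one hpi0 hpi1 (by omega)
      calc _ ≤ (‖S.ϖ‖ ^ (q - d) * ‖S.ϖ‖ ^ d) * ((‖S.ϖ‖ ^ d)⁻¹ * c) :=
            mul_le_mul_of_nonneg_right this (by positivity)
        _ = _ := by
            have := (pow_pos S.ϖ_pos d).ne'
            field_simp
    refine h3.trans ?_
    rw [hc, mul_max_of_nonneg _ _ (by positivity)]
    refine max_le ?_ ?_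
    · rw [← div_eq_mul_inv, div_le_one (pow_pos S.ϖ_pos d)]
      exact pow_le_pow_of_le_one hpi0 hpi1 (by omega)
    · rw [← div_eq_mul_inv, div_le_one hApos]
      exact hqd
  have c3 : ∀ m i, q ≤ i → ‖a * (f (m :: u)).coeff i - (S.low k f (m :: u)).coeff i‖ ≤ 1 := by
    intro m i hi
    have := norm_sub_le_of_le (hhigh m i hi) (h.eqn m u hu i)
    rw [coeff_sub, coeff_add, coeff_C_mul] at this
    rwa [show (BreuilSchneider.shift S.ϖ (S.τ m) (f u)).coeff i -
      ((BreuilSchneider.shift S.ϖ (S.τ m) (f u)).coeff i + (S.low k f (m :: u)).coeff i -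
        a * (f (m :: u)).coeff i) = a * (f (m :: u)).coeff i - (S.low k f (m :: u)).coeff i
      by ring] at this
  have hq0 : 0 < q := by have := S.two_le_card; omega
  have main : ∀ m, Bdd ‖a‖⁻¹ (C a * f (m :: u)) ∧
      Bdd 1 (BreuilSchneider.shift S.ϖ (S.τ m) (f u) + S.digit d r 0 f (m :: u)) ∧
      ∀ s, 1 ≤ s → s ≤ d →
        Bdd ((‖S.ϖ‖ ^ s)⁻¹) ((d.choose s : 𝕜[X]) * S.digit d r s f (m :: u)) := by
    intro m
    obtain ⟨G, hG, hfG⟩ := exists_digits S.Θ_monic S.Θ_natDegree hq0 d _ (hdega (m :: u))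
    have hG1 := S.bdd_digits_of_shift hpi1 d G (fun s _ => hG s) fun m' => by
      rw [← hfG]; exact (ha1 m m').bddTo d
    have hG0 : Bdd 1 (G 0) := by simpa using hG1 0 (by omega)
    have hGA := bdd_digits_of_high S.Θ_bdd S.Θ_monic S.Θ_natDegree (c := ‖a‖⁻¹) (by positivity) d G
      (fun s _ => hG s) fun i hi => by
        rw [← hfG, coeff_C_mul]
        have := norm_add_le_of_le ((c3 m i hi).trans hA) (hlow m i)
        rwa [sub_add_cancel] at this
    refine ⟨?_, ?_⟩
    · rw [hfG]
      refine Bdd.sum (by positivity) fun s hs => (S.Θ_bdd.pow s).one_mul ?_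
      rcases Nat.eq_zero_or_pos s with rfl | hs0
      · exact hG0.mono hA
      · exact hGA s hs0 (by simpa [Nat.lt_succ_iff] using hs)
    have hPQ := Tame.bdd_low_sub hk hp (hchild m)
    set Q := ∑ s ∈ Finset.range (d + 1),
      S.Θ ^ s * ((d.choose s : 𝕜[X]) * S.digit d r s f (m :: u)) with hQ
    set x : ℕ → 𝕜[X] := fun s => G s - (d.choose s : 𝕜[X]) * S.digit d r s f (m :: u) with hx
    have hxQ : C a * f (m :: u) - Q = ∑ s ∈ Finset.range (d + 1), S.Θ ^ s * x s := by
      rw [hfG, hQ, ← Finset.sum_sub_distrib]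
      exact Finset.sum_congr rfl fun s _ => by rw [hx]; ring
    -- As d - s + r < q, the polynomials `digit` have degree below q, so the x s are genuine
    -- Θ-digits, and those of positive index are seen by the coefficients of index at least q.
    have hx1 := bdd_digits_of_high S.Θ_bdd S.Θ_monic S.Θ_natDegree zero_le_one d x
      (fun s _ i hi => by
        rw [hx]
        simp only
        rw [coeff_sub, hG s i hi, ← C_eq_natCast, coeff_C_mul,
          coeff_eq_zero_of_natDegree_lt
            (lt_of_le_of_lt (S.natDegree_digit_le d r s f _) (by omega))]
        ring) fun i hi => by
        rw [← hxQ]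
        have := norm_add_le_of_le (c3 m i hi) (hPQ i)
        rw [coeff_sub] at this
        rw [coeff_sub, coeff_C_mul]
        rwa [sub_add_sub_cancel] at this
    refine ⟨?_, fun s hs1 hs2 => ?_⟩
    · have h1 : Bdd 1 (C a * f (m :: u) - Q - x 0) := by
        rw [hxQ, Finset.sum_range_succ', pow_zero, one_mul, add_sub_cancel_right]
        refine Bdd.sum zero_le_one fun s hs => (S.Θ_bdd.pow _).one_mul (hx1 _ (by omega) ?_)
        rw [Finset.mem_range] at hs
        omega
      have h2 := (((h.eqn m u hu).add h1).add hG0).sub hPQ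
      rw [hx] at h2
      simp only [Nat.choose_zero_right, Nat.cast_one, one_mul] at h2
      convert h2 using 1
      ring
    · have hs : (1 : ℝ) ≤ (‖S.ϖ‖ ^ s)⁻¹ :=
        (one_le_inv₀ (pow_pos S.ϖ_pos s)).mpr (pow_le_one₀ hpi0 hpi1)
      have h1 := (hG1 s hs2).of_C_mul (pow_ne_zero _ (norm_pos_iff.mp S.ϖ_pos))
      rw [norm_pow, mul_one] at h1
      have h2 := h1.sub ((hx1 s hs1 hs2).mono hs)
      rw [hx] at h2
      simpa using h2
  refine ⟨fun m => ?_, c3, fun m => (main m).2.1, fun m => ?_, fun m => (main m).2.2⟩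
  · exact (main m).1.of_C_mul ha
  · have := ((main m).2.1.mono hA).sub (Tame.bdd_digit hk (hchild m) 0)
    rwa [add_sub_cancel_right] at this

end TreeData

end BreuilSchneider
end

/-! ### Newton interpolation, and the case where r is large compared with v(a) -/

noncomputable section

namespace BreuilSchneider

open Polynomial

section Newton

variable {𝕜 : Type*} [NormedField 𝕜]

/-- By Pascal's rule each difference lowers the bottom entry of the binomial by one. -/
theorem fwdDiff_iter_choose_add_eq_zero (b : ℕ) {l i : ℕ} (h : l < i) :
    (fwdDiff 1)^[i] (fun x : ℕ => ((x + b).choose l : 𝕜)) = 0 := by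
  have h0 : ∀ n, (fwdDiff 1)^[n] (0 : ℕ → 𝕜) = 0 := fun n => by
    have := fwdDiff_iter_const_smul (h := 1) (0 : 𝕜) (0 : ℕ → 𝕜) n
    simpa using this
  induction l generalizing i with
  | zero =>
    obtain ⟨n, rfl⟩ : ∃ n, i = n + 1 := ⟨i - 1, by omega⟩
    rw [Function.iterate_succ_apply]
    have : fwdDiff 1 (fun x : ℕ => ((x + b).choose 0 : 𝕜)) = 0 := by
      ext x; simp [fwdDiff]
    rw [this, h0]
  | succ l ih =>
    obtain ⟨n, rfl⟩ : ∃ n, i = n + 1 := ⟨i - 1, by omega⟩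
    rw [Function.iterate_succ_apply]
    have : fwdDiff 1 (fun x : ℕ => ((x + b).choose (l + 1) : 𝕜)) =
        fun x : ℕ => ((x + b).choose l : 𝕜) := by
      ext x
      rw [fwdDiff, show x + 1 + b = (x + b) + 1 by ring, Nat.choose_succ_succ']
      push_cast
      ring
    rw [this, ih (by omega)]

/-- Newton's formula for s ↦ W(d - s) at s = d. The weights C(d, s) may be divisible by p, but C(d,
k) C(k, s) = C(d, s) C(d - s, k - s) shows that only the weighted values C(d, s) W(d - s) enter. -/
theorem norm_le_of_fwdDiff [IsUltrametricDist 𝕜] {W : ℕ → 𝕜} {t d : ℕ}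
    (hW : ∀ i, t < i → (fwdDiff 1)^[i] W = 0) {c : ℝ} (hc : 0 ≤ c)
    (H : ∀ s ≤ t, ‖(d.choose s : 𝕜) * W (d - s)‖ ≤ c) : ‖W 0‖ ≤ c := by
  have h1 := shift_eq_sum_fwdDiff_iter (1 : ℕ) (fun s => W (d - s)) d 0
  simp only [smul_eq_mul, mul_one, zero_add, Nat.sub_self] at h1
  rw [h1]
  refine norm_sum_le_of_le hc fun k hk => ?_
  rw [Finset.mem_range] at hk
  rw [fwdDiff_iter_eq_sum_shift]
  rcases Nat.lt_or_ge t k with htk | htk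
  -- Differences of order k of the reversed sequence are, up to sign, those of W at d - k, and
  -- vanish for k > t.
  · have h2 := congrFun (hW k htk) (d - k)
    rw [fwdDiff_iter_eq_sum_shift, ← Finset.sum_range_reflect] at h2
    have h3 : ∑ j ∈ Finset.range (k + 1), ((-1 : ℤ) ^ (k - j) * (k.choose j : ℤ)) •
        W (d - (0 + j • 1)) = (-1 : ℤ) ^ k • ∑ j ∈ Finset.range (k + 1),
          ((-1 : ℤ) ^ (k - (k + 1 - 1 - j)) * (k.choose (k + 1 - 1 - j) : ℤ)) •
            W (d - k + (k + 1 - 1 - j) • 1) := by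
      rw [Finset.smul_sum]
      refine Finset.sum_congr rfl fun j hj => ?_
      rw [Finset.mem_range] at hj
      rw [smul_smul, Nat.add_sub_cancel, Nat.choose_symm (by omega), Nat.sub_sub_self (by omega),
        ← mul_assoc, ← pow_add, show k + j = (k - j) + 2 * j by omega, pow_add, pow_mul]
      congr 1
      · simp
      · congr 1; simp only [smul_eq_mul]; omega
    rw [h3, h2]
    simpa using hc
  · rw [Finset.smul_sum]
    refine norm_sum_le_of_le hc fun s hs => ?_
    rw [Finset.mem_range] at hs
    have e : d.choose k • ((-1 : ℤ) ^ (k - s) * (k.choose s : ℤ)) • W (d - (0 + s • 1)) =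
        ((-1 : 𝕜) ^ (k - s) * ((d - s).choose (k - s) : 𝕜)) * ((d.choose s : 𝕜) * W (d - s)) := by
      have h2 : (d.choose k : 𝕜) * (k.choose s : 𝕜) =
          (d.choose s : 𝕜) * ((d - s).choose (k - s) : 𝕜) := by
        exact_mod_cast congrArg (Nat.cast : ℕ → 𝕜) (Nat.choose_mul (n := d) (show s ≤ k by omega))
      simp only [nsmul_eq_mul, zsmul_eq_mul, smul_eq_mul, mul_one, zero_add]
      push_cast
      linear_combination ((-1 : 𝕜) ^ (k - s) * W (d - s)) * h2
    rw [e, norm_mul]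
    refine (mul_le_of_le_one_left (norm_nonneg _) ?_).trans (H s (by omega))
    rw [norm_mul, norm_pow, norm_neg, norm_one, one_pow, one_mul]
    exact norm_natCast_le _

end Newton

namespace TreeData

variable {𝕜 : Type*} [NormedField 𝕜] {Λ : Type*} [Fintype Λ]
variable (S : TreeData 𝕜 Λ)

local notation "q" => Fintype.card Λ

theorem digit_coeff (d r s : ℕ) (f : List Λ → 𝕜[X]) (v : List Λ) (n : ℕ) :
    (S.digit d r s f v).coeff n = ∑ j ∈ Finset.range (r + 1), ∑ l,
      (f (l :: v)).coeff (d * q + j) * S.ϖ ^ (r - j) *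
        (S.τ l ^ (d - s + j - n) * ((d - s + j).choose n : 𝕜)) := by
  rw [digit, Finset.sum_comm]
  simp only [finsetSum_coeff, coeff_C_mul, coeff_X_add_C_pow]

variable [IsUltrametricDist 𝕜]

/-- By Lucas C(dq + i, dq + j) ≡ C(i, j) modulo p, and |p| ≤ |a| compensates the bound |a|⁻¹.
Coefficients of index below dq do not reach degree dq + j. -/
theorem Tame.norm_low_coeff_sub_le {S : TreeData 𝕜 Λ} {k d r : ℕ} {a : 𝕜} {f : List Λ → 𝕜[X]}
    {v : List Λ} (had : S.Admissible k d r a) (h : ∀ l, S.Tame k (d * q) a (f (l :: v))) {j : ℕ}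
    (hj : j ≤ r) :
    ‖(S.low k f v).coeff (d * q + j) - (S.digit d r d f v).coeff j‖ ≤ 1 := by
  have hk := had.weight
  have hr : r < q := by have := had.add_lt; omega
  rw [S.digit_coeff, low, finsetSum_coeff, Finset.sum_comm, ← Finset.sum_sub_distrib]
  refine norm_sum_le_of_le zero_le_one fun l _ => ?_
  rw [lift_coeff, show k + 1 = d * q + (r + 1) by omega, Finset.sum_range_add,
    Finset.sum_eq_zero, zero_add, ← Finset.sum_sub_distrib]
  · refine norm_sum_le_of_le zero_le_one fun i hi => ?_
    rw [Finset.mem_range] at hi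
    have h1 := (h l).lead (d * q + i) (by omega)
    have h2 := S.norm_choose_sub_le (d := d) (r := i) (u := d) (w := j) (by omega) (by omega)
    rw [Nat.choose_self, Nat.cast_one, one_mul] at h2
    rw [show k - (d * q + i) = r - i by omega] at h1 ⊢
    rw [show d * q + i - (d * q + j) = i - j by omega, Nat.sub_self, zero_add, ← mul_sub,
      ← mul_sub, norm_mul, norm_mul (S.τ l ^ _), norm_pow (S.τ l)]
    refine (mul_le_mul h1 (mul_le_mul (pow_le_one₀ (norm_nonneg _) (S.τ_le l))
      (h2.trans had.norm_p_le) (norm_nonneg _) zero_le_one) (by positivity) (by positivity)).trans ?_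
    rw [one_mul, inv_mul_cancel₀ (norm_ne_zero_iff.mpr had.ne_zero)]
  · intro i hi
    rw [Finset.mem_range] at hi
    rw [Nat.choose_eq_zero_of_lt (by omega)]
    simp

/-- The loss of ϖ^d in recovering f(u) is compensated by the factor ϖ^(d + j) carried by the
coefficient. -/
theorem Estimates.norm_shift_coeff_le {S : TreeData 𝕜 Λ} {N k d r : ℕ} {a : 𝕜}
    {f : List Λ → 𝕜[X]} (hs : S.IsSol N k a f) (had : S.Admissible k d r a) {u : List Λ}
    (h : S.Estimates d r a k f u) (m : Λ) (j : ℕ) :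
    ‖(BreuilSchneider.shift S.ϖ (S.τ m) (f u)).coeff (d + j)‖ ≤ ‖S.ϖ‖ ^ j * ‖a‖⁻¹ := by
  have h1 := (S.bdd_of_shift S.ϖ_lt.le d (f := f u) ((hs.natDegree_le u).trans_lt (by
    have := had.weight; have := had.add_lt; rw [add_mul]; omega))
    fun m => (h.shift m).bddTo d).of_C_mul (pow_ne_zero _ (norm_pos_iff.mp S.ϖ_pos))
  refine (h1.norm_shift_coeff_le (S.τ_le m) (d + j)).trans (le_of_eq ?_)
  have := (pow_pos S.ϖ_pos d).ne'
  rw [pow_add, norm_pow]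
  field_simp

/-- Boundedness of the solutions when the remainder of the weight is at least the valuation of the
eigenvalue. -/
theorem IsSol.bdd_of_pow_le {S : TreeData 𝕜 Λ} {N k d r : ℕ} {a : 𝕜} {f : List Λ → 𝕜[X]}
    (h : S.IsSol N k a f) (had : S.Admissible k d r a) (hra : ‖S.ϖ‖ ^ r ≤ ‖a‖)
    (hra2 : ‖S.ϖ‖ ^ (r + 1) ≤ ‖a‖ * ‖a‖) :
    ∀ v, N + 1 ≤ v.length → Bdd (‖a‖⁻¹ * ‖a‖⁻¹) (f v) := by
  have hpi0 := S.ϖ_pos.le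
  have hpi1 := S.ϖ_lt.le
  have hk := had.weight
  have hApos : 0 < ‖a‖ := norm_pos_iff.mpr had.ne_zero
  have hA : 1 ≤ ‖a‖⁻¹ := (one_le_inv₀ hApos).mpr had.norm_le
  have main : ∀ n, N + 1 ≤ n → ∀ v : List Λ, v.length = n → S.Tame k (d * q) a (f v) := by
    refine h.induction (Q := fun n => ∀ v : List Λ, v.length = n → S.Tame k (d * q) a (f v)) _
      (fun n hn v hv => ?_) ?_
    · rw [hn v hv.ge]
      exact ⟨bdd_zero (by positivity), fun i _ => by simp, fun i _ => by simp⟩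
    intro n hn ih v hv
    obtain ⟨m, u, rfl⟩ : ∃ m u, v = m :: u := by
      cases v with
      | nil => simp at hv; omega
      | cons m u => exact ⟨m, u, rfl⟩
    rw [List.length_cons] at hv
    have ht : ∀ w : List Λ, u.length + 2 ≤ w.length → S.Tame k (d * q) a (f w) :=
      fun w hw => ih _ (by omega) w rfl
    have E := h.estimates had (by omega) ht
    have htail : ∀ i < d * q, ‖(f (m :: u)).coeff i * S.ϖ ^ (k - i)‖ ≤ 1 := by
      intro i hi
      rw [norm_mul, norm_pow]
      calc _ ≤ (‖a‖⁻¹ * ‖a‖⁻¹) * (‖a‖ * ‖a‖) := by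
            refine mul_le_mul (E.child m i) (le_trans ?_ hra2) (by positivity) (by positivity)
            exact pow_le_pow_of_le_one hpi0 hpi1 (by omega)
        _ = 1 := by field_simp
    refine ⟨E.child m, fun i hi => ?_, htail⟩
    rcases Nat.lt_or_ge i (d * q) with hlt | hge
    · exact (htail i hlt).trans hA
    obtain ⟨j, rfl⟩ : ∃ j, i = d * q + j := ⟨i - d * q, by omega⟩
    have hjr : j ≤ r := by omega
    rw [show k - (d * q + j) = r - j by omega]
    have hchild : ∀ l, S.Tame k (d * q) a (f (l :: m :: u)) := fun l => ht _ (by simp)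
    have hpow : ∀ n, ‖S.ϖ‖ ^ n ≤ 1 := fun n => pow_le_one₀ hpi0 hpi1
    -- The digit of index d is known up to ϖ^d, which suffices if r - j ≥ d. Otherwise the other
    -- digits must be used.
    have key : ‖S.ϖ ^ (r - j) * (S.digit d r d f (m :: u)).coeff j‖ ≤ 1 := by
      rw [norm_mul, norm_pow]
      have hpos : ∀ n, 0 < ‖S.ϖ‖ ^ n := fun n => pow_pos S.ϖ_pos n
      rcases Nat.lt_or_ge (r - j) d with hjd | hjd
      swap
      · have h1 := E.digit m d had.one_le le_rfl j
        rw [Nat.choose_self, Nat.cast_one, one_mul] at h1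
        calc _ ≤ ‖S.ϖ‖ ^ d * (‖S.ϖ‖ ^ d)⁻¹ := mul_le_mul
              (pow_le_pow_of_le_one hpi0 hpi1 hjd) h1 (norm_nonneg _) (by positivity)
          _ = 1 := mul_inv_cancel₀ (hpos d).ne'
      set Y : ℕ → 𝕜 := fun i => ∑ l, (f (l :: m :: u)).coeff (d * q + i) * S.ϖ ^ (r - i) *
        S.τ l ^ (i - j) with hY
      -- In the terms with i ≥ j, C(x + i, x + j) = C(x + i, i - j) is a polynomial in x of degree i
      -- - j ≤ r - j; the others vanish. One function W thus interpolates the coefficient of index d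
      -- - s + j of the digit of index s, for all s.
      set W : ℕ → 𝕜 := ∑ i ∈ Finset.range (r + 1), Y i • fun x => ((x + i).choose (x + j) : 𝕜) with hWdef
      have hW : ∀ s ≤ d, (S.digit d r s f (m :: u)).coeff (d - s + j) = W (d - s) := by
        intro s hs
        rw [S.digit_coeff, hWdef, Finset.sum_apply]
        refine Finset.sum_congr rfl fun i _ => ?_
        rw [Pi.smul_apply, smul_eq_mul, hY, Finset.sum_mul]
        refine Finset.sum_congr rfl fun l _ => ?_
        rw [show d - s + i - (d - s + j) = i - j by omega]
        ring
      have hdiff : ∀ i, r - j < i → (fwdDiff 1)^[i] W = 0 := by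
        intro i hi
        rw [hWdef, fwdDiff_iter_finsetSum]
        refine Finset.sum_eq_zero fun i' hi' => ?_
        rw [Finset.mem_range] at hi'
        rw [fwdDiff_iter_const_smul]
        rcases Nat.lt_or_ge i' j with hlt | hge
        · have : (fun x : ℕ => ((x + i').choose (x + j) : 𝕜)) = (0 : 𝕜) • 0 := by
            ext x
            rw [Nat.choose_eq_zero_of_lt (by omega)]
            simp
          rw [this, fwdDiff_iter_const_smul, zero_smul, smul_zero]
        · have : (fun x : ℕ => ((x + i').choose (x + j) : 𝕜)) =
              fun x : ℕ => ((x + i').choose (i' - j) : 𝕜) := by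
            ext x
            rw [Nat.choose_symm_of_eq_add (show x + i' = (x + j) + (i' - j) by omega)]
          rw [this, fwdDiff_iter_choose_add_eq_zero _ (by omega), smul_zero]
      have hN := norm_le_of_fwdDiff (t := r - j) (d := d) hdiff
        (c := (‖S.ϖ‖ ^ (r - j))⁻¹) (by positivity) fun s hs => by
          rw [← hW s (by omega)]
          rcases Nat.eq_zero_or_pos s with rfl | hs0
          -- For s = 0 the digit is minus the translate of f(u) up to an integral error; here |ϖ|^r
          -- ≤ |a| enters.
          · have h1 : ‖(BreuilSchneider.shift S.ϖ (S.τ m) (f u)).coeff (d + j)‖ ≤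
                (‖S.ϖ‖ ^ (r - j))⁻¹ := by
              refine (E.norm_shift_coeff_le h had m j).trans ?_
              rw [← div_eq_mul_inv, ← one_div, div_le_div_iff₀ hApos (hpos _), ← pow_add,
                show j + (r - j) = r by omega, one_mul]
              exact hra
            have h2 := norm_sub_le_of_le ((E.shift_add_digit m (d + j)).trans
              ((one_le_inv₀ (hpos _)).mpr (hpow _))) h1
            rw [coeff_add, add_sub_cancel_left] at h2
            simpa using h2
          · have h1 := E.digit m s hs0 (by omega) (d - s + j)
            rw [← C_eq_natCast, coeff_C_mul] at h1
            exact h1.trans (inv_anti₀ (hpos _) (pow_le_pow_of_le_one hpi0 hpi1 hs))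
      have h0 := hW d le_rfl
      rw [Nat.sub_self, zero_add] at h0
      rw [h0]
      calc _ ≤ ‖S.ϖ‖ ^ (r - j) * (‖S.ϖ‖ ^ (r - j))⁻¹ :=
            mul_le_mul_of_nonneg_left hN (by positivity)
        _ = 1 := mul_inv_cancel₀ (hpos _).ne'
    have hq : q ≤ d * q + j := by
      have : 1 * q ≤ d * q := Nat.mul_le_mul_right _ had.one_le
      omega
    have hsmall : ∀ x : 𝕜, ‖x‖ ≤ 1 → ‖S.ϖ ^ (r - j) * x‖ ≤ 1 := fun x hx => by
      rw [norm_mul, norm_pow]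
      exact mul_le_one₀ (hpow _) (norm_nonneg _) hx
    have h1 := norm_add_le_of_le (norm_add_le_of_le (hsmall _ (E.coeff m _ hq))
      (hsmall _ (Tame.norm_low_coeff_sub_le had hchild hjr))) key
    rw [show S.ϖ ^ (r - j) * (a * (f (m :: u)).coeff (d * q + j) -
        (S.low k f (m :: u)).coeff (d * q + j)) + S.ϖ ^ (r - j) *
        ((S.low k f (m :: u)).coeff (d * q + j) - (S.digit d r d f (m :: u)).coeff j) +
        S.ϖ ^ (r - j) * (S.digit d r d f (m :: u)).coeff j =
        a * ((f (m :: u)).coeff (d * q + j) * S.ϖ ^ (r - j)) by ring, norm_mul] at h1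
    rwa [← one_div, le_div_iff₀ hApos, mul_comm]
  exact fun v hv => (main _ hv v rfl).bdd

end TreeData

end BreuilSchneider
end

/-! ### Weights dq with d ≥ 2 -/

noncomputable section

namespace BreuilSchneider

open Polynomial

namespace TreeData

variable {𝕜 : Type*} [NormedField 𝕜] {Λ : Type*} [Fintype Λ]
variable (S : TreeData 𝕜 Λ)

local notation "q" => Fintype.card Λ

theorem norm_sum_neg_pow_le {j : ℕ} (hj : j < q - 1) : ‖∑ l, (-S.τ l) ^ j‖ ≤ ‖S.ϖ‖ := by
  have : ∑ l, (-S.τ l) ^ j = (-1) ^ j * ∑ l, S.τ l ^ j := by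
    rw [Finset.mul_sum]
    exact Finset.sum_congr rfl fun l _ => neg_pow _ _
  rw [this, norm_mul, norm_pow, norm_neg, norm_one, one_pow, one_mul]
  exact S.sum_pow j hj

variable [IsUltrametricDist 𝕜]

/-- Summation over l gains a factor ϖ beyond the obvious ϖ²: the coefficient of index i enters with
C(i, 2) times a power sum of exponent i - 2. The power sum is divisible by ϖ except possibly at i =
q + 1 and i = 2q, where C(i, 2) is divisible by p. -/
theorem norm_sum_shift_coeff_two_le (hq : 4 ≤ q) {f : 𝕜[X]} (hdeg : f.natDegree ≤ 2 * q) {c : ℝ}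
    (hf : Bdd c f) : ‖∑ l, (shift S.ϖ (S.τ l) f).coeff 2‖ ≤ ‖S.ϖ‖ ^ 3 * c := by
  have hc := hf.nonneg
  have hpi0 := S.ϖ_pos.le
  have e : ∑ l, (shift S.ϖ (S.τ l) f).coeff 2 = S.ϖ ^ 2 * ∑ i ∈ Finset.range (2 * q + 1),
      f.coeff i * ((i.choose 2 : 𝕜) * ∑ l, (-S.τ l) ^ (i - 2)) := by
    have : ∀ l, (shift S.ϖ (S.τ l) f).coeff 2 = S.ϖ ^ 2 * ∑ i ∈ Finset.range (2 * q + 1),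
        f.coeff i * ((-S.τ l) ^ (i - 2) * (i.choose 2 : 𝕜)) := by
      intro l
      rw [shift_coeff, shift]
      nth_rewrite 1 [as_sum_range_C_mul_X_pow' f (Nat.lt_succ_of_le hdeg)]
      rw [Polynomial.sum_comp, finsetSum_coeff]
      congr 1
      refine Finset.sum_congr rfl fun i _ => ?_
      rw [C_mul_comp, X_pow_comp, coeff_C_mul, map_one, one_mul, sub_eq_add_neg, ← C_neg,
        coeff_X_add_C_pow]
    simp only [this]
    rw [← Finset.mul_sum, Finset.sum_comm]
    congr 1
    refine Finset.sum_congr rfl fun i _ => ?_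
    rw [Finset.mul_sum, Finset.mul_sum]
    refine Finset.sum_congr rfl fun l _ => ?_
    ring
  rw [e, norm_mul, norm_pow, pow_succ ‖S.ϖ‖ 2, mul_assoc]
  refine mul_le_mul_of_nonneg_left ?_ (by positivity)
  refine norm_sum_le_of_le (by positivity) fun i hi => ?_
  rw [Finset.mem_range] at hi
  rw [norm_mul, mul_comm]
  refine mul_le_mul ?_ (hf i) (norm_nonneg _) hpi0
  have hpow : ∀ n, ‖∑ l, (-S.τ l) ^ n‖ ≤ 1 := fun n => norm_sum_le_of_le zero_le_one fun l _ => by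
    rw [norm_pow, norm_neg]; exact pow_le_one₀ (norm_nonneg _) (S.τ_le l)
  have hch : ∀ x y, y < q → y < 2 → i = x * q + y → ‖(i.choose 2 : 𝕜)‖ ≤ ‖S.ϖ‖ := by
    intro x y hy hy2 hi
    have := S.norm_choose_sub_le (d := x) (r := y) (u := 0) (w := 2) hy (by omega)
    rw [Nat.choose_eq_zero_of_lt hy2, Nat.cast_zero, mul_zero, sub_zero, zero_mul, zero_add,
      ← hi] at this
    exact this.trans S.p_le
  rw [norm_mul]
  rcases Nat.lt_trichotomy (i - 2) (q - 1) with h | h | h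
  · exact (mul_le_of_le_one_left (norm_nonneg _) (norm_natCast_le _)).trans (S.norm_sum_neg_pow_le h)
  · exact (mul_le_of_le_one_right (norm_nonneg _) (hpow _)).trans
      (hch 1 1 (by omega) (by omega) (by omega))
  · rcases Nat.lt_or_ge i (2 * q) with h2 | h2
    · refine (mul_le_of_le_one_left (norm_nonneg _) (norm_natCast_le _)).trans ?_
      obtain ⟨n, hn, hn1⟩ : ∃ n, i - 2 = n + 1 * (q - 1) ∧ 1 ≤ n :=
        ⟨i - 2 - (q - 1), by omega, by omega⟩
      have e2 : ∑ l, (-S.τ l) ^ (i - 2) = (-1) ^ (i - 2) *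
          (∑ l, (S.τ l ^ (n + 1 * (q - 1)) - S.τ l ^ n) + ∑ l, S.τ l ^ n) := by
        rw [← Finset.sum_add_distrib, Finset.mul_sum]
        refine Finset.sum_congr rfl fun l _ => ?_
        rw [neg_pow, hn]; ring
      rw [e2, norm_mul, norm_pow, norm_neg, norm_one, one_pow, one_mul]
      refine norm_add_le_of_le (norm_sum_le_of_le hpi0 fun l _ => ?_) (S.sum_pow n (by omega))
      exact norm_pow_add_sub_le (S.τ_le l) ((S.τ_frob l).trans S.p_le) n hn1 1
    · exact (mul_le_of_le_one_right (norm_nonneg _) (hpow _)).trans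
        (hch 2 0 (by omega) (by omega) (by omega))

/-- Boundedness of the solutions when the weight is a multiple of `q` and the eigenvalue has
valuation at most `1`. -/
theorem IsSol.bdd_of_dvd {S : TreeData 𝕜 Λ} {N k d : ℕ} {a : 𝕜} {f : List Λ → 𝕜[X]}
    (h : S.IsSol N k a f) (had : S.Admissible k d 0 a) (hd : 2 ≤ d) (hpa : ‖S.ϖ‖ ≤ ‖a‖) :
    ∀ v, N + 2 ≤ v.length → Bdd (‖a‖⁻¹ * ‖a‖⁻¹) (f v) := by
  have hpos := S.ϖ_pos
  have hpi0 := S.ϖ_pos.le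
  have hpi1 := S.ϖ_lt.le
  have hk : k = d * q := had.weight
  have hApos : 0 < ‖a‖ := norm_pos_iff.mpr had.ne_zero
  have hA : 1 ≤ ‖a‖⁻¹ := (one_le_inv₀ hApos).mpr had.norm_le
  have hAp : ‖a‖⁻¹ ≤ ‖S.ϖ‖⁻¹ := inv_anti₀ hpos hpa
  have hϖ0 : S.ϖ ≠ 0 := norm_pos_iff.mp hpos
  have h1p : 1 ≤ ‖S.ϖ‖⁻¹ := (one_le_inv₀ hpos).mpr hpi1
  have hq4 : 4 ≤ q := by have := had.two_mul_le; omega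
  have hqk : q ≤ k := by
    rw [hk]; exact Nat.le_mul_of_pos_left _ (by omega)
  have main : ∀ n, N + 2 ≤ n → ∀ v : List Λ, v.length = n → S.Tame k (d * q) a (f v) := by
    refine h.induction (Q := fun n => ∀ v : List Λ, v.length = n → S.Tame k (d * q) a (f v)) _
      (fun n hn v hv => ?_) ?_
    · rw [hn v hv.ge]
      exact ⟨bdd_zero (by positivity), fun i _ => by simp, fun i _ => by simp⟩
    intro n hn ih v hv
    obtain ⟨m, m₂, w, rfl⟩ : ∃ m m₂ w, v = m :: m₂ :: w := by
      match v, hv with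
      | [], hv => simp at hv; omega
      | [_], hv => simp at hv; omega
      | m :: m₂ :: w, _ => exact ⟨m, m₂, w, rfl⟩
    simp only [List.length_cons] at hv
    have E : ∀ m₂, S.Estimates d 0 a k f (m₂ :: w) := fun m₂ =>
      h.estimates had (by simp; omega) fun w' hw' => ih _ (by simp at hw'; omega) w' rfl
    have hchild : ∀ m₂ m l, S.Tame k (d * q) a (f (l :: m :: m₂ :: w)) := fun m₂ m l =>
      ih _ (by simp; omega) _ rfl
    -- For r = 0, the coefficient of index d of the digit 0 and the constant term of the digit d are
    -- both the sum of the children's leading coefficients; eliminating it relates a vertex to its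
    -- parent.
    have hrel : ∀ m₂ m, ‖a * (f (m :: m₂ :: w)).coeff k +
        (shift S.ϖ (S.τ m) (f (m₂ :: w))).coeff d‖ ≤ 1 := by
      intro m₂ m
      have h1 := (E m₂).coeff m k hqk
      have h2 := Tame.norm_low_coeff_sub_le had (hchild m₂ m) (j := 0) le_rfl
      have h3 := (E m₂).shift_add_digit m d
      have e : (S.digit d 0 0 f (m :: m₂ :: w)).coeff d =
          (S.digit d 0 d f (m :: m₂ :: w)).coeff 0 := by
        simp [digit_coeff]
      rw [coeff_add, e] at h3
      rw [add_zero, ← hk] at h2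
      have h4 := norm_add_le_of_le (norm_add_le_of_le h1 h2) h3
      convert h4 using 2
      ring
    have hlowu : ∀ m₂, Bdd (‖a‖⁻¹ * ‖a‖⁻¹) (S.low k f (m₂ :: w)) := fun m₂ =>
      Bdd.sum (by positivity) fun l _ => ((E m₂).child l).lift hpi1 (S.τ_le l)
    have hdeg : ∀ v, (C a * f v).natDegree < (d + 1) * q := fun v =>
      ((natDegree_C_mul_le _ _).trans (h.natDegree_le v)).trans_lt (by rw [hk, add_mul]; omega)
    have hash : ∀ m₂ m, Bdd 1 (shift S.ϖ (S.τ m) (C a * f (m₂ :: w))) := by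
      intro m₂ m
      rw [shift_C_mul]
      have := ((E m₂).shift m).C_mul a
      rwa [mul_inv_cancel₀ hApos.ne'] at this
    have hAA : ‖a‖⁻¹ * ‖a‖⁻¹ ≤ (‖S.ϖ‖ ^ d)⁻¹ := by
      rw [← mul_inv]
      refine inv_anti₀ (by positivity) ?_
      calc ‖S.ϖ‖ ^ d ≤ ‖S.ϖ‖ ^ 2 := pow_le_pow_of_le_one hpi0 hpi1 hd
        _ = ‖S.ϖ‖ * ‖S.ϖ‖ := sq _
        _ ≤ _ := mul_le_mul hpa hpa hpi0 hApos.le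
    have h1d : 1 ≤ (‖S.ϖ‖ ^ d)⁻¹ :=
      (one_le_inv₀ (pow_pos hpos d)).mpr (pow_le_one₀ hpi0 hpi1)
    have hwhigh : ∀ m₂ i, q ≤ i → ‖(shift S.ϖ (S.τ m₂) (f w)).coeff i‖ ≤ 1 := by
      have h1 : ∀ m₂, Bdd ((‖S.ϖ‖ ^ d)⁻¹) (shift S.ϖ (S.τ m₂) (f w)) := by
        intro m₂
        have h2 := (S.bdd_of_shift hpi1 d (hdeg (m₂ :: w)) fun m => (hash m₂ m).bddTo d).of_C_mul
          (pow_ne_zero _ hϖ0)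
        rw [norm_pow, mul_one] at h2
        have h3 := (((h.eqn m₂ w (by omega)).mono h1d).add h2).sub ((hlowu m₂).mono hAA)
        rwa [sub_add_cancel, add_sub_cancel_right] at h3
      intro m₂ i hi
      have h2 := (S.bdd_of_shift hpi1 d (f := f w)
        ((h.natDegree_le w).trans_lt (by rw [hk, add_mul]; omega))
        fun m => (h1 m).bddTo d).of_C_mul (pow_ne_zero _ hϖ0)
      rw [norm_pow] at h2
      refine (h2.norm_shift_coeff_le (ω := S.ϖ) (S.τ_le m₂) i).trans ?_
      rw [← mul_inv, ← pow_add, ← div_eq_mul_inv, div_le_one (pow_pos hpos _)]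
      exact pow_le_pow_of_le_one hpi0 hpi1 (by have := had.two_mul_le; omega)
    -- The equation at m₂ :: w, one level closer to the root than in `estimates`, has children
    -- bounded by |a|⁻²; dividing by a gives |a|⁻³.
    have hfu3 : Bdd (‖S.ϖ‖⁻¹ ^ 3) (f (m₂ :: w)) := by
      obtain ⟨G, hG, hfG⟩ := exists_digits S.Θ_monic S.Θ_natDegree (by omega) d _ (hdeg (m₂ :: w))
      have hG0 : Bdd 1 (G 0) := by
        simpa using S.bdd_digits_of_shift hpi1 d G (fun s _ => hG s) (fun m' => by
          rw [← hfG]; exact (hash m₂ m').bddTo d) 0 (by omega)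
      have h1AA : 1 ≤ ‖a‖⁻¹ * ‖a‖⁻¹ := one_le_mul_of_one_le_of_one_le hA hA
      have hGA := bdd_digits_of_high S.Θ_bdd S.Θ_monic S.Θ_natDegree (c := ‖a‖⁻¹ * ‖a‖⁻¹)
        (by positivity) d G (fun s _ => hG s) fun i hi => by
          rw [← hfG]
          have := norm_sub_le_of_le (norm_add_le_of_le ((hwhigh m₂ i hi).trans h1AA)
            (hlowu m₂ i)) ((h.eqn m₂ w (by omega) i).trans h1AA)
          rwa [coeff_sub, coeff_add, sub_sub_cancel] at this
      have h1 : Bdd (‖a‖⁻¹ * ‖a‖⁻¹) (C a * f (m₂ :: w)) := by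
        rw [hfG]
        refine Bdd.sum (by positivity) fun s hs => (S.Θ_bdd.pow s).one_mul ?_
        rcases Nat.eq_zero_or_pos s with rfl | hs0
        · exact hG0.mono h1AA
        · exact hGA s hs0 (by simpa [Nat.lt_succ_iff] using hs)
      refine (h1.of_C_mul had.ne_zero).mono ?_
      calc ‖a‖⁻¹ * (‖a‖⁻¹ * ‖a‖⁻¹) = ‖a‖⁻¹ ^ 3 := by ring
        _ ≤ _ := pow_le_pow_left₀ (by positivity) hAp 3
    have hfud : Bdd ((‖S.ϖ‖ ^ d)⁻¹) (f (m₂ :: w)) := by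
      rcases Nat.lt_or_ge 2 d with h3 | h2
      · refine hfu3.mono ?_
        rw [inv_pow]
        exact inv_anti₀ (pow_pos hpos d) (pow_le_pow_of_le_one hpi0 hpi1 h3)
      obtain rfl : d = 2 := le_antisymm h2 hd
      -- For d = 2 the bound |ϖ|⁻³ is one power too weak. Summing `hrel` over m removes the
      -- translates by the extra ϖ of `norm_sum_shift_coeff_two_le`, and the equation in degree k
      -- replaces the sum of the children's leading coefficients by a f(m₂ :: w)_k, leaving a² f(m₂
      -- :: w)_k integral.
      have hck : ‖(f (m₂ :: w)).coeff k‖ ≤ ‖a‖⁻¹ * ‖a‖⁻¹ := by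
        have h1 := norm_sub_le_of_le (h.eqn m₂ w (by omega) k) (hwhigh m₂ k hqk)
        rw [coeff_sub, coeff_add, coeff_C_mul, low, finsetSum_coeff] at h1
        simp only [lift_coeff_top] at h1
        have h2 : ‖a * (∑ l, (f (l :: m₂ :: w)).coeff k - a * (f (m₂ :: w)).coeff k)‖ ≤ 1 := by
          rw [norm_mul]
          refine mul_le_one₀ had.norm_le (norm_nonneg _) ?_
          rwa [add_sub_assoc, add_sub_cancel_left] at h1
        have h3 := S.norm_sum_shift_coeff_two_le hq4 (by rw [← hk]; exact h.natDegree_le _) hfu3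
        rw [← mul_pow, mul_inv_cancel₀ hpos.ne', one_pow] at h3
        have h4 : ‖∑ l, (a * (f (l :: m₂ :: w)).coeff k +
            (shift S.ϖ (S.τ l) (f (m₂ :: w))).coeff 2)‖ ≤ 1 :=
          norm_sum_le_of_le zero_le_one fun l _ => hrel m₂ l
        rw [Finset.sum_add_distrib, ← Finset.mul_sum] at h4
        have h5 := norm_sub_le_of_le (norm_sub_le_of_le h4 h3) h2
        rw [show a * ∑ l, (f (l :: m₂ :: w)).coeff k +
          ∑ l, (shift S.ϖ (S.τ l) (f (m₂ :: w))).coeff 2 -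
          ∑ l, (shift S.ϖ (S.τ l) (f (m₂ :: w))).coeff 2 -
          a * (∑ l, (f (l :: m₂ :: w)).coeff k - a * (f (m₂ :: w)).coeff k) =
          a * a * (f (m₂ :: w)).coeff k by ring, norm_mul, norm_mul] at h5
        rw [← mul_inv, ← one_div, le_div_iff₀ (by positivity), mul_comm]
        exact h5
      have hck2 : ‖(f (m₂ :: w)).coeff k‖ ≤ (‖S.ϖ‖ ^ 2)⁻¹ := hck.trans hAA
      -- Removing the top digit leaves degree below 2q, so that recovery from translates loses only
      -- one ϖ.
      set g := f (m₂ :: w) - C ((f (m₂ :: w)).coeff k) * S.Θ ^ 2 with hg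
      have hΘ2 : (S.Θ ^ 2).natDegree = 2 * q := by
        rw [S.Θ_monic.natDegree_pow, S.Θ_natDegree]
      have hgdeg : g.natDegree < (1 + 1) * q := by
        have h1 : g.natDegree ≤ 2 * q := by
          refine (natDegree_sub_le _ _).trans (max_le ?_ ?_)
          · rw [← hk]; exact h.natDegree_le _
          · exact (natDegree_C_mul_le _ _).trans hΘ2.le
        refine lt_of_le_of_ne h1 fun h2 => ?_
        have h3 : g.coeff (2 * q) = 0 := by
          have h4 := S.Θ_monic.pow 2
          rw [Monic, leadingCoeff, hΘ2] at h4
          rw [hg, coeff_sub, coeff_C_mul, h4, hk]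
          ring
        rw [show (1 + 1) * q = 2 * q by ring] at h2
        rw [← h2, coeff_natDegree, leadingCoeff_eq_zero] at h3
        rw [h3, natDegree_zero] at h2
        omega
      have hgsh : ∀ m, Bdd ‖a‖⁻¹ (shift S.ϖ (S.τ m) g) := by
        classical
        intro m
        rw [hg, shift_sub]
        refine ((E m₂).shift m).sub (Bdd.mono ?_ hA)
        rw [shift_C_mul, pow_two, shift_mul, S.shift_Θ]
        rw [show C ((f (m₂ :: w)).coeff k) * (C S.ϖ * X * S.cofactor S.ϖ m *
          (C S.ϖ * X * S.cofactor S.ϖ m)) = C ((f (m₂ :: w)).coeff k * S.ϖ ^ 2) *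
          ((X * S.cofactor S.ϖ m) * (X * S.cofactor S.ϖ m)) by
            rw [C_mul, C_pow]; ring]
        have hX := bdd_X.mul_one (S.cofactor_bdd hpi1 m)
        refine (bdd_C ?_).mul_one (hX.mul_one hX)
        rw [norm_mul, norm_pow]
        calc _ ≤ (‖S.ϖ‖ ^ 2)⁻¹ * ‖S.ϖ‖ ^ 2 := mul_le_mul_of_nonneg_right hck2 (by positivity)
          _ = 1 := inv_mul_cancel₀ (by positivity)
      have hg1 := (S.bdd_of_shift hpi1 1 hgdeg fun m => (hgsh m).bddTo 1).of_C_mul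
        (pow_ne_zero _ hϖ0)
      rw [pow_one] at hg1
      have hg2 : Bdd ((‖S.ϖ‖ ^ 2)⁻¹) g := hg1.mono (by
        rw [pow_two, mul_inv]
        exact mul_le_mul_of_nonneg_left hAp (by positivity))
      have h1 := hg2.add ((bdd_C hck2).mul_one (S.Θ_bdd.pow 2))
      rwa [hg, sub_add_cancel] at h1
    have hkey : ‖(shift S.ϖ (S.τ m) (f (m₂ :: w))).coeff d‖ ≤ 1 := by
      refine (hfud.norm_shift_coeff_le (S.τ_le m) d).trans (le_of_eq ?_)
      exact mul_inv_cancel₀ (pow_pos hpos d).ne'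
    have htail : ∀ i < d * q, ‖(f (m :: m₂ :: w)).coeff i * S.ϖ ^ (k - i)‖ ≤ 1 := by
      intro i hi
      rw [norm_mul, norm_pow]
      rcases Nat.lt_or_ge (i + 1) k with hlt | hge
      · calc _ ≤ (‖a‖⁻¹ * ‖a‖⁻¹) * (‖a‖ * ‖a‖) := by
              refine mul_le_mul ((E m₂).child m i) ?_ (by positivity) (by positivity)
              calc _ ≤ ‖S.ϖ‖ ^ 2 := pow_le_pow_of_le_one hpi0 hpi1 (by omega)
                _ = ‖S.ϖ‖ * ‖S.ϖ‖ := sq _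
                _ ≤ _ := mul_le_mul hpa hpa hpi0 hApos.le
          _ = 1 := by field_simp
      -- For i = k - 1 the bound |a|⁻² is insufficient. Here the binomial C(k, k - 1) = dq is
      -- divisible by p, so the children's sum is integral in degree i, and a f_i is integral.
      · have hik : k = i + 1 := by omega
        have hqi : q ≤ i := by
          have : 2 * q ≤ d * q := Nat.mul_le_mul_right _ hd
          omega
        have hP : ‖(S.low k f (m :: m₂ :: w)).coeff i‖ ≤ 1 := by
          rw [low, finsetSum_coeff]
          refine norm_sum_le_of_le zero_le_one fun l _ => ?_
          rw [lift_coeff, Finset.sum_range_succ]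
          refine norm_add_le_of_le (norm_sum_le_of_le zero_le_one fun j hj => ?_) ?_
          · rw [Finset.mem_range] at hj
            rw [norm_mul]
            refine mul_le_one₀ ((hchild m₂ m l).tail j (by omega)) (norm_nonneg _) ?_
            rw [norm_mul, norm_pow]
            exact mul_le_one₀ (pow_le_one₀ (norm_nonneg _) (S.τ_le l)) (norm_nonneg _)
              (norm_natCast_le _)
          · have h1 : ‖((k.choose i : ℕ) : 𝕜)‖ ≤ ‖a‖ := by
              rw [hik, Nat.choose_succ_self_right, ← hik, hk]
              exact (S.norm_le_of_dvd (dvd_mul_of_dvd_right S.p_dvd_card d)).trans had.norm_p_le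
            rw [norm_mul, norm_mul (S.τ l ^ _)]
            calc _ ≤ ‖a‖⁻¹ * (1 * ‖a‖) := by
                  refine mul_le_mul ((hchild m₂ m l).lead k le_rfl) (mul_le_mul ?_ h1
                    (norm_nonneg _) zero_le_one) (by positivity) (by positivity)
                  rw [norm_pow]
                  exact pow_le_one₀ (norm_nonneg _) (S.τ_le l)
              _ = 1 := by rw [one_mul, inv_mul_cancel₀ hApos.ne']
        have h1 := norm_add_le_of_le ((E m₂).coeff m i hqi) hP
        rw [sub_add_cancel, norm_mul] at h1
        rw [show k - i = 1 by omega, pow_one, mul_comm]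
        exact (mul_le_mul_of_nonneg_right hpa (norm_nonneg _)).trans h1
    refine ⟨(E m₂).child m, fun i hi => ?_, htail⟩
    rcases Nat.lt_or_ge i (d * q) with hlt | hge
    · exact (htail i hlt).trans hA
    · obtain rfl : i = k := by omega
      have h1 := norm_sub_le_of_le (hrel m₂ m) hkey
      rw [add_sub_cancel_right, norm_mul] at h1
      rw [Nat.sub_self, pow_zero, mul_one, ← one_div, le_div_iff₀ hApos, mul_comm]
      exact h1
  exact fun v hv => (main _ hv v rfl).bdd

end TreeData

end BreuilSchneider
end

/-! ### Weight q: perturbations of Θ -/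

noncomputable section

namespace BreuilSchneider

open Polynomial

namespace TreeData

variable {𝕜 : Type*} [NormedField 𝕜] {Λ : Type*} [Fintype Λ]
variable (S : TreeData 𝕜 Λ)

local notation "q" => Fintype.card Λ

/-- The linear coefficient of Θ(ϖX - τ_m) is ϖ times the constant term of the cofactor, a unit. -/
theorem norm_derivative_Θ_eval (m : Λ) : ‖(derivative S.Θ).eval (-S.τ m)‖ = 1 := by
  classical
  have h := shift_coeff_one S.ϖ (S.τ m) S.Θ
  rw [S.shift_Θ, mul_assoc, coeff_C_mul, coeff_X_mul] at h
  rw [← mul_left_cancel₀ (norm_pos_iff.mp S.ϖ_pos) h, S.cofactor_coeff_zero]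

/-- Monic polynomials of degree `q` close to `Θ`. -/
structure NearΘ (δ : ℝ) (F : 𝕜[X]) : Prop where
  coeff_eq_zero : ∀ i, q < i → F.coeff i = 0
  coeff_card : F.coeff q = 1
  near : Bdd δ (F - S.Θ)

theorem nearΘ_Θ {δ : ℝ} (hδ : 0 ≤ δ) : S.NearΘ δ S.Θ where
  coeff_eq_zero i hi := coeff_eq_zero_of_natDegree_lt (by rwa [S.Θ_natDegree])
  coeff_card := by
    have := S.Θ_monic
    rwa [Monic, leadingCoeff, S.Θ_natDegree] at this
  near := by rw [sub_self]; exact bdd_zero hδ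

theorem shift_coeff_top {k : ℕ} {f : 𝕜[X]} (hf : f.natDegree ≤ k) (ω x : 𝕜) :
    (shift ω x f).coeff k = ω ^ k * f.coeff k := by
  rw [shift_coeff, shift]
  congr 1
  nth_rewrite 1 [as_sum_range_C_mul_X_pow' f (Nat.lt_succ_of_le hf)]
  rw [Polynomial.sum_comp, finsetSum_coeff, Finset.sum_range_succ, Finset.sum_eq_zero]
  · rw [C_mul_comp, X_pow_comp, coeff_C_mul, map_one, one_mul, sub_eq_add_neg, ← C_neg,
      coeff_X_add_C_pow]
    simp
  · intro i hi
    rw [C_mul_comp, X_pow_comp, coeff_C_mul, map_one, one_mul, sub_eq_add_neg, ← C_neg,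
      coeff_X_add_C_pow, Nat.choose_eq_zero_of_lt (Finset.mem_range.mp hi)]
    simp

variable [IsUltrametricDist 𝕜]

theorem norm_Θ_coeff_one : ‖S.Θ.coeff 1‖ = 1 := by
  have h2 := S.two_le_card
  have h := S.bdd_X_pow_sub_X_sub_Θ 1
  rw [coeff_sub, coeff_sub, coeff_X_pow, if_neg (by omega), coeff_X_one, zero_sub] at h
  have h1 := h.trans_lt (S.p_le.trans_lt S.ϖ_lt)
  have h3 := IsUltrametricDist.norm_add_eq_max_of_norm_ne_norm (x := (-1 : 𝕜) - S.Θ.coeff 1)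
    (y := 1) (by rw [norm_one]; exact h1.ne)
  rwa [norm_one, max_eq_right h1.le, show (-1 : 𝕜) - S.Θ.coeff 1 + 1 = -S.Θ.coeff 1 by ring,
    norm_neg] at h3

/-- A polynomial of degree less than `q` is bounded by the values of a small perturbation of the
evaluation at the representatives. -/
theorem bdd_of_eval_sub_derivative {γ : 𝕜} (hγ : ‖γ‖ < 1) {g : 𝕜[X]}
    (hg : ∀ i, q ≤ i → g.coeff i = 0) {c : ℝ} (hc : 0 ≤ c)
    (h : ∀ m, ‖g.eval (-S.τ m) - γ * (derivative g).eval (-S.τ m)‖ ≤ c) : Bdd c g := by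
  have hτ : ∀ m, ‖-S.τ m‖ ≤ 1 := fun m => by rw [norm_neg]; exact S.τ_le m
  -- The derivative term is at most |γ| < 1 times the size of g, so it cannot spoil interpolation.
  have key := le_of_contraction (Finset.range q) g.coeff hc hγ fun C₀ hC i hi => by
    have h0 : 0 ≤ C₀ := (norm_nonneg _).trans (hC i hi)
    have hb : Bdd C₀ g := fun j => by
      rcases Nat.lt_or_ge j q with hj | hj
      · exact hC j (Finset.mem_range.mpr hj)
      · rw [hg j hj, norm_zero]; exact h0
    refine S.bdd_of_eval hg (c := max c (‖γ‖ * C₀)) (fun m => ?_) i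
    have h1 : ‖γ * (derivative g).eval (-S.τ m)‖ ≤ max c (‖γ‖ * C₀) := by
      rw [norm_mul]
      exact (mul_le_mul_of_nonneg_left (hb.derivative.norm_eval_le (hτ m)) (norm_nonneg _)).trans
        (le_max_right _ _)
    have h2 := norm_add_le_of_le ((h m).trans (le_max_left c (‖γ‖ * C₀))) h1
    rwa [sub_add_cancel] at h2
  intro i
  rcases Nat.lt_or_ge i q with hi | hi
  · exact key i (Finset.mem_range.mpr hi)
  · rw [hg i hi, norm_zero]; exact hc

/-- Injectivity is the preceding bound with c = 0, and source and target both have dimension q. -/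
theorem exists_eval_sub_derivative_eq {γ : 𝕜} (hγ : ‖γ‖ < 1) (y : Λ → 𝕜) :
    ∃ g : 𝕜[X], (∀ i, q ≤ i → g.coeff i = 0) ∧
      ∀ m, g.eval (-S.τ m) - γ * (derivative g).eval (-S.τ m) = y m := by
  let L : degreeLT 𝕜 q →ₗ[𝕜] (Λ → 𝕜) :=
    { toFun := fun g m => (g : 𝕜[X]).eval (-S.τ m) - γ * (derivative (g : 𝕜[X])).eval (-S.τ m)
      map_add' := fun g h => by
        ext m
        simp only [Submodule.coe_add, eval_add, derivative_add, Pi.add_apply]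
        ring
      map_smul' := fun c g => by
        ext m
        simp only [Submodule.coe_smul, eval_smul, derivative_smul, Pi.smul_apply, smul_eq_mul,
          RingHom.id_apply]
        ring }
  have hco : ∀ g : degreeLT 𝕜 q, ∀ i, q ≤ i → (g : 𝕜[X]).coeff i = 0 := fun g i hi =>
    coeff_eq_zero_of_degree_lt ((mem_degreeLT.mp g.2).trans_le (by exact_mod_cast hi))
  have hinj : Function.Injective L := by
    rw [injective_iff_map_eq_zero]
    intro g hg
    have h := S.bdd_of_eval_sub_derivative hγ (hco g) le_rfl fun m => by
      have := congrFun hg m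
      simp only [L, LinearMap.coe_mk, AddHom.coe_mk, Pi.zero_apply] at this
      rw [this, norm_zero]
    ext i
    simpa using h i
  have e := degreeLTEquiv 𝕜 q
  have : FiniteDimensional 𝕜 (degreeLT 𝕜 q) := e.symm.finiteDimensional
  have hsurj := (LinearMap.injective_iff_surjective_of_finrank_eq_finrank (f := L) (by
    rw [e.finrank_eq]; simp)).mp hinj
  obtain ⟨g, hg⟩ := hsurj y
  exact ⟨g, hco g, fun m => congrFun hg m⟩

theorem bdd_lift_of_coeff_eq_zero {g : 𝕜[X]} (hg : ∀ i, q ≤ i → g.coeff i = 0) {c : ℝ}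
    (h : Bdd c g) (l : Λ) : Bdd (c * ‖S.ϖ‖) (lift q S.ϖ (S.τ l) g) := by
  refine bdd_lift (mul_nonneg h.nonneg (norm_nonneg _)) (S.τ_le l) fun i _ => ?_
  rcases Nat.lt_or_ge i q with hi' | hi'
  · rw [norm_mul, norm_pow]
    exact mul_le_mul (h i) (pow_le_of_le_one (norm_nonneg _) S.ϖ_lt.le (by omega)) (by positivity)
      h.nonneg
  · rw [hg i hi', zero_mul, norm_zero]
    exact mul_nonneg h.nonneg (norm_nonneg _)

namespace NearΘ

variable {S} {δ : ℝ} {F : 𝕜[X]} (h : S.NearΘ δ F) (hδ : δ < 1)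
include h hδ

theorem bdd : Bdd 1 F := by
  have := (h.near.mono hδ.le).add S.Θ_bdd
  rwa [sub_add_cancel] at this

theorem norm_coeff_one : ‖F.coeff 1‖ = 1 := by
  have h1 := (h.near 1).trans_lt hδ
  rw [coeff_sub] at h1
  have h2 := IsUltrametricDist.norm_add_eq_max_of_norm_ne_norm (x := F.coeff 1 - S.Θ.coeff 1)
    (y := S.Θ.coeff 1) (by rw [S.norm_Θ_coeff_one]; exact h1.ne)
  rwa [sub_add_cancel, S.norm_Θ_coeff_one, max_eq_right h1.le] at h2

theorem norm_derivative_eval (m : Λ) : ‖(derivative F).eval (-S.τ m)‖ = 1 := by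
  have h1 := (h.near.derivative.norm_eval_le (x := -S.τ m)
    (by rw [norm_neg]; exact S.τ_le m)).trans_lt hδ
  rw [derivative_sub, eval_sub] at h1
  have h2 := IsUltrametricDist.norm_add_eq_max_of_norm_ne_norm
    (x := (derivative F).eval (-S.τ m) - (derivative S.Θ).eval (-S.τ m))
    (y := (derivative S.Θ).eval (-S.τ m)) (by rw [S.norm_derivative_Θ_eval]; exact h1.ne)
  rwa [sub_add_cancel, S.norm_derivative_Θ_eval, max_eq_right h1.le] at h2

/-- Power sums of exponent below q - 1 are divisible by ϖ, and the coefficient of F' in degree q - 1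
is q. -/
theorem norm_sum_derivative_eval_le : ‖∑ m, (derivative F).eval (-S.τ m)‖ ≤ ‖S.ϖ‖ := by
  have hdeg : (derivative F).natDegree < q := by
    have h2 := S.two_le_card
    refine (natDegree_derivative_le F).trans_lt ?_
    have : F.natDegree ≤ q := natDegree_le_iff_coeff_eq_zero.mpr h.coeff_eq_zero
    omega
  simp only [eval_eq_sum_range' hdeg]
  rw [Finset.sum_comm]
  refine norm_sum_le_of_le (norm_nonneg _) fun i hi => ?_
  rw [Finset.mem_range] at hi
  rw [← Finset.mul_sum, norm_mul]
  rcases Nat.lt_or_ge i (q - 1) with hlt | hge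
  · exact (mul_le_of_le_one_left (norm_nonneg _) ((h.bdd hδ).derivative i)).trans
      (S.norm_sum_neg_pow_le hlt)
  · have hi1 : i + 1 = q := by omega
    have h1 : ‖(derivative F).coeff i‖ ≤ ‖S.ϖ‖ := by
      rw [coeff_derivative, hi1, h.coeff_card, one_mul, ← Nat.cast_succ, Nat.succ_eq_add_one, hi1]
      exact (S.norm_le_of_dvd S.p_dvd_card).trans S.p_le
    refine (mul_le_of_le_one_right (norm_nonneg _) ?_).trans h1
    refine norm_sum_le_of_le zero_le_one fun l _ => ?_
    rw [norm_pow, norm_neg]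
    exact pow_le_one₀ (norm_nonneg _) (S.τ_le l)

/-- Terms of index below q carry a power of ϖ, and the term of index q carries the binomial C(q, 1)
= q. -/
theorem norm_lift_coeff_one_le (l : Λ) : ‖(lift q S.ϖ (S.τ l) F).coeff 1‖ ≤ ‖S.ϖ‖ := by
  rw [lift_coeff]
  refine norm_sum_le_of_le (norm_nonneg _) fun i hi => ?_
  rw [Finset.mem_range] at hi
  have hF := h.bdd hδ i
  have hτ : ‖S.τ l ^ (i - 1)‖ ≤ 1 := by
    rw [norm_pow]; exact pow_le_one₀ (norm_nonneg _) (S.τ_le l)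
  rw [norm_mul, norm_mul, norm_mul, norm_pow S.ϖ]
  rcases Nat.lt_or_ge i q with hlt | hge
  · calc _ ≤ 1 * ‖S.ϖ‖ * (1 * 1) := by
          gcongr
          · exact pow_le_of_le_one (norm_nonneg _) S.ϖ_lt.le (by omega)
          · exact norm_natCast_le _
      _ = _ := by ring
  · obtain rfl : i = q := by omega
    rw [Nat.choose_one_right, Nat.sub_self, pow_zero]
    calc _ ≤ 1 * 1 * (1 * ‖S.ϖ‖) := by
          gcongr
          exact (S.norm_le_of_dvd S.p_dvd_card).trans S.p_le
      _ = _ := by ring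

end NearΘ

/-- The values of a solution at depth `n` are close to multiples of a fixed polynomial `F`, with
ratios `κ` along the edges. -/
structure Relative (a : 𝕜) (f : List Λ → 𝕜[X]) (n : ℕ) (F : 𝕜[X]) (κ : Λ → 𝕜) : Prop where
  nearΘ : S.NearΘ (‖S.ϖ‖ * ‖a‖⁻¹) F
  ratio_le : ∀ m, ‖κ m‖ ≤ ‖S.ϖ‖ * ‖a‖⁻¹
  sum_le : ‖∑ m, κ m‖ ≤ ‖S.ϖ‖ * ‖a‖⁻¹ * ‖S.ϖ‖
  near : ∀ u : List Λ, u.length = n → Bdd ‖a‖⁻¹ (f u - C ((f u).coeff q) * F)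
  child : ∀ u : List Λ, u.length = n → ∀ m,
    ‖(f (m :: u)).coeff q - κ m * (f u).coeff q‖ ≤ ‖a‖⁻¹
  parent : ∀ u : List Λ, u.length = n → ∀ m,
    ‖S.ϖ‖ * ‖(f u).coeff q‖ ≤ max (‖a‖ * ‖(f (m :: u)).coeff q‖) 1

/-- Boundedness of the solutions when the weight is `q` and the eigenvalue has valuation less
than `1`. -/
theorem IsSol.bdd_of_weight_eq_card {S : TreeData 𝕜 Λ} {N : ℕ} {a : 𝕜} {f : List Λ → 𝕜[X]}
    (h : S.IsSol N q a f) (ha : ‖a‖ ≤ 1) (hpa : ‖S.ϖ‖ < ‖a‖) :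
    ∀ v, N + 1 ≤ v.length → Bdd (‖a‖⁻¹ * ‖a‖⁻¹) (f v) := by
  have hpos := S.ϖ_pos
  have hpi0 := S.ϖ_pos.le
  have hpi1 := S.ϖ_lt.le
  have hq2 := S.two_le_card
  have hApos : 0 < ‖a‖ := hpos.trans hpa
  have hA : 1 ≤ ‖a‖⁻¹ := (one_le_inv₀ hApos).mpr ha
  have hAA : ‖a‖ * ‖a‖⁻¹ = 1 := mul_inv_cancel₀ hApos.ne'
  have hδ0 : 0 ≤ ‖S.ϖ‖ * ‖a‖⁻¹ := by positivity
  have hδ : ‖S.ϖ‖ * ‖a‖⁻¹ < 1 := by rw [← hAA]; exact mul_lt_mul_of_pos_right hpa (by positivity)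
  have hτ : ∀ m, ‖-S.τ m‖ ≤ 1 := fun m => by rw [norm_neg]; exact S.τ_le m
  have hcoeff : ∀ v i, q < i → (f v).coeff i = 0 := fun v i hi =>
    coeff_eq_zero_of_natDegree_lt ((h.natDegree_le v).trans_lt hi)
  have hsub : ∀ v {F : 𝕜[X]}, S.NearΘ (‖S.ϖ‖ * ‖a‖⁻¹) F → ∀ i, q ≤ i →
      (f v - C ((f v).coeff q) * F).coeff i = 0 := by
    intro v F hF i hi
    rw [coeff_sub, coeff_C_mul]
    rcases hi.eq_or_lt with rfl | hi
    · rw [hF.coeff_card]; ring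
    · rw [hcoeff v i hi, hF.coeff_eq_zero i hi]; ring
  have main : ∀ n, N ≤ n → ∃ F κ, S.Relative a f n F κ := by
    refine h.induction (Q := fun n => ∃ F κ, S.Relative a f n F κ) _ (fun n hn => ?_) ?_
    · refine ⟨S.Θ, 0, ⟨S.nearΘ_Θ hδ0, fun m => by simpa using hδ0, ?_, fun u hu => ?_,
        fun u hu m => ?_, fun u hu m => ?_⟩⟩
      · simp only [Pi.zero_apply, Finset.sum_const_zero, norm_zero]; positivity
      · rw [hn u hu.ge]; simpa using bdd_zero (by positivity)
      · rw [hn u hu.ge, hn (m :: u) (by simp; omega)]; simp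
      · rw [hn u hu.ge]; simp
    intro n hn ih
    obtain ⟨F₁, κ, h1⟩ := ih (n + 1) (by omega)
    obtain ⟨F₂, _, h2⟩ := ih (n + 2) (by omega)
    -- By the description of the two deeper levels, a f(w) minus the sum over the children of w is
    -- approximately f(w)_q E. Only the coefficients of index 0 and 1 matter, and that of index 1
    -- has norm exactly |a|, because a dominates ϖ.
    set E : 𝕜[X] := C a * F₁ - ∑ l, C (κ l) * lift q S.ϖ (S.τ l) F₂ with hE
    have hlift : ∀ l, Bdd 1 (lift q S.ϖ (S.τ l) F₂) := fun l =>
      (h2.nearΘ.bdd hδ).lift hpi1 (S.τ_le l)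
    have hE0 : ‖E.coeff 0‖ ≤ 1 := by
      rw [hE]
      refine Bdd.sub ((bdd_C ha).mul_one (h1.nearΘ.bdd hδ)) (Bdd.sum zero_le_one fun l _ =>
        (bdd_C ((h1.ratio_le l).trans hδ.le)).mul_one (hlift l)) 0
    have hE1 : ‖E.coeff 1‖ = ‖a‖ := by
      have e1 : ‖(C a * F₁).coeff 1‖ = ‖a‖ := by
        rw [coeff_C_mul, norm_mul, h1.nearΘ.norm_coeff_one hδ, mul_one]
      have e2 : ‖(∑ l, C (κ l) * lift q S.ϖ (S.τ l) F₂).coeff 1‖ ≤ ‖S.ϖ‖ := by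
        rw [finsetSum_coeff]
        refine norm_sum_le_of_le hpi0 fun l _ => ?_
        rw [coeff_C_mul, norm_mul]
        exact (mul_le_of_le_one_left (norm_nonneg _) ((h1.ratio_le l).trans hδ.le)).trans
          (h2.nearΘ.norm_lift_coeff_one_le hδ l)
      rw [hE, coeff_sub, sub_eq_add_neg, IsUltrametricDist.norm_add_eq_max_of_norm_ne_norm, norm_neg,
        e1, max_eq_left (e2.trans hpa.le)]
      rw [norm_neg, e1]
      exact (e2.trans_lt hpa).ne'
    have hE1ne : E.coeff 1 ≠ 0 := norm_pos_iff.mp (hE1 ▸ hApos)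
    have hR : ∀ w : List Λ, w.length = n + 1 →
        ‖(C a * f w - S.low q f w - C ((f w).coeff q) * E).coeff 0‖ ≤ ‖a‖⁻¹ ∧
        ‖(C a * f w - S.low q f w - C ((f w).coeff q) * E).coeff 1‖ ≤ 1 := by
      intro w hw
      have e : C a * f w - S.low q f w - C ((f w).coeff q) * E =
          C a * (f w - C ((f w).coeff q) * F₁) -
          ∑ l, (lift q S.ϖ (S.τ l) (f (l :: w) - C ((f (l :: w)).coeff q) * F₂) +
            C ((f (l :: w)).coeff q - κ l * (f w).coeff q) * lift q S.ϖ (S.τ l) F₂) := by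
        simp only [hE, low, lift_sub, lift_C_mul, mul_sub, sub_mul, C_sub, C_mul, Finset.mul_sum,
          Finset.sum_add_distrib, Finset.sum_sub_distrib]
        rw [show ∑ l, C (κ l) * C ((f w).coeff q) * lift q S.ϖ (S.τ l) F₂ =
          ∑ l, C ((f w).coeff q) * (C (κ l) * lift q S.ϖ (S.τ l) F₂) from
            Finset.sum_congr rfl fun l _ => by ring]
        ring
      rw [e]
      have b1 : Bdd 1 (C a * (f w - C ((f w).coeff q) * F₁)) := by
        have := (h1.near w hw).C_mul a
        rwa [hAA] at this
      have b2 : ∀ l, Bdd 1 (lift q S.ϖ (S.τ l) (f (l :: w) - C ((f (l :: w)).coeff q) * F₂)) :=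
        fun l => (S.bdd_lift_of_coeff_eq_zero (hsub _ h2.nearΘ)
          (h2.near (l :: w) (by simp [hw])) l).mono (by rw [mul_comm]; exact hδ.le)
      have b3 : ∀ l, ‖(f (l :: w)).coeff q - κ l * (f w).coeff q‖ ≤ ‖a‖⁻¹ := h1.child w hw
      constructor
      · refine ((b1.mono hA).sub (Bdd.sum (by positivity) fun l _ =>
          ((b2 l).mono hA).add ((bdd_C (b3 l)).mul_one (hlift l)))) 0
      · rw [coeff_sub, finsetSum_coeff]
        refine norm_sub_le_of_le (b1 1) (norm_sum_le_of_le zero_le_one fun l _ => ?_)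
        rw [coeff_add, coeff_C_mul]
        refine norm_add_le_of_le (b2 l 1) ?_
        rw [norm_mul]
        calc _ ≤ ‖a‖⁻¹ * ‖S.ϖ‖ := mul_le_mul (b3 l) (h2.nearΘ.norm_lift_coeff_one_le hδ l)
              (norm_nonneg _) (by positivity)
          _ ≤ 1 := by rw [mul_comm]; exact hδ.le
    -- The equation in degrees 0 and 1: value and derivative of f(u) at -τ_m are both governed by
    -- the leading coefficient of f(m :: u).
    have h01 : ∀ u : List Λ, u.length = n → ∀ m,
        ‖(f u).eval (-S.τ m) - (f (m :: u)).coeff q * E.coeff 0‖ ≤ ‖a‖⁻¹ ∧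
        ‖S.ϖ * (derivative (f u)).eval (-S.τ m) - (f (m :: u)).coeff q * E.coeff 1‖ ≤ 1 := by
      intro u hu m
      have heq := h.eqn m u (by omega)
      obtain ⟨r0, r1⟩ := hR (m :: u) (by simp [hu])
      have e : shift S.ϖ (S.τ m) (f u) + S.low q f (m :: u) - C a * f (m :: u) +
          (C a * f (m :: u) - S.low q f (m :: u) - C ((f (m :: u)).coeff q) * E) =
          shift S.ϖ (S.τ m) (f u) - C ((f (m :: u)).coeff q) * E := by ring
      constructor
      · have := norm_add_le_of_le ((heq 0).trans hA) r0
        rw [← coeff_add, e, coeff_sub, coeff_C_mul, shift_coeff_zero] at this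
        exact this
      · have := norm_add_le_of_le (heq 1) r1
        rw [← coeff_add, e, coeff_sub, coeff_C_mul, shift_coeff_one] at this
        exact this
    -- The constant that eliminates f(m :: u)_q between the two relations: f(u)(-τ_m) - γ
    -- f(u)'(-τ_m) is bounded by |a|⁻¹. The polynomial F = Θ + g is the monic one of degree q killed
    -- by these q functionals, so f(u) is close to f(u)_q F.
    set γ : 𝕜 := S.ϖ * E.coeff 0 * (E.coeff 1)⁻¹ with hγdef
    have hγ : ‖γ‖ ≤ ‖S.ϖ‖ * ‖a‖⁻¹ := by
      rw [hγdef, norm_mul, norm_mul, norm_inv, hE1]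
      exact mul_le_mul_of_nonneg_right (mul_le_of_le_one_right hpi0 hE0) (by positivity)
    obtain ⟨g, hg, hgL⟩ := S.exists_eval_sub_derivative_eq (hγ.trans_lt hδ)
      fun m => γ * (derivative S.Θ).eval (-S.τ m)
    have hF : S.NearΘ (‖S.ϖ‖ * ‖a‖⁻¹) (S.Θ + g) := by
      have h3 := S.nearΘ_Θ hδ0
      refine ⟨fun i hi => ?_, ?_, ?_⟩
      · rw [coeff_add, h3.coeff_eq_zero i hi, hg i hi.le, add_zero]
      · rw [coeff_add, h3.coeff_card, hg _ le_rfl, add_zero]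
      · rw [add_sub_cancel_left]
        refine S.bdd_of_eval_sub_derivative (hγ.trans_lt hδ) hg hδ0 fun m => ?_
        rw [hgL, norm_mul, S.norm_derivative_Θ_eval, mul_one]
        exact hγ
    have hL : ∀ m, (S.Θ + g).eval (-S.τ m) - γ * (derivative (S.Θ + g)).eval (-S.τ m) = 0 := by
      intro m
      have := hgL m
      rw [derivative_add, eval_add, eval_add, S.Θ_eval]
      linear_combination this
    have hnear : ∀ u : List Λ, u.length = n →
        Bdd ‖a‖⁻¹ (f u - C ((f u).coeff q) * (S.Θ + g)) := by
      intro u hu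
      refine S.bdd_of_eval_sub_derivative (hγ.trans_lt hδ) (hsub u hF) (by positivity) fun m => ?_
      obtain ⟨r0, r1⟩ := h01 u hu m
      have r2 : ‖E.coeff 0 * (E.coeff 1)⁻¹ * (S.ϖ * (derivative (f u)).eval (-S.τ m) -
          (f (m :: u)).coeff q * E.coeff 1)‖ ≤ ‖a‖⁻¹ := by
        rw [norm_mul, norm_mul, norm_inv, hE1]
        calc _ ≤ 1 * ‖a‖⁻¹ * 1 := by gcongr
          _ = _ := by ring
      convert norm_sub_le_of_le r0 r2 using 2
      rw [derivative_sub, derivative_C_mul, eval_sub, eval_sub, eval_C_mul, eval_C_mul, hγdef]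
      have := hL m
      rw [hγdef] at this
      field_simp
      field_simp at this
      linear_combination (-(f u).coeff q) * this
    -- The ratio along the edge m is read off from the relation in degree 1.
    refine ⟨S.Θ + g, fun m => S.ϖ * (derivative (S.Θ + g)).eval (-S.τ m) * (E.coeff 1)⁻¹,
      ⟨hF, fun m => ?_, ?_, hnear, fun u hu m => ?_, fun u hu m => ?_⟩⟩
    · rw [norm_mul, norm_mul, norm_inv, hE1, hF.norm_derivative_eval hδ, mul_one]
    · rw [← Finset.sum_mul, ← Finset.mul_sum, norm_mul, norm_mul, norm_inv, hE1]
      calc _ ≤ ‖S.ϖ‖ * ‖S.ϖ‖ * ‖a‖⁻¹ := by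
            gcongr
            exact hF.norm_sum_derivative_eval_le hδ
        _ = _ := by ring
    · have r1 := (h01 u hu m).2
      have r2 := (hnear u hu).derivative.norm_eval_le (hτ m)
      have r3 : ‖S.ϖ * (derivative (f u - C ((f u).coeff q) * (S.Θ + g))).eval (-S.τ m)‖ ≤ 1 := by
        rw [norm_mul]
        exact (mul_le_mul_of_nonneg_left r2 hpi0).trans hδ.le
      have r4 := norm_sub_le_of_le r3 r1
      have r5 : ‖(E.coeff 1)⁻¹ * (S.ϖ * (derivative (f u - C ((f u).coeff q) *
          (S.Θ + g))).eval (-S.τ m) - (S.ϖ * (derivative (f u)).eval (-S.τ m) -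
            (f (m :: u)).coeff q * E.coeff 1))‖ ≤ ‖a‖⁻¹ := by
        rw [norm_mul, norm_inv, hE1]
        exact mul_le_of_le_one_right (by positivity) r4
      convert r5 using 2
      rw [derivative_sub, derivative_C_mul, eval_sub, eval_C_mul]
      field_simp
      ring
    · have r1 := (h01 u hu m).2
      have r2 := (hnear u hu).derivative.norm_eval_le (hτ m)
      have r3 : ‖S.ϖ * (derivative (f u - C ((f u).coeff q) * (S.Θ + g))).eval (-S.τ m)‖ ≤ 1 := by
        rw [norm_mul]
        exact (mul_le_mul_of_nonneg_left r2 hpi0).trans hδ.le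
      have r4 := (norm_sub_le_of_le r1 r3).trans (le_max_right
        (‖a‖ * ‖(f (m :: u)).coeff q‖) 1)
      have r5 : ‖(f (m :: u)).coeff q * E.coeff 1‖ ≤ max (‖a‖ * ‖(f (m :: u)).coeff q‖) 1 := by
        rw [norm_mul, hE1, mul_comm]
        exact le_max_left _ _
      have r6 := norm_add_le_of_le r4 r5
      rw [show S.ϖ * (derivative (f u)).eval (-S.τ m) - (f (m :: u)).coeff q * E.coeff 1 -
        S.ϖ * (derivative (f u - C ((f u).coeff q) * (S.Θ + g))).eval (-S.τ m) +
        (f (m :: u)).coeff q * E.coeff 1 =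
        S.ϖ * (f u).coeff q * (derivative (S.Θ + g)).eval (-S.τ m) by
          rw [derivative_sub, derivative_C_mul, eval_sub, eval_C_mul]; ring] at r6
      rwa [norm_mul, norm_mul, hF.norm_derivative_eval hδ, mul_one] at r6
  intro v hv
  obtain ⟨m, u, rfl⟩ : ∃ m u, v = m :: u := by
    match v, hv with
    | [], hv => simp at hv
    | m :: u, _ => exact ⟨m, u, rfl⟩
  simp only [List.length_cons, add_le_add_iff_right] at hv
  obtain ⟨_, _, h0⟩ := main u.length hv
  obtain ⟨F, κ, h1⟩ := main (u.length + 1) (by omega)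
  have hw := h1.child (m :: u) (by simp)
  have hlead : ‖(f (m :: u)).coeff q‖ ≤ ‖a‖⁻¹ * ‖a‖⁻¹ := by
    -- In degree q the equation at m :: u has three terms. The children give (∑ κ) f(m :: u)_q up to
    -- |a|⁻¹, and the parent gives ϖ^q f(u)_q; up to fixed errors, both are at most |ϖ||a|⁻¹ < 1
    -- times a f(m :: u)_q, which is thereby bounded.
    have hcontr := le_of_contraction {()} (fun _ => a * (f (m :: u)).coeff q) (e := ‖a‖⁻¹)
      (by positivity) hδ (fun c hc i hi => by
        have hc := hc () (by simp)
        set M := max ‖a‖⁻¹ (‖S.ϖ‖ * ‖a‖⁻¹ * c) with hM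
        have hM0 : 0 ≤ M := le_max_of_le_left (by positivity)
        have hc0 : 0 ≤ c := (norm_nonneg _).trans hc
        rw [norm_mul] at hc
        have t1 := (h.eqn m u hv q).trans (hA.trans (le_max_left _ (‖S.ϖ‖ * ‖a‖⁻¹ * c)))
        have t2 : ‖(shift S.ϖ (S.τ m) (f u)).coeff q‖ ≤ M := by
          have t3 := h0.parent u rfl m
          have e : ‖S.ϖ‖ ^ q = ‖S.ϖ‖ ^ (q - 1) * ‖S.ϖ‖ := by
            rw [← pow_succ, Nat.sub_add_cancel (by omega)]
          rw [shift_coeff_top (h.natDegree_le u), norm_mul, norm_pow, e, mul_assoc]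
          have t4 : ‖S.ϖ‖ ^ (q - 1) ≤ ‖S.ϖ‖ := pow_le_of_le_one hpi0 hpi1 (by omega)
          refine (mul_le_mul t4 (t3.trans (max_le_max_right 1 hc)) (by positivity) hpi0).trans ?_
          rw [mul_max_of_nonneg _ _ hpi0]
          refine max_le (le_max_of_le_right ?_) (le_max_of_le_left ?_)
          · exact mul_le_mul_of_nonneg_right (le_mul_of_one_le_right hpi0 hA) hc0
          · rw [mul_one]; exact hpi1.trans hA
        have t5 : ‖(∑ l, κ l) * (f (m :: u)).coeff q‖ ≤ M := by
          refine le_max_of_le_right ?_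
          rw [norm_mul]
          calc _ ≤ ‖S.ϖ‖ * ‖a‖⁻¹ * ‖S.ϖ‖ * ‖(f (m :: u)).coeff q‖ := by
                gcongr; exact h1.sum_le
            _ ≤ ‖S.ϖ‖ * ‖a‖⁻¹ * (‖a‖ * ‖(f (m :: u)).coeff q‖) := by
                rw [mul_assoc]; gcongr
            _ ≤ _ := by gcongr
        have t6 : ‖∑ l, ((f (l :: m :: u)).coeff q - κ l * (f (m :: u)).coeff q)‖ ≤ M :=
          norm_sum_le_of_le hM0 fun l _ => (hw l).trans (le_max_left _ _)
        have t7 := norm_sub_le_of_le (norm_add_le_of_le (norm_add_le_of_le t6 t5) t2) t1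
        rw [coeff_sub, coeff_add, coeff_C_mul, low, finsetSum_coeff] at t7
        simp only [lift_coeff_top, Finset.sum_sub_distrib, ← Finset.sum_mul] at t7
        convert t7 using 2
        ring) () (by simp)
    rw [norm_mul, mul_comm] at hcontr
    rw [← div_eq_mul_inv, le_div_iff₀ hApos]
    exact hcontr
  have h2 := ((h1.near (m :: u) (by simp)).mono (le_mul_of_one_le_right (by positivity) hA)).add
    ((bdd_C hlead).mul_one (h1.nearΘ.bdd hδ))
  rwa [sub_add_cancel] at h2

end TreeData

end BreuilSchneider

end

/-! ### Uniform boundedness in the three cases -/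

noncomputable section

namespace BreuilSchneider

open Polynomial

namespace TreeData

variable {𝕜 : Type*} [NormedField 𝕜] {Λ : Type*} [Fintype Λ]

local notation "q" => Fintype.card Λ

theorem IsSol.mono {S : TreeData 𝕜 Λ} {N N' k : ℕ} {a : 𝕜} {f : List Λ → 𝕜[X]}
    (h : S.IsSol N k a f) (hN : N ≤ N') : S.IsSol N' k a f :=
  ⟨h.natDegree_le, h.finite, fun m u hu => h.eqn m u (hN.trans hu)⟩

variable [IsUltrametricDist 𝕜]

/-- The equation expresses the translates of f(v) by values at deeper vertices. Each level closer to
the root thus costs ϖ^d, which is harmless for the one or two levels missed by the inductions. -/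
theorem IsSol.bdd_of_bdd_succ {S : TreeData 𝕜 Λ} {N k d : ℕ} {a : 𝕜} {f : List Λ → 𝕜[X]}
    (h : S.IsSol N k a f) (hk : k < (d + 1) * q) (ha : ‖a‖ ≤ 1) {c : ℝ} (hc : 1 ≤ c)
    (hb : ∀ v, N + 1 ≤ v.length → Bdd c (f v)) :
    ∀ v, N ≤ v.length → Bdd ((‖S.ϖ‖ ^ d)⁻¹ * c) (f v) := by
  intro v hv
  have h1 : ∀ m, Bdd c (shift S.ϖ (S.τ m) (f v)) := by
    intro m
    have hlow : Bdd c (S.low k f (m :: v)) := Bdd.sum (by positivity) fun l _ =>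
      (hb (l :: m :: v) (by simp; omega)).lift S.ϖ_lt.le (S.τ_le l)
    have h2 := (((h.eqn m v hv).mono hc).add
      ((bdd_C ha).one_mul (hb (m :: v) (by simp; omega)))).sub hlow
    rwa [sub_add_cancel, add_sub_cancel_right] at h2
  have h2 := (S.bdd_of_shift S.ϖ_lt.le d ((h.natDegree_le v).trans_lt hk)
    fun m => (h1 m).bddTo d).of_C_mul (pow_ne_zero _ (norm_pos_iff.mp S.ϖ_pos))
  rwa [norm_pow] at h2

/-- The three cases in which the solutions are uniformly bounded. -/
theorem exists_bdd_of_isSol (S : TreeData 𝕜 Λ) {k d r : ℕ} {a : 𝕜} (hk : k = d * q + r)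
    (hr : r < q) (ha : ‖a‖ ≤ 1) (hkq : 2 * k ≤ q ^ 2)
    (hfrob : ∀ l, ‖S.τ l ^ q - S.τ l‖ ≤ ‖S.ϖ‖ ^ d)
    (H : (d + r < q ∧ ‖S.ϖ‖ ≤ ‖a‖) ∨
      (d + r < q ∧ ‖S.ϖ‖ ^ (r + 1) ≤ ‖a‖ * ‖a‖ ∧ ‖a‖ ≤ ‖S.ϖ‖ ∧ ‖(S.p : 𝕜)‖ ≤ ‖a‖) ∨
      (k < S.p * q ∧ d ≤ r + 1 ∧ ‖a‖ ≤ ‖S.ϖ‖ ^ d)) :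
    ∃ c, ∀ N f, S.IsSol N k a f → ∀ v, N ≤ v.length → Bdd c (f v) := by
  have hpos := S.ϖ_pos
  have hpi0 := S.ϖ_pos.le
  have hpi1 := S.ϖ_lt.le
  have hq2 := S.two_le_card
  have hd2 : 2 * d ≤ q := by
    have : 2 * d * q ≤ q * q := by rw [← pow_two]; refine le_trans ?_ hkq; rw [hk]; nlinarith
    exact Nat.le_of_mul_le_mul_right this (by omega)
  have hkd : k < (d + 1) * q := by rw [hk, add_mul, one_mul]; omega
  have case3 : d ≤ r + 1 → d < S.p → ‖a‖ ≤ ‖S.ϖ‖ ^ d →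
      ∃ c, ∀ N f, S.IsSol N k a f → ∀ v, N ≤ v.length → Bdd c (f v) := by
    intro h1 h2 h3
    refine ⟨(‖S.ϖ‖ ^ d)⁻¹ * 1, fun N f h v hv => ?_⟩
    have := (h.bdd_of_norm_le_pow hk hr h1 h2 hd2 h3 hfrob v hv).of_C_mul
      (pow_ne_zero _ (norm_pos_iff.mp S.ϖ_pos))
    rwa [norm_pow] at this
  have case2 : (∀ N f, S.IsSol N k a f → ∀ v, N + 2 ≤ v.length → Bdd (‖a‖⁻¹ * ‖a‖⁻¹) (f v)) →
      0 < ‖a‖ → ∃ c, ∀ N f, S.IsSol N k a f → ∀ v, N ≤ v.length → Bdd c (f v) := by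
    intro hb h0
    have h1 : 1 ≤ ‖a‖⁻¹ := (one_le_inv₀ h0).mpr ha
    have h2 : 1 ≤ (‖S.ϖ‖ ^ d)⁻¹ :=
      (one_le_inv₀ (pow_pos hpos d)).mpr (pow_le_one₀ hpi0 hpi1)
    have h3 := one_le_mul_of_one_le_of_one_le h1 h1
    exact ⟨_, fun N f h => h.bdd_of_bdd_succ hkd ha (one_le_mul_of_one_le_of_one_le h2 h3)
      ((h.mono N.le_succ).bdd_of_bdd_succ hkd ha h3 (hb N f h))⟩
  have hd0 : d = 0 → ∃ c, ∀ N f, S.IsSol N k a f → ∀ v, N ≤ v.length → Bdd c (f v) := by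
    rintro rfl
    exact case3 (by omega) S.prime.pos (by simpa using ha)
  rcases H with ⟨hdr, hpa⟩ | ⟨hdr, hra2, hap, hp⟩ | ⟨hkp, hdr, had⟩
  · rcases Nat.eq_zero_or_pos d with h0 | hd1
    · exact hd0 h0
    have h0 : 0 < ‖a‖ := hpos.trans_le hpa
    have had : S.Admissible k d r a :=
      ⟨hk, hd1, hdr, hd2, norm_pos_iff.mp h0, ha, S.p_le.trans hpa,
        (pow_le_of_le_one hpi0 hpi1 (by omega)).trans hpa⟩
    -- For r ≥ 1, or for a a unit, the Newton argument applies. The rest is r = 0 with |ϖ| ≤ |a| <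
    -- 1: d ≥ 2, then weight q with |a| > |ϖ|, then weight q with |a| = |ϖ|, where the small
    -- eigenvalue argument takes over.
    rcases Nat.eq_zero_or_pos r with rfl | hr1
    · rcases ha.eq_or_lt with h1 | h1
      · exact case2 (fun N f h v hv => h.bdd_of_pow_le had (by rw [h1, pow_zero])
          (by rw [h1]; simpa using hpi1) v (by omega)) h0
      · rcases Nat.lt_or_ge 1 d with hd | hd
        · exact case2 (fun N f h => h.bdd_of_dvd had hd hpa) h0
        · obtain rfl : d = 1 := by omega
          rcases hpa.eq_or_lt with h2 | h2
          · exact case3 (by omega) S.prime.one_lt (by rw [pow_one]; exact h2.ge)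
          · obtain rfl : k = q := by omega
            exact case2 (fun N f h v hv => h.bdd_of_weight_eq_card ha h2 v (by omega)) h0
    · refine case2 (fun N f h v hv => h.bdd_of_pow_le had
        ((pow_le_of_le_one hpi0 hpi1 (by omega)).trans hpa) ?_ v (by omega)) h0
      calc ‖S.ϖ‖ ^ (r + 1) ≤ ‖S.ϖ‖ ^ 2 := pow_le_pow_of_le_one hpi0 hpi1 (by omega)
        _ = ‖S.ϖ‖ * ‖S.ϖ‖ := sq _
        _ ≤ _ := mul_le_mul hpa hpa hpi0 h0.le
  · rcases Nat.eq_zero_or_pos d with h0 | hd1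
    · exact hd0 h0
    have h0 : 0 < ‖a‖ := by
      refine (norm_nonneg a).lt_of_ne fun h => ?_
      rw [← h, zero_mul] at hra2
      exact absurd hra2 (not_le.mpr (pow_pos hpos _))
    have hra : ‖S.ϖ‖ ^ r ≤ ‖a‖ := by
      refine le_of_mul_le_mul_right (a := ‖S.ϖ‖) ?_ hpos
      rw [← pow_succ]
      exact hra2.trans (mul_le_mul_of_nonneg_left hap h0.le)
    have had : S.Admissible k d r a :=
      ⟨hk, hd1, hdr, hd2, norm_pos_iff.mp h0, ha, hp,
        (pow_le_pow_of_le_one hpi0 hpi1 (by omega)).trans hra⟩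
    exact case2 (fun N f h v hv => h.bdd_of_pow_le had hra hra2 v (by omega)) h0
  · refine case3 hdr ?_ had
    by_contra! hp
    have := Nat.mul_le_mul_right q hp
    omega

end TreeData

end BreuilSchneider

end

/-! ### Norms, uniformizers and representatives of the residue field -/

noncomputable section

namespace BreuilSchneider

open IsLocalRing

section RingOfInt

variable {K : Type*} [NormedField K] [IsUltrametricDist K]

theorem mem_ringOfInt {x : K} : x ∈ ringOfInt K ↔ ‖x‖ ≤ 1 := Iff.rfl

theorem isUnit_ringOfInt_iff {x : ringOfInt K} : IsUnit x ↔ ‖(x : K)‖ = 1 := by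
  constructor
  · rintro ⟨u, rfl⟩
    have h1 : ((u : ringOfInt K) : K) * ((u⁻¹ : (ringOfInt K)ˣ) : ringOfInt K) = 1 := by
      rw [← MulMemClass.coe_mul, Units.mul_inv]; rfl
    have h2 := congrArg norm h1
    rw [norm_mul, norm_one] at h2
    have h3 := mem_ringOfInt.mp (u : ringOfInt K).2
    have h4 := mem_ringOfInt.mp ((u⁻¹ : (ringOfInt K)ˣ) : ringOfInt K).2
    refine le_antisymm h3 ?_
    rw [← h2]
    exact mul_le_of_le_one_right (norm_nonneg _) h4
  · intro h
    have h0 : (x : K) ≠ 0 := by rw [← norm_pos_iff, h]; exact one_pos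
    exact IsUnit.of_mul_eq_one ⟨(x : K)⁻¹, by rw [mem_ringOfInt, norm_inv, h, inv_one]⟩
      (Subtype.ext (mul_inv_cancel₀ h0))

theorem mem_maximalIdeal_ringOfInt {x : ringOfInt K} :
    x ∈ maximalIdeal (ringOfInt K) ↔ ‖(x : K)‖ < 1 := by
  rw [mem_maximalIdeal, mem_nonunits_iff, isUnit_ringOfInt_iff]
  exact ⟨fun h => (mem_ringOfInt.mp x.2).lt_of_ne h, fun h => h.ne⟩

theorem residue_eq_iff {x y : ringOfInt K} :
    residue (ringOfInt K) x = residue (ringOfInt K) y ↔ ‖(x : K) - y‖ < 1 := by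
  rw [← sub_eq_zero, ← map_sub, residue_eq_zero_iff, mem_maximalIdeal_ringOfInt]
  rfl

end RingOfInt

/-- In finite dimension σ is continuous; if |σ y| > |y|, the ratios at the powers y^n would be
unbounded, against the operator norm. Inverses give the other inequality. -/
theorem norm_algHom {p : ℕ} [Fact p.Prime] {F : Type*} [NormedField F] [NormedAlgebra ℚ_[p] F]
    [FiniteDimensional ℚ_[p] F] {C : Type*} [NormedField C] [NormedAlgebra ℚ_[p] C]
    (σ : F →ₐ[ℚ_[p]] C) (x : F) : ‖σ x‖ = ‖x‖ := by
  have hle : ∀ y : F, ‖σ y‖ ≤ ‖y‖ := by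
    intro y
    by_contra! hlt
    have hy : 0 < ‖y‖ := norm_pos_iff.mpr fun h => by simp [h] at hlt
    obtain ⟨n, hn⟩ := pow_unbounded_of_one_lt ‖LinearMap.toContinuousLinearMap σ.toLinearMap‖
      ((one_lt_div hy).mpr hlt)
    have h := (LinearMap.toContinuousLinearMap σ.toLinearMap).le_opNorm (y ^ n)
    rw [LinearMap.coe_toContinuousLinearMap', AlgHom.toLinearMap_apply, map_pow, norm_pow, norm_pow,
      ← div_le_iff₀ (pow_pos hy n), ← div_pow] at h
    exact absurd hn (not_lt.mpr h)
  refine le_antisymm (hle x) ?_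
  rcases eq_or_ne x 0 with rfl | hx
  · simp
  · have h := hle x⁻¹
    rw [map_inv₀, norm_inv, norm_inv] at h
    exact (inv_le_inv₀ (norm_pos_iff.mpr ((map_ne_zero σ).mpr hx)) (norm_pos_iff.mpr hx)).mp h

section Uniformizer

theorem norm_uniformizer_pos {F : Type*} [NormedField F] (ϖ : Fˣ) : 0 < ‖(ϖ : F)‖ :=
  norm_pos_iff.mpr ϖ.ne_zero

variable {F : Type*} [NormedField F] [IsUltrametricDist F] {ϖ : Fˣ}

namespace IsUniformizer

variable (hϖ : IsUniformizer ϖ)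
include hϖ

theorem norm_lt_one : ‖(ϖ : F)‖ < 1 := by
  obtain ⟨h, he⟩ := hϖ
  have : (⟨(ϖ : F), h⟩ : ringOfInt F) ∈ maximalIdeal (ringOfInt F) := by
    rw [he]; exact Ideal.mem_span_singleton_self _
  exact mem_maximalIdeal_ringOfInt.mp this

theorem norm_le {x : F} (hx : ‖x‖ < 1) : ‖x‖ ≤ ‖(ϖ : F)‖ := by
  obtain ⟨h, he⟩ := hϖ
  have : (⟨x, hx.le⟩ : ringOfInt F) ∈ maximalIdeal (ringOfInt F) :=
    mem_maximalIdeal_ringOfInt.mpr hx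
  rw [he, Ideal.mem_span_singleton] at this
  obtain ⟨y, hy⟩ := this
  have h1 : x = ϖ * y := congrArg Subtype.val hy
  rw [h1, norm_mul]
  exact mul_le_of_le_one_right (norm_nonneg _) (mem_ringOfInt.mp y.2)

theorem exists_norm_eq_zpow {x : F} (hx : x ≠ 0) : ∃ n : ℤ, ‖x‖ = ‖(ϖ : F)‖ ^ n := by
  have hpos := norm_uniformizer_pos ϖ
  obtain ⟨n, hn1, hn2⟩ := exists_mem_Ioc_zpow (norm_pos_iff.mpr hx)
    ((one_lt_inv₀ hpos).mpr hϖ.norm_lt_one)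
  refine ⟨-(n + 1), le_antisymm (by rwa [zpow_neg, ← inv_zpow]) ?_⟩
  have h1 : ‖(ϖ : F) ^ (-n) * x⁻¹‖ < 1 := by
    rw [norm_mul, norm_zpow, norm_inv, ← div_eq_mul_inv, div_lt_one (norm_pos_iff.mpr hx), zpow_neg,
      ← inv_zpow]
    exact hn1
  have h2 := hϖ.norm_le h1
  rw [norm_mul, norm_zpow, norm_inv, ← div_eq_mul_inv, div_le_iff₀ (norm_pos_iff.mpr hx)] at h2
  rw [show -(n + 1) = -n - 1 by ring, zpow_sub_one₀ hpos.ne', ← div_eq_mul_inv, div_le_iff₀ hpos,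
    mul_comm]
  exact h2

theorem norm_eq_zpow_ordF {x : F} (hx : x ≠ 0) : ‖x‖ = ‖(ϖ : F)‖ ^ ordF ϖ x := by
  have h := hϖ.exists_norm_eq_zpow hx
  rw [ordF, dif_pos h]
  exact h.choose_spec

theorem ordF_eq {x : F} {n : ℤ} (h : ‖x‖ = ‖(ϖ : F)‖ ^ n) : ordF ϖ x = n := by
  have hpos := norm_uniformizer_pos ϖ
  have hx : x ≠ 0 := by rw [← norm_pos_iff, h]; exact zpow_pos hpos n
  rw [hϖ.norm_eq_zpow_ordF hx] at h
  exact zpow_right_injective₀ hpos hϖ.norm_lt_one.ne h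

theorem ordF_mul {x y : F} (hx : x ≠ 0) (hy : y ≠ 0) : ordF ϖ (x * y) = ordF ϖ x + ordF ϖ y := by
  refine hϖ.ordF_eq ?_
  rw [norm_mul, hϖ.norm_eq_zpow_ordF hx, hϖ.norm_eq_zpow_ordF hy,
    zpow_add₀ (norm_uniformizer_pos ϖ).ne']

end IsUniformizer

end Uniformizer

/-- In x^n - y^n = (∑ x^i y^(n-1-i)) (x - y) the sum is n y^(n-1) modulo ω, hence divisible by ω. -/
theorem pow_succ_dvd_pow_sub_pow {R : Type*} [CommRing R] {ω x y : R} {n j : ℕ}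
    (hn : ω ∣ (n : R)) (hj : 1 ≤ j) (h : ω ^ j ∣ x - y) : ω ^ (j + 1) ∣ x ^ n - y ^ n := by
  rw [← geom_sum₂_mul, pow_succ']
  refine mul_dvd_mul ?_ h
  rw [← Ideal.mem_span_singleton, ← Ideal.Quotient.eq_zero_iff_mem, RingHom.map_geom_sum₂]
  have h1 : Ideal.Quotient.mk (Ideal.span {ω}) x = Ideal.Quotient.mk (Ideal.span {ω}) y := by
    rw [Ideal.Quotient.mk_eq_mk_iff_sub_mem, Ideal.mem_span_singleton]
    exact (dvd_pow_self ω (by omega)).trans h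
  have h2 : ((n : ℕ) : R ⧸ Ideal.span {ω}) = 0 := by
    rw [← map_natCast (Ideal.Quotient.mk (Ideal.span {ω})), Ideal.Quotient.eq_zero_iff_mem,
      Ideal.mem_span_singleton]
    exact hn
  rw [h1, geom_sum₂_self, h2, zero_mul]

theorem pow_succ_dvd_iterate_pow_sub {R : Type*} [CommRing R] {ω x : R} {n : ℕ}
    (hn : ω ∣ (n : R)) (h : ω ∣ x ^ n - x) (L : ℕ) :
    ω ^ (L + 1) ∣ (x ^ n ^ L) ^ n - x ^ n ^ L := by
  induction L with
  | zero => simpa using h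
  | succ L ih =>
    have := pow_succ_dvd_pow_sub_pow hn (by omega) ih
    rwa [← pow_mul x, ← pow_succ] at this

section LocalField

variable {p : ℕ} [Fact p.Prime] {F : Type*} [NormedField F] [NormedAlgebra ℚ_[p] F]

theorem norm_natCast_eq_padic (n : ℕ) : ‖(n : F)‖ = ‖(n : ℚ_[p])‖ := by
  rw [← map_natCast (algebraMap ℚ_[p] F), norm_algebraMap']

variable (p) in
theorem norm_prime_lt_one : ‖(p : F)‖ < 1 := by
  rw [norm_natCast_eq_padic (p := p)]
  exact Padic.norm_p_lt_one

variable (p) in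
theorem norm_prime_pos : 0 < ‖(p : F)‖ := by
  have : (p : ℚ_[p]) ≠ 0 := Nat.cast_ne_zero.mpr (Fact.out : p.Prime).ne_zero
  rw [norm_natCast_eq_padic (p := p)]
  exact norm_pos_iff.mpr this

theorem norm_natCast_eq_one {n : ℕ} (h : ¬p ∣ n) : ‖(n : F)‖ = 1 := by
  rw [norm_natCast_eq_padic (p := p), Padic.norm_natCast_eq_one_iff]
  exact (Nat.Prime.coprime_iff_not_dvd Fact.out).mpr h

variable [IsUltrametricDist F]

variable (p F) in
theorem charP_residueField : CharP (ResidueField (ringOfInt F)) p := by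
  refine ringChar.of_eq (CharP.ringChar_of_prime_eq_zero Fact.out ?_)
  rw [← map_natCast (residue (ringOfInt F)), residue_eq_zero_iff, mem_maximalIdeal_ringOfInt]
  exact norm_prime_lt_one p

local notation "Λ" => ResidueField (ringOfInt F)

theorem norm_le_pow_of_pow_dvd {ω : F} (hω : ω ∈ ringOfInt F) {n : ℕ} {x : ringOfInt F}
    (h : (⟨ω, hω⟩ : ringOfInt F) ^ n ∣ x) : ‖(x : F)‖ ≤ ‖ω‖ ^ n := by
  obtain ⟨y, rfl⟩ := h
  rw [MulMemClass.coe_mul, SubmonoidClass.coe_pow, norm_mul, norm_pow]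
  exact mul_le_of_le_one_right (by positivity) (mem_ringOfInt.mp y.2)

/-- Representatives of the residue field, approximately fixed by the Frobenius. -/
theorem IsUniformizer.exists_representatives [Fintype Λ] {ϖ : Fˣ} (hϖ : IsUniformizer ϖ) (L : ℕ) :
    ∃ τ : Λ → ringOfInt F, (∀ l, residue (ringOfInt F) (τ l) = l) ∧
      ∀ l, ‖(τ l : F) ^ Fintype.card Λ - τ l‖ ≤ ‖(ϖ : F)‖ ^ L := by
  obtain ⟨hmem, he⟩ := hϖ
  have hdvd : ∀ x : ringOfInt F, residue (ringOfInt F) x = 0 → (⟨(ϖ : F), hmem⟩ : ringOfInt F) ∣ x :=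
    fun x hx => by
      rw [residue_eq_zero_iff, he, Ideal.mem_span_singleton] at hx
      exact hx
  choose s hs using residue_surjective (R := ringOfInt F)
  -- Approximate Teichmüller representatives: raising to the q-th power L times improves the
  -- congruence τ^q ≡ τ and keeps the residue class.
  refine ⟨fun l => s l ^ Fintype.card Λ ^ L, fun l => ?_, fun l => ?_⟩
  · rw [map_pow, hs, FiniteField.pow_card_pow]
  · have h1 := pow_succ_dvd_iterate_pow_sub (ω := (⟨(ϖ : F), hmem⟩ : ringOfInt F)) (x := s l)
      (n := Fintype.card Λ) (hdvd _ (by rw [map_natCast, FiniteField.cast_card_eq_zero]))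
      (hdvd _ (by rw [map_sub, map_pow, hs, FiniteField.pow_card, sub_self])) L
    have h2 := norm_le_pow_of_pow_dvd hmem ((pow_dvd_pow _ L.le_succ).trans h1)
    exact h2

variable [FiniteDimensional ℚ_[p] F] {C : Type*} [NormedField C] [NormedAlgebra ℚ_[p] C]

theorem IsUniformizer.exists_treeData [Fintype Λ] {ϖ : Fˣ} (hϖ : IsUniformizer ϖ)
    (σ : F →ₐ[ℚ_[p]] C) (d : ℕ) :
    ∃ (S : TreeData C Λ) (τ : Λ → ringOfInt F), S.p = p ∧ S.ϖ = σ ϖ ∧ (∀ l, S.τ l = σ (τ l)) ∧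
      (∀ l, residue (ringOfInt F) (τ l) = l) ∧
      ∀ l, ‖S.τ l ^ Fintype.card Λ - S.τ l‖ ≤ ‖S.ϖ‖ ^ d := by
  -- The precision max n d makes τ^q - τ divisible both by p, as `TreeData` demands, and by ϖ^d.
  obtain ⟨n, hn⟩ := exists_pow_lt_of_lt_one (norm_prime_pos p (F := F)) hϖ.norm_lt_one
  obtain ⟨τ, hτ, hfrob⟩ := hϖ.exists_representatives (max n d)
  have hpi0 := (norm_uniformizer_pos ϖ).le
  have hsub : ∀ l m, l ≠ m → ‖(τ l : F) - τ m‖ = 1 := fun l m hlm => by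
    refine le_antisymm (mem_ringOfInt.mp (τ l - τ m).2) (not_lt.mp fun h => hlm ?_)
    rw [← hτ l, ← hτ m]
    exact residue_eq_iff.mpr h
  have hfrobC : ∀ l, ‖σ (τ l) ^ Fintype.card Λ - σ (τ l)‖ ≤ ‖(ϖ : F)‖ ^ max n d := fun l => by
    rw [← map_pow, ← map_sub, norm_algHom]
    exact hfrob l
  have hpC : ‖(p : C)‖ = ‖(p : F)‖ :=
    (norm_natCast_eq_padic (p := p) p).trans (norm_natCast_eq_padic p).symm
  refine ⟨⟨p, σ ϖ, fun l => σ (τ l), Fact.out, ?_, ?_, ?_, ?_, fun n => norm_natCast_eq_one, ?_, ?_,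
    ?_, ?_⟩, τ, rfl, rfl, fun l => rfl, hτ, fun l => ?_⟩
  · have := charP_residueField p F
    obtain ⟨n, -, h⟩ := FiniteField.card Λ p
    exact ⟨n, n.pos, h⟩
  · rw [norm_algHom]; exact norm_uniformizer_pos ϖ
  · rw [norm_algHom]; exact hϖ.norm_lt_one
  · rw [norm_algHom, hpC]; exact hϖ.norm_le (norm_prime_lt_one p)
  · exact fun l => by rw [norm_algHom]; exact mem_ringOfInt.mp (τ l).2
  · exact fun l m h => by rw [← map_sub, norm_algHom]; exact hsub l m h
  · refine fun l => (hfrobC l).trans ?_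
    rw [hpC]
    exact (pow_le_pow_of_le_one hpi0 hϖ.norm_lt_one.le (le_max_left n d)).trans hn.le
  · intro j hj
    have h1 : residue (ringOfInt F) (∑ l, τ l ^ j) = 0 := by
      rw [map_sum]
      simp only [map_pow, hτ]
      exact FiniteField.sum_pow_lt_card_sub_one Λ j hj
    rw [residue_eq_zero_iff, mem_maximalIdeal_ringOfInt] at h1
    have h2 := hϖ.norm_le h1
    have h3 : ∑ l, σ (τ l) ^ j = σ ((∑ l, τ l ^ j : ringOfInt F) : F) := by
      rw [AddSubmonoidClass.coe_finsetSum, map_sum]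
      exact Finset.sum_congr rfl fun l _ => by rw [SubmonoidClass.coe_pow, map_pow]
    rw [h3, norm_algHom, norm_algHom]
    exact h2
  · exact ((hfrobC l).trans (pow_le_pow_of_le_one hpi0 hϖ.norm_lt_one.le (le_max_right n d))).trans
      (congrArg (· ^ d) (norm_algHom σ (ϖ : F)).symm).le

end LocalField

end BreuilSchneider

end

/-! ### Matrices, vertices and words -/

noncomputable section

namespace BreuilSchneider

open IsLocalRing

section Matrices

variable {F : Type*} [NormedField F] [IsUltrametricDist F]

theorem norm_matrix_mul_le {A B : Matrix (Fin 2) (Fin 2) F} {s t : ℝ} (hA : ∀ i j, ‖A i j‖ ≤ s)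
    (hB : ∀ i j, ‖B i j‖ ≤ t) (i j : Fin 2) : ‖(A * B) i j‖ ≤ s * t := by
  have hs : 0 ≤ s := (norm_nonneg _).trans (hA 0 0)
  have ht : 0 ≤ t := (norm_nonneg _).trans (hB 0 0)
  rw [Matrix.mul_apply]
  refine norm_sum_le_of_le (by positivity) fun l _ => ?_
  rw [norm_mul]
  exact mul_le_mul (hA _ _) (hB _ _) (norm_nonneg _) hs

theorem mem_maxCompact_iff {g : GL (Fin 2) F} :
    g ∈ maxCompact F ↔ (∀ i j, ‖g i j‖ ≤ 1) ∧ ‖(g : Matrix (Fin 2) (Fin 2) F).det‖ = 1 := by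
  constructor
  · rintro ⟨h, rfl⟩
    refine ⟨fun i j => (h i j).2, ?_⟩
    have h1 : ((Matrix.GeneralLinearGroup.map (algebraMap (ringOfInt F) F) h : GL (Fin 2) F) :
        Matrix (Fin 2) (Fin 2) F).det = ((h : Matrix (Fin 2) (Fin 2) (ringOfInt F)).det : F) := by
      simp only [Matrix.det_fin_two]
      rfl
    rw [h1]
    exact isUnit_ringOfInt_iff.mp ((Matrix.isUnit_iff_isUnit_det _).mp h.isUnit)
  · rintro ⟨h, hdet⟩
    let A : Matrix (Fin 2) (Fin 2) (ringOfInt F) := Matrix.of fun i j => ⟨g i j, h i j⟩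
    have hA : (A.det : F) = (g : Matrix (Fin 2) (Fin 2) F).det := by
      simp only [Matrix.det_fin_two]
      rfl
    refine ⟨Matrix.GeneralLinearGroup.mk'' A (isUnit_ringOfInt_iff.mpr (hA ▸ hdet)), ?_⟩
    ext i j
    rfl

/-- The element c is the central part of g. Only sizes of entries and determinant are left, so
membership in KZ becomes a computation with explicit matrices. -/
theorem mem_KZ_iff {g : GL (Fin 2) F} : g ∈ KZ F ↔
    ∃ c : F, c ≠ 0 ∧ (∀ i j, ‖g i j‖ ≤ ‖c‖) ∧
      ‖(g : Matrix (Fin 2) (Fin 2) F).det‖ = ‖c‖ ^ 2 := by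
  rw [KZ, Subgroup.mem_sup_of_normal_right]
  constructor
  · rintro ⟨y, hy, z, hz, rfl⟩
    rw [Matrix.GeneralLinearGroup.center_eq_range_scalar] at hz
    obtain ⟨c, rfl⟩ := hz
    rw [mem_maxCompact_iff] at hy
    refine ⟨c, c.ne_zero, fun i j => ?_, ?_⟩
    · have h1 : (y * Matrix.GeneralLinearGroup.scalar (Fin 2) c : GL (Fin 2) F) i j =
          y i j * c := by
        simp
      rw [h1, norm_mul]
      exact mul_le_of_le_one_left (norm_nonneg _) (hy.1 i j)
    · rw [Matrix.GeneralLinearGroup.coe_mul, Matrix.det_mul, norm_mul, hy.2, one_mul]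
      simp
  · rintro ⟨c, hc, h, hdet⟩
    have hs : ∀ d : Fˣ, ∀ i j, (g * Matrix.GeneralLinearGroup.scalar (Fin 2) d : GL (Fin 2) F) i j =
          g i j * d := fun d i j => by simp
    refine ⟨g * Matrix.GeneralLinearGroup.scalar (Fin 2) (Units.mk0 c hc)⁻¹, ?_,
      Matrix.GeneralLinearGroup.scalar (Fin 2) (Units.mk0 c hc), ?_, ?_⟩
    · have hc0 : 0 < ‖c‖ := norm_pos_iff.mpr hc
      rw [mem_maxCompact_iff]
      refine ⟨fun i j => ?_, ?_⟩
      · rw [hs, norm_mul, Units.val_inv_eq_inv_val, Units.val_mk0, norm_inv, ← div_eq_mul_inv,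
          div_le_one hc0]
        exact h i j
      · rw [Matrix.det_fin_two, hs, hs, hs, hs, mul_mul_mul_comm, mul_mul_mul_comm (g 0 1),
          ← sub_mul, ← Matrix.det_fin_two, norm_mul, hdet, Units.val_inv_eq_inv_val, Units.val_mk0,
          norm_mul, norm_inv]
        field_simp
    · rw [Matrix.GeneralLinearGroup.center_eq_range_scalar]
      exact ⟨_, rfl⟩
    · rw [map_inv, inv_mul_cancel_right]

theorem inv_mul_mem_KZ {g x : GL (Fin 2) F} {B : Matrix (Fin 2) (Fin 2) F}
    (h : (g : Matrix (Fin 2) (Fin 2) F) * B = x) {c : F} (hc : c ≠ 0) (hB : ∀ i j, ‖B i j‖ ≤ ‖c‖)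
    (hdet : ‖B.det‖ = ‖c‖ ^ 2) : g⁻¹ * x ∈ KZ F := by
  have h1 : ((g⁻¹ * x : GL (Fin 2) F) : Matrix (Fin 2) (Fin 2) F) = B := by
    rw [Matrix.GeneralLinearGroup.coe_mul, ← h, ← Matrix.mul_assoc,
      ← Matrix.GeneralLinearGroup.coe_mul, inv_mul_cancel, Matrix.GeneralLinearGroup.coe_one,
      Matrix.one_mul]
  rw [mem_KZ_iff]
  exact ⟨c, hc, fun i j => by rw [h1]; exact hB i j, by rw [h1]; exact hdet⟩

theorem norm_le_one_of_mem_iwahori {i : GL (Fin 2) F} (hi : i ∈ iwahori F) :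
    i ∈ maxCompact F ∧ ‖i 1 0‖ < 1 := by
  obtain ⟨h, h1, rfl⟩ := hi
  exact ⟨⟨h, rfl⟩, mem_maximalIdeal_ringOfInt.mp h1⟩

theorem norm_mul_KZ_le {M : Matrix (Fin 2) (Fin 2) F} {g i κ : GL (Fin 2) F}
    (hi : i ∈ maxCompact F) (hκ : κ ∈ KZ F) {s : ℝ} (hM : ∀ a b, ‖M a b‖ ≤ s)
    (h : (g : Matrix (Fin 2) (Fin 2) F) = i * M * κ) :
    ∃ c : ℝ, 0 < c ∧ (∀ a b, ‖g a b‖ ≤ s * c) ∧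
      ‖(g : Matrix (Fin 2) (Fin 2) F).det‖ = ‖M.det‖ * c ^ 2 := by
  obtain ⟨hi1, hi2⟩ := mem_maxCompact_iff.mp hi
  obtain ⟨c, hc, hκ1, hκ2⟩ := mem_KZ_iff.mp hκ
  refine ⟨‖c‖, norm_pos_iff.mpr hc, fun a b => ?_, ?_⟩
  · rw [h]
    have := norm_matrix_mul_le (norm_matrix_mul_le hi1 hM) hκ1 a b
    rwa [one_mul] at this
  · rw [h, Matrix.det_mul, Matrix.det_mul, norm_mul, norm_mul, hi2, hκ2, one_mul]

end Matrices

section Vertices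

variable {F : Type*} [NormedField F] (ϖ : Fˣ)

/-- The matrix `(ϖ x; 0 1)`. -/
def childMatrix (x : F) : GL (Fin 2) F :=
  Matrix.GeneralLinearGroup.mkOfDetNeZero !![(ϖ : F), x; 0, 1] (by simp)

theorem coe_childMatrix (x : F) :
    (childMatrix ϖ x : Matrix (Fin 2) (Fin 2) F) = !![(ϖ : F), x; 0, 1] := rfl

theorem coe_alpha [IsUltrametricDist F] :
    (alpha ϖ : Matrix (Fin 2) (Fin 2) F) = !![1, 0; 0, (ϖ : F)] := rfl

theorem coe_beta [IsUltrametricDist F] :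
    (beta ϖ : Matrix (Fin 2) (Fin 2) F) = !![0, 1; (ϖ : F), 0] := rfl

theorem coe_childMatrix_inv (x : F) : ((childMatrix ϖ x)⁻¹ : GL (Fin 2) F).1 =
    !![(ϖ : F)⁻¹, -x * (ϖ : F)⁻¹; 0, 1] := by
  have h : (childMatrix ϖ x) * (Matrix.GeneralLinearGroup.mkOfDetNeZero
      !![(ϖ : F)⁻¹, -x * (ϖ : F)⁻¹; 0, 1] (by simp) : GL (Fin 2) F) = 1 := by
    have := ϖ.ne_zero
    ext i j
    fin_cases i <;> fin_cases j <;>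
      simp [coe_childMatrix, Matrix.GeneralLinearGroup.mkOfDetNeZero,
        Matrix.mul_apply, mul_left_comm _ x]
  rw [inv_eq_of_mul_eq_one_right h]
  rfl

theorem coe_alpha_inv_pow [IsUltrametricDist F] (m : ℕ) : ((alpha ϖ)⁻¹ ^ m : GL (Fin 2) F).1 =
    !![1, 0; 0, ((ϖ : F) ^ m)⁻¹] := by
  have h : (alpha ϖ) ^ m * (Matrix.GeneralLinearGroup.mkOfDetNeZero
      !![1, 0; 0, ((ϖ : F) ^ m)⁻¹] (by simp) : GL (Fin 2) F) = 1 := by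
    have h0 : ((alpha ϖ) ^ m : GL (Fin 2) F).1 = !![1, 0; 0, (ϖ : F) ^ m] := by
      induction m with
      | zero => ext i j; fin_cases i <;> fin_cases j <;> simp
      | succ m ih =>
        rw [pow_succ, Units.val_mul, ih, coe_alpha]
        ext i j; fin_cases i <;> fin_cases j <;> simp [Matrix.mul_apply, pow_succ]
    have := ϖ.ne_zero
    ext i j
    rw [Matrix.GeneralLinearGroup.coe_mul, h0]
    fin_cases i <;> fin_cases j <;>
      simp [Matrix.GeneralLinearGroup.mkOfDetNeZero, Matrix.mul_apply]
  rw [inv_pow, inv_eq_of_mul_eq_one_right h]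
  rfl

variable {Λ : Type*} (τ : Λ → F)

/-- The element of `GL₂(F)` attached to a vertex of the rooted tree of words. -/
def vertex : List Λ → GL (Fin 2) F
  | [] => 1
  | l :: v => vertex v * childMatrix ϖ (τ l)

/-- The upper right coefficient of `vertex v`. -/
def shiftOf : List Λ → F
  | [] => 0
  | l :: v => (ϖ : F) ^ v.length * τ l + shiftOf v

theorem coe_vertex (v : List Λ) : (vertex ϖ τ v : Matrix (Fin 2) (Fin 2) F) =
    !![(ϖ : F) ^ v.length, shiftOf ϖ τ v; 0, 1] := by
  induction v with
  | nil => ext i j; fin_cases i <;> fin_cases j <;> simp [vertex, shiftOf]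
  | cons l v ih =>
    rw [vertex, Matrix.GeneralLinearGroup.coe_mul, ih, coe_childMatrix]
    ext i j; fin_cases i <;> fin_cases j <;>
      simp [Matrix.mul_apply, pow_succ, shiftOf]

theorem vertex_one_one (v : List Λ) : vertex ϖ τ v 1 1 = 1 := by
  rw [coe_vertex]; rfl

theorem norm_det_vertex (v : List Λ) :
    ‖(vertex ϖ τ v : Matrix (Fin 2) (Fin 2) F).det‖ = ‖(ϖ : F)‖ ^ v.length := by
  rw [coe_vertex, Matrix.det_fin_two_of]; simp

end Vertices

section Tree

variable {F : Type*} [NormedField F] [IsUltrametricDist F] {ϖ : Fˣ}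

theorem mul_mem_ball {N : ℕ} {g κ : GL (Fin 2) F} (hg : g ∈ ball ϖ N) (hκ : κ ∈ KZ F) :
    g * κ ∈ ball ϖ N := by
  rcases hg with ⟨m, hm, i, hi, κ', hκ', rfl⟩ | ⟨m, hm, i, hi, κ', hκ', rfl⟩
  · exact Or.inl ⟨m, hm, i, hi, κ' * κ, mul_mem hκ' hκ, by group⟩
  · exact Or.inr ⟨m, hm, i, hi, κ' * κ, mul_mem hκ' hκ, by group⟩

theorem childMatrix_mul_alpha_mem {x : F} (hx : ‖x‖ ≤ 1) :
    childMatrix ϖ x * alpha ϖ ∈ KZ F := by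
  rw [mem_KZ_iff]
  have e : (childMatrix ϖ x * alpha ϖ : GL (Fin 2) F).1 =
      !![(ϖ : F), x * ϖ; 0, (ϖ : F)] := by
    rw [Units.val_mul, coe_childMatrix, coe_alpha]
    ext i j; fin_cases i <;> fin_cases j <;> simp [Matrix.mul_apply]
  refine ⟨ϖ, ϖ.ne_zero, fun i j => ?_, ?_⟩
  · rw [e]
    fin_cases i <;> fin_cases j <;> simp [hx]
  · rw [e, Matrix.det_fin_two_of]; simp [pow_two]

theorem exists_eq_childMatrix_mul {x : F} (hx : ‖x‖ ≤ 1) : ∃ κ₁ ∈ KZ F, ∃ κ₂ ∈ KZ F,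
    childMatrix ϖ x = κ₁ * (alpha ϖ)⁻¹ * κ₂ :=
  ⟨childMatrix ϖ x * alpha ϖ, childMatrix_mul_alpha_mem hx, 1, one_mem _, by group⟩

/-- Conjugation by the Weyl element turns α⁻¹ into ϖ⁻¹ α. -/
theorem exists_eq_alpha_mul : ∃ κ₁ ∈ KZ F, ∃ κ₂ ∈ KZ F, alpha ϖ = κ₁ * (alpha ϖ)⁻¹ * κ₂ := by
  let w : GL (Fin 2) F := Matrix.GeneralLinearGroup.mkOfDetNeZero !![0, 1; 1, 0] (by simp)
  have hw : w ∈ KZ F := by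
    rw [mem_KZ_iff]
    have e : w.1 = !![0, 1; 1, 0] := rfl
    refine ⟨1, one_ne_zero, fun i j => ?_, ?_⟩
    · rw [e]
      fin_cases i <;> fin_cases j <;> simp
    · rw [e, Matrix.det_fin_two_of]; simp
  refine ⟨w, hw, (w * (alpha ϖ)⁻¹)⁻¹ * alpha ϖ, ?_, by group⟩
  refine inv_mul_mem_KZ (B := !![0, (ϖ : F); (ϖ : F), 0]) (c := ϖ) ?_ ϖ.ne_zero (fun i j => ?_) ?_
  · have := coe_alpha_inv_pow ϖ 1
    rw [pow_one, pow_one] at this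
    have e : w.1 = !![0, 1; 1, 0] := rfl
    rw [Units.val_mul, e, this, coe_alpha]
    ext i j; fin_cases i <;> fin_cases j <;> simp [Matrix.mul_apply]
  · fin_cases i <;> fin_cases j <;> simp
  · rw [Matrix.det_fin_two_of]; simp [pow_two]

variable (hϖ : IsUniformizer ϖ)
include hϖ

/-- The matrix of v has an entry 1 and determinant ϖ^length. In the n-th sphere, n ≤ N, the entry 1
bounds the central factor below, which forces the determinant to have norm at least |ϖ|^n. -/
theorem IsUniformizer.vertex_notMem_ball {Λ : Type*} (τ : Λ → F) {v : List Λ} {N : ℕ}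
    (hv : N < v.length) : vertex ϖ τ v ∉ ball ϖ N := by
  have hpos := norm_uniformizer_pos ϖ
  have hlt := hϖ.norm_lt_one
  have hinv : ∀ m, 1 ≤ (‖(ϖ : F)‖ ^ m)⁻¹ := fun m =>
    (one_le_inv₀ (pow_pos hpos m)).mpr (pow_le_one₀ hpos.le hlt.le)
  have key : ∀ {M : Matrix (Fin 2) (Fin 2) F} {i κ : GL (Fin 2) F}, i ∈ maxCompact F → κ ∈ KZ F →
      ∀ m : ℕ, (∀ a b, ‖M a b‖ ≤ (‖(ϖ : F)‖ ^ m)⁻¹) → ∀ n ≤ N,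
      ‖M.det‖ * (‖(ϖ : F)‖ ^ m) ^ 2 = ‖(ϖ : F)‖ ^ n →
      (vertex ϖ τ v : Matrix (Fin 2) (Fin 2) F) = i * M * κ → False := by
    intro M i κ hi hκ m hM n hn hdet h
    obtain ⟨c, hc, h1, h2⟩ := norm_mul_KZ_le hi hκ hM h
    have h3 := h1 1 1
    rw [vertex_one_one, norm_one, inv_mul_eq_div, one_le_div (pow_pos hpos m)] at h3
    rw [norm_det_vertex] at h2
    have h4 : ‖(ϖ : F)‖ ^ n ≤ ‖(ϖ : F)‖ ^ v.length := by
      rw [h2, ← hdet]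
      gcongr
    have := (pow_le_pow_iff_right_of_lt_one₀ hpos hlt).mp h4
    omega
  rintro (⟨m, hm, i, hi, κ, hκ, h⟩ | ⟨m, hm, i, hi, κ, hκ, h⟩)
  · refine key (norm_le_one_of_mem_iwahori hi).1 hκ m (M := ((alpha ϖ)⁻¹ ^ m : GL (Fin 2) F).1) ?_ m hm
      ?_ (by rw [h, Units.val_mul, Units.val_mul])
    · rw [coe_alpha_inv_pow]
      intro a b
      fin_cases a <;> fin_cases b <;> simp [hinv m]
    · rw [coe_alpha_inv_pow, Matrix.det_fin_two_of]
      have := (pow_pos hpos m).ne'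
      simp
      field_simp
  · refine key (norm_le_one_of_mem_iwahori hi).1 hκ m
      (M := (beta ϖ * (alpha ϖ)⁻¹ ^ m : GL (Fin 2) F).1) ?_ (m + 1) hm
      ?_ (by rw [h, Units.val_mul, Units.val_mul, Units.val_mul, Units.val_mul, Matrix.mul_assoc i.1])
    · rw [Units.val_mul, coe_alpha_inv_pow, coe_beta]
      intro a b
      fin_cases a <;> fin_cases b <;> simp [Matrix.mul_apply, hlt.le.trans (hinv m)]
    · rw [Units.val_mul, coe_alpha_inv_pow, coe_beta, Matrix.det_mul, Matrix.det_fin_two_of,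
        Matrix.det_fin_two_of]
      have := (pow_pos hpos m).ne'
      simp
      field_simp
      ring

/-- The words attached to a finite set of vertices have bounded length. -/
theorem IsUniformizer.exists_length_lt {Λ : Type*} (τ : Λ → F) (x : GL (Fin 2) F) :
    ∃ M : ℕ, ∀ v : List Λ, ∀ κ ∈ KZ F, (vertex ϖ τ v)⁻¹ = κ * x → v.length < M := by
  have hpos := norm_uniformizer_pos ϖ
  have hlt := hϖ.norm_lt_one
  obtain ⟨s, hs⟩ : ∃ s : ℝ, ∀ a b, ‖(x⁻¹ : GL (Fin 2) F) a b‖ ≤ s := by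
    refine ⟨∑ a, ∑ b, ‖(x⁻¹ : GL (Fin 2) F) a b‖, fun a b => ?_⟩
    exact (Finset.single_le_sum (f := fun b => ‖(x⁻¹ : GL (Fin 2) F) a b‖)
      (fun _ _ => norm_nonneg _) (Finset.mem_univ b)).trans
      (Finset.single_le_sum (f := fun a => ∑ b, ‖(x⁻¹ : GL (Fin 2) F) a b‖)
      (fun _ _ => Finset.sum_nonneg fun _ _ => norm_nonneg _) (Finset.mem_univ a))
  have hd : 0 < ‖((x⁻¹ : GL (Fin 2) F) : Matrix (Fin 2) (Fin 2) F).det‖ := by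
    rw [norm_pos_iff]
    exact ((Matrix.isUnit_iff_isUnit_det _).mp (x⁻¹).isUnit).ne_zero
  obtain ⟨M, hM⟩ := exists_pow_lt_of_lt_one
    (show 0 < ‖((x⁻¹ : GL (Fin 2) F) : Matrix (Fin 2) (Fin 2) F).det‖ / (s ^ 2 + 1) by positivity) hlt
  refine ⟨M, fun v κ hκ h => ?_⟩
  have e : vertex ϖ τ v = 1 * x⁻¹ * κ⁻¹ := by
    rw [one_mul, ← mul_inv_rev, ← h, inv_inv]
  obtain ⟨c, hc, h1, h2⟩ := norm_mul_KZ_le (one_mem _) (inv_mem hκ) hs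
    (show (vertex ϖ τ v : Matrix (Fin 2) (Fin 2) F) = (1 : GL (Fin 2) F) *
      ((x⁻¹ : GL (Fin 2) F) : Matrix (Fin 2) (Fin 2) F) * (κ⁻¹ : GL (Fin 2) F) by
        rw [e, Units.val_mul, Units.val_mul])
  have h3 := h1 1 1
  rw [vertex_one_one, norm_one] at h3
  rw [norm_det_vertex] at h2
  have h4 : ‖((x⁻¹ : GL (Fin 2) F) : Matrix (Fin 2) (Fin 2) F).det‖ / (s ^ 2 + 1) ≤
      ‖(ϖ : F)‖ ^ v.length := by
    rw [h2, div_le_iff₀ (by positivity), mul_assoc]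
    refine le_mul_of_one_le_right hd.le ?_
    have : 1 ≤ (s * c) ^ 2 := one_le_pow₀ h3
    nlinarith [sq_nonneg c]
  exact (pow_lt_pow_iff_right_of_lt_one₀ hpos hlt).mp (hM.trans_le h4)

theorem IsUniformizer.alpha_inv_mul_childMatrix_notMem (x : F) :
    (alpha ϖ)⁻¹ * childMatrix ϖ x ∉ KZ F := by
  have hpos := norm_uniformizer_pos ϖ
  have hlt := hϖ.norm_lt_one
  rw [mem_KZ_iff]
  have e : ((alpha ϖ)⁻¹ * childMatrix ϖ x : GL (Fin 2) F).1 =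
      !![(ϖ : F), x; 0, (ϖ : F)⁻¹] := by
    have := coe_alpha_inv_pow ϖ 1
    rw [pow_one, pow_one] at this
    rw [Units.val_mul, coe_childMatrix, this]
    ext i j; fin_cases i <;> fin_cases j <;> simp [Matrix.mul_apply]
  rintro ⟨c, hc, h, hdet⟩
  rw [e, Matrix.det_fin_two_of, mul_zero, sub_zero, mul_inv_cancel₀ ϖ.ne_zero, norm_one] at hdet
  have h1 := h 1 1
  rw [e] at h1
  simp only [Matrix.of_apply, Matrix.cons_val', Matrix.cons_val_one, Matrix.cons_val_fin_one] at h1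
  have h2 : ‖c‖ = 1 := by
    have := (pow_eq_one_iff_of_nonneg (norm_nonneg c) two_ne_zero).mp hdet.symm
    exact this
  rw [h2, norm_inv] at h1
  exact absurd h1 (not_le.mpr ((one_lt_inv₀ hpos).mpr hlt))

theorem IsUniformizer.norm_sub_lt_one_of_inv_mul_mem {x y : F}
    (hxy : (childMatrix ϖ x)⁻¹ * childMatrix ϖ y ∈ KZ F) : ‖y - x‖ < 1 := by
  have hpos := norm_uniformizer_pos ϖ
  have hlt := hϖ.norm_lt_one
  rw [mem_KZ_iff] at hxy
  have e : ((childMatrix ϖ x)⁻¹ * childMatrix ϖ y : GL (Fin 2) F).1 =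
      !![1, (y - x) * (ϖ : F)⁻¹; 0, 1] := by
    rw [Units.val_mul, coe_childMatrix, coe_childMatrix_inv]
    ext i j; fin_cases i <;> fin_cases j <;> simp [Matrix.mul_apply]
    ring
  obtain ⟨c, hc, h, hdet⟩ := hxy
  rw [e, Matrix.det_fin_two_of, mul_zero, sub_zero, mul_one, norm_one] at hdet
  have h1 := h 0 1
  have h2 : ‖c‖ = 1 := (pow_eq_one_iff_of_nonneg (norm_nonneg c) two_ne_zero).mp hdet.symm
  rw [e, h2] at h1
  simp only [Matrix.of_apply, Matrix.cons_val', Matrix.cons_val_zero, Matrix.cons_val_one,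
    Matrix.cons_val_fin_one, norm_mul, norm_inv] at h1
  rw [← div_eq_mul_inv, div_le_one hpos] at h1
  exact h1.trans_lt hlt

variable {Λ : Type*} {τ : Λ → F} (hrep : ∀ x : F, ‖x‖ ≤ 1 → ∃ l, ‖x - τ l‖ < 1)

include hrep in
/-- Every vertex adjacent to the origin is `alpha` or a child. -/
theorem IsUniformizer.exists_mem_KZ {x κ₁ κ₂ : GL (Fin 2) F} (h₁ : κ₁ ∈ KZ F) (h₂ : κ₂ ∈ KZ F)
    (hx : x = κ₁ * (alpha ϖ)⁻¹ * κ₂) :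
    (alpha ϖ)⁻¹ * x ∈ KZ F ∨ ∃ l, (childMatrix ϖ (τ l))⁻¹ * x ∈ KZ F := by
  have hpos := norm_uniformizer_pos ϖ
  have hlt := hϖ.norm_lt_one
  have hne := ϖ.ne_zero
  obtain ⟨s, hs, h1, hdet⟩ := mem_KZ_iff.mp h₁
  have hs0 : 0 < ‖s‖ := norm_pos_iff.mpr hs
  have e : (κ₁ * (alpha ϖ)⁻¹ : GL (Fin 2) F).1 =
      !![κ₁ 0 0, κ₁ 0 1 * (ϖ : F)⁻¹; κ₁ 1 0, κ₁ 1 1 * (ϖ : F)⁻¹] := by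
    have := coe_alpha_inv_pow ϖ 1
    rw [pow_one, pow_one] at this
    rw [Units.val_mul, this]
    ext i j; fin_cases i <;> fin_cases j <;> simp [Matrix.mul_apply]
  rw [Matrix.det_fin_two] at hdet
  have hsϖ : ‖s * (ϖ : F)⁻¹‖ = ‖s‖ * ‖(ϖ : F)‖⁻¹ := by rw [norm_mul, norm_inv]
  have hi : 1 ≤ ‖(ϖ : F)‖⁻¹ := (one_le_inv₀ hpos).mpr hlt.le
  have hle : ∀ y : F, ‖y‖ ≤ ‖s‖ → ‖y‖ ≤ ‖s‖ * ‖(ϖ : F)‖⁻¹ := fun y hy =>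
    hy.trans (le_mul_of_one_le_right hs0.le hi)
  -- The neighbours of the origin form the projective line over the residue field. The lower right
  -- entry decides between the point at infinity, which is α, and the affine point κ₁ 0 1 / κ₁ 1 1
  -- modulo ϖ, which names the child.
  rcases lt_or_eq_of_le (h1 1 1) with hd | hd
  · left
    rw [hx, ← mul_assoc]
    refine mul_mem (inv_mul_mem_KZ (c := s * (ϖ : F)⁻¹) (B := !![κ₁ 0 0, κ₁ 0 1 * (ϖ : F)⁻¹;
      κ₁ 1 0 * (ϖ : F)⁻¹, κ₁ 1 1 * (ϖ : F)⁻¹ * (ϖ : F)⁻¹]) ?_ ?_ (fun i j => ?_) ?_) h₂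
    · rw [e, coe_alpha]
      ext i j; fin_cases i <;> fin_cases j <;> simp [Matrix.mul_apply] <;> field_simp
    · exact mul_ne_zero hs (inv_ne_zero hne)
    · have h11 : ‖κ₁ 1 1‖ ≤ ‖s‖ * ‖(ϖ : F)‖ := by
        have : ‖κ₁ 1 1 * s⁻¹‖ < 1 := by
          rw [norm_mul, norm_inv, ← div_eq_mul_inv, div_lt_one hs0]; exact hd
        have := hϖ.norm_le this
        rw [norm_mul, norm_inv, ← div_eq_mul_inv, div_le_iff₀ hs0] at this
        linarith
      rw [hsϖ]
      fin_cases i <;> fin_cases j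
      · exact hle _ (h1 0 0)
      · simpa using mul_le_mul_of_nonneg_right (h1 0 1) (inv_nonneg.mpr hpos.le)
      · simpa using mul_le_mul_of_nonneg_right (h1 1 0) (inv_nonneg.mpr hpos.le)
      · simp only [Fin.mk_one, Matrix.of_apply, Matrix.cons_val', Matrix.cons_val_one,
          Matrix.cons_val_fin_one, norm_mul, norm_inv]
        refine mul_le_mul_of_nonneg_right ?_ (inv_nonneg.mpr hpos.le)
        rw [← div_eq_mul_inv, div_le_iff₀ hpos]
        exact h11
    · rw [Matrix.det_fin_two_of, hsϖ, mul_pow, ← hdet, inv_pow, ← norm_pow, ← norm_inv, ← norm_mul]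
      congr 1
      field_simp
  · right
    have hd0 : κ₁ 1 1 ≠ 0 := norm_pos_iff.mp (hd ▸ hs0)
    obtain ⟨l, hl⟩ := hrep (κ₁ 0 1 / κ₁ 1 1) (by
      rw [norm_div, hd, div_le_one hs0]; exact h1 0 1)
    have hl' := hϖ.norm_le hl
    have hτl : ‖τ l‖ ≤ 1 := by
      have h3 : ‖κ₁ 0 1 / κ₁ 1 1‖ ≤ 1 := by
        rw [norm_div, hd, div_le_one hs0]; exact h1 0 1
      have := norm_sub_le_of_le h3 hl.le
      rwa [sub_sub_cancel] at this
    refine ⟨l, ?_⟩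
    rw [hx, ← mul_assoc]
    refine mul_mem (inv_mul_mem_KZ (c := s * (ϖ : F)⁻¹) (B := !![(κ₁ 0 0 - τ l * κ₁ 1 0) * (ϖ : F)⁻¹,
      (κ₁ 0 1 - τ l * κ₁ 1 1) * (ϖ : F)⁻¹ * (ϖ : F)⁻¹; κ₁ 1 0, κ₁ 1 1 * (ϖ : F)⁻¹]) ?_ ?_
      (fun i j => ?_) ?_) h₂
    · rw [e, coe_childMatrix]
      ext i j; fin_cases i <;> fin_cases j <;> simp [Matrix.mul_apply] <;> field_simp <;> ring
    · exact mul_ne_zero hs (inv_ne_zero hne)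
    · have h01 : ‖κ₁ 0 1 - τ l * κ₁ 1 1‖ ≤ ‖s‖ * ‖(ϖ : F)‖ := by
        have : κ₁ 0 1 - τ l * κ₁ 1 1 = κ₁ 1 1 * (κ₁ 0 1 / κ₁ 1 1 - τ l) := by
          field_simp
        rw [this, norm_mul, hd]
        exact mul_le_mul_of_nonneg_left hl' hs0.le
      have h00 : ‖κ₁ 0 0 - τ l * κ₁ 1 0‖ ≤ ‖s‖ := by
        refine norm_sub_le_of_le (h1 0 0) ?_
        rw [norm_mul]
        exact (mul_le_of_le_one_left (norm_nonneg _) hτl).trans (h1 1 0)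
      rw [hsϖ]
      fin_cases i <;> fin_cases j
      · simpa using mul_le_mul_of_nonneg_right h00 (inv_nonneg.mpr hpos.le)
      · simp only [Fin.mk_one, Matrix.of_apply, Matrix.cons_val', Matrix.cons_val_one,
          Matrix.cons_val_fin_one, norm_mul, norm_inv, Fin.zero_eta, Matrix.cons_val_zero]
        refine mul_le_mul_of_nonneg_right ?_ (inv_nonneg.mpr hpos.le)
        rw [← div_eq_mul_inv, div_le_iff₀ hpos]
        exact h01
      · exact hle _ (h1 1 0)
      · simpa using mul_le_mul_of_nonneg_right (h1 1 1) (inv_nonneg.mpr hpos.le)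
    · rw [Matrix.det_fin_two_of, hsϖ, mul_pow, ← hdet, inv_pow, ← norm_pow, ← norm_inv, ← norm_mul]
      congr 1
      field_simp
      ring

include hrep in
-- The word is the ϖ-adic expansion of y to precision m, its head being the digit of highest order.
theorem IsUniformizer.exists_norm_sub_shiftOf_le {y : F} (hy : ‖y‖ ≤ 1) (m : ℕ) :
    ∃ v : List Λ, v.length = m ∧ ‖y - shiftOf ϖ τ v‖ ≤ ‖(ϖ : F)‖ ^ m := by
  induction m with
  | zero => exact ⟨[], rfl, by simpa [shiftOf] using hy⟩
  | succ m ih =>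
    obtain ⟨v, rfl, hv⟩ := ih
    have h0 : 0 < ‖(ϖ : F)‖ ^ v.length := pow_pos (norm_uniformizer_pos ϖ) _
    obtain ⟨l, hl⟩ := hrep ((y - shiftOf ϖ τ v) / (ϖ : F) ^ v.length) (by
      rw [norm_div, norm_pow, div_le_one h0]; exact hv)
    refine ⟨l :: v, rfl, ?_⟩
    have e : y - shiftOf ϖ τ (l :: v) = (ϖ : F) ^ v.length *
        ((y - shiftOf ϖ τ v) / (ϖ : F) ^ v.length - τ l) := by
      rw [shiftOf, mul_sub, mul_div_cancel₀ _ (pow_ne_zero _ ϖ.ne_zero)]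
      ring
    rw [e, norm_mul, norm_pow, pow_succ]
    exact mul_le_mul_of_nonneg_left (hϖ.norm_le hl) h0.le

include hrep in
-- For i in the Iwahori subgroup the entry i 1 1 is a unit, and the coset of i α⁻ᵐ depends only on i
-- 0 1 / i 1 1 modulo ϖ^m.
theorem IsUniformizer.exists_eq_vertex_mul {x : GL (Fin 2) F} {m : ℕ} (hx : x ∈ sphere0 ϖ m) :
    ∃ v : List Λ, v.length = m ∧ ∃ κ ∈ KZ F, x = vertex ϖ τ v * κ := by
  have hpos := norm_uniformizer_pos ϖ
  have hlt := hϖ.norm_lt_one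
  have hne := ϖ.ne_zero
  obtain ⟨i, hi, κ, hκ, rfl⟩ := hx
  obtain ⟨hi1, hi2⟩ := norm_le_one_of_mem_iwahori hi
  obtain ⟨hi3, hdet⟩ := mem_maxCompact_iff.mp hi1
  rw [Matrix.det_fin_two] at hdet
  have hd : ‖i 1 1‖ = 1 := by
    refine le_antisymm (hi3 1 1) (not_lt.mp fun h => ?_)
    have h1 : ‖i 0 0 * i 1 1 - i 0 1 * i 1 0‖ < 1 := by
      rw [sub_eq_add_neg]
      refine (IsUltrametricDist.norm_add_le_max _ _).trans_lt (max_lt ?_ ?_)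
      · rw [norm_mul]
        exact (mul_le_of_le_one_left (norm_nonneg _) (hi3 0 0)).trans_lt h
      · rw [norm_neg, norm_mul]
        exact (mul_le_of_le_one_left (norm_nonneg _) (hi3 0 1)).trans_lt hi2
    exact h1.ne hdet
  have hd0 : i 1 1 ≠ 0 := norm_pos_iff.mp (by rw [hd]; exact one_pos)
  have hq : ‖i 0 1 / i 1 1‖ ≤ 1 := by rw [norm_div, hd, div_one]; exact hi3 0 1
  obtain ⟨v, rfl, hv⟩ := hϖ.exists_norm_sub_shiftOf_le hrep hq m
  have hpm : 0 < ‖(ϖ : F)‖ ^ v.length := pow_pos hpos _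
  have hpm1 : 1 ≤ (‖(ϖ : F)‖ ^ v.length)⁻¹ :=
    (one_le_inv₀ hpm).mpr (pow_le_one₀ hpos.le hlt.le)
  have hne' : (ϖ : F) ^ v.length ≠ 0 := pow_ne_zero _ hne
  refine ⟨v, rfl, (vertex ϖ τ v)⁻¹ * (i * (alpha ϖ)⁻¹ ^ v.length * κ), ?_, by group⟩
  rw [← mul_assoc]
  have e : (i * (alpha ϖ)⁻¹ ^ v.length : GL (Fin 2) F).1 =
      !![i 0 0, i 0 1 * ((ϖ : F) ^ v.length)⁻¹; i 1 0, i 1 1 * ((ϖ : F) ^ v.length)⁻¹] := by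
    rw [Units.val_mul, coe_alpha_inv_pow]
    ext i j; fin_cases i <;> fin_cases j <;> simp [Matrix.mul_apply]
  set x := shiftOf ϖ τ v with hxdef
  have hx1 : ‖x‖ ≤ 1 := by
    have := norm_sub_le_of_le hq (hv.trans (pow_le_one₀ hpos.le hlt.le))
    rwa [sub_sub_cancel] at this
  have hs : ‖((ϖ : F) ^ v.length)⁻¹‖ = (‖(ϖ : F)‖ ^ v.length)⁻¹ := by rw [norm_inv, norm_pow]
  refine mul_mem (inv_mul_mem_KZ (c := ((ϖ : F) ^ v.length)⁻¹)
    (B := !![(i 0 0 - x * i 1 0) * ((ϖ : F) ^ v.length)⁻¹,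
      (i 0 1 - x * i 1 1) * ((ϖ : F) ^ v.length)⁻¹ * ((ϖ : F) ^ v.length)⁻¹;
      i 1 0, i 1 1 * ((ϖ : F) ^ v.length)⁻¹]) ?_ (inv_ne_zero hne') (fun a b => ?_) ?_) hκ
  · rw [e, coe_vertex, ← hxdef]
    ext a b; fin_cases a <;> fin_cases b <;> simp [Matrix.mul_apply] <;> field_simp <;> ring
  · have h01 : ‖i 0 1 - x * i 1 1‖ ≤ ‖(ϖ : F)‖ ^ v.length := by
      have : i 0 1 - x * i 1 1 = i 1 1 * (i 0 1 / i 1 1 - x) := by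
        field_simp
      rw [this, norm_mul, hd, one_mul]
      exact hv
    have h00 : ‖i 0 0 - x * i 1 0‖ ≤ 1 := by
      refine norm_sub_le_of_le (hi3 0 0) ?_
      rw [norm_mul]
      exact mul_le_one₀ hx1 (norm_nonneg _) (hi3 1 0)
    rw [hs]
    fin_cases a <;> fin_cases b
    · simpa using mul_le_mul_of_nonneg_right h00 (inv_nonneg.mpr hpm.le)
    · simp only [Fin.mk_one, Matrix.of_apply, Matrix.cons_val', Matrix.cons_val_one,
        Matrix.cons_val_fin_one, norm_mul, hs, Fin.zero_eta, Matrix.cons_val_zero]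
      refine mul_le_of_le_one_left (inv_nonneg.mpr hpm.le) ?_
      rw [← div_eq_mul_inv, div_le_one hpm]
      exact h01
    · exact (hi3 1 0).trans hpm1
    · simpa using mul_le_mul_of_nonneg_right (hi3 1 1) (inv_nonneg.mpr hpm.le)
  · have e2 : !![(i 0 0 - x * i 1 0) * ((ϖ : F) ^ v.length)⁻¹,
      (i 0 1 - x * i 1 1) * ((ϖ : F) ^ v.length)⁻¹ * ((ϖ : F) ^ v.length)⁻¹;
      i 1 0, i 1 1 * ((ϖ : F) ^ v.length)⁻¹].det = (i 0 0 * i 1 1 - i 0 1 * i 1 0) *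
        ((ϖ : F) ^ v.length)⁻¹ * ((ϖ : F) ^ v.length)⁻¹ := by
      rw [Matrix.det_fin_two_of]; ring
    rw [e2, norm_mul, norm_mul, hdet, one_mul, pow_two]

end Tree

end BreuilSchneider

end

/-! ### Dehomogenization of binary forms -/

noncomputable section

namespace BreuilSchneider

open Polynomial

section Dehomogenization

variable {C : Type*} [Field C]

/-- The dehomogenization `x ↦ 1`, `y ↦ X`. -/
def dehom : MvPolynomial (Fin 2) C →ₐ[C] C[X] := MvPolynomial.aeval ![1, X]

theorem dehom_monomial (m : Fin 2 →₀ ℕ) (c : C) :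
    dehom (MvPolynomial.monomial m c) = Polynomial.C c * X ^ m 1 := by
  rw [dehom, MvPolynomial.aeval_monomial, Finsupp.prod_fintype _ _ fun _ => pow_zero _]
  simp

theorem dehom_eq_sum (P : MvPolynomial (Fin 2) C) :
    dehom P = ∑ m ∈ P.support, Polynomial.C (P.coeff m) * X ^ m 1 := by
  conv_lhs => rw [P.as_sum, map_sum]
  exact Finset.sum_congr rfl fun m _ => dehom_monomial m _

/-- The monomial `x ^ (n - i) * y ^ i`. -/
def xyMonomial (C : Type*) [Field C] (n i : ℕ) : MvPolynomial (Fin 2) C :=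
  MvPolynomial.X 0 ^ (n - i) * MvPolynomial.X 1 ^ i

theorem xyMonomial_mem {n i : ℕ} (hi : i ≤ n) : xyMonomial C n i ∈ Sym C n := by
  rw [MvPolynomial.mem_homogeneousSubmodule]
  have := (MvPolynomial.isHomogeneous_X_pow (R := C) (0 : Fin 2) (n - i)).mul
    (MvPolynomial.isHomogeneous_X_pow (R := C) (1 : Fin 2) i)
  rwa [Nat.sub_add_cancel hi] at this

theorem add_eq_of_mem_support {n : ℕ} {P : MvPolynomial (Fin 2) C} (hP : P ∈ Sym C n)
    {m : Fin 2 →₀ ℕ} (hm : m ∈ P.support) : m 0 + m 1 = n := by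
  rw [MvPolynomial.mem_homogeneousSubmodule] at hP
  have := hP (MvPolynomial.mem_support_iff.mp hm)
  rw [Finsupp.weight_apply, Finsupp.sum_fintype _ _ fun _ => by simp] at this
  simpa using this

theorem monomial_eq_smul_xyMonomial {n : ℕ} {m : Fin 2 →₀ ℕ} (hm : m 0 + m 1 = n) (c : C) :
    MvPolynomial.monomial m c = c • xyMonomial C n (m 1) := by
  rw [MvPolynomial.monomial_eq, Finsupp.prod_fintype _ _ fun _ => pow_zero _, Fin.prod_univ_two,
    xyMonomial, MvPolynomial.smul_eq_C_mul, ← hm, Nat.add_sub_cancel]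

theorem eq_of_mem_sym {M : Type*} [AddCommMonoid M] [Module C M]
    {φ ψ : MvPolynomial (Fin 2) C →ₗ[C] M} {n : ℕ}
    (h : ∀ i ≤ n, φ (xyMonomial C n i) = ψ (xyMonomial C n i)) {P : MvPolynomial (Fin 2) C}
    (hP : P ∈ Sym C n) : φ P = ψ P := by
  rw [P.as_sum, map_sum, map_sum]
  refine Finset.sum_congr rfl fun m hm => ?_
  have hm' := add_eq_of_mem_support hP hm
  rw [monomial_eq_smul_xyMonomial hm', map_smul, map_smul, h _ (by omega)]

theorem natDegree_dehom_le {n : ℕ} {P : MvPolynomial (Fin 2) C} (hP : P ∈ Sym C n) :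
    (dehom P).natDegree ≤ n := by
  rw [dehom_eq_sum]
  refine natDegree_sum_le_of_forall_le _ _ fun m hm => (natDegree_C_mul_X_pow_le _ _).trans ?_
  have := add_eq_of_mem_support hP hm
  omega

theorem dehom_xyMonomial (n i : ℕ) : dehom (xyMonomial C n i) = X ^ i := by
  simp [dehom, xyMonomial]

/-- Homogenization in degree `n`. -/
def hom (n : ℕ) : C[X] →ₗ[C] Sym C n :=
  ∑ i : Fin (n + 1), (lcoeff C i).smulRight
    ⟨xyMonomial C n i, xyMonomial_mem (Nat.lt_succ_iff.mp i.2)⟩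

theorem coe_hom (n : ℕ) (f : C[X]) :
    (hom n f : MvPolynomial (Fin 2) C) = ∑ i ∈ Finset.range (n + 1), f.coeff i • xyMonomial C n i := by
  rw [Finset.sum_range]
  simp [hom]

theorem hom_dehom {n : ℕ} (P : Sym C n) : hom n (dehom (P : MvPolynomial (Fin 2) C)) = P := by
  have h := eq_of_mem_sym (φ := (Sym C n).subtype ∘ₗ hom n ∘ₗ dehom.toLinearMap)
    (ψ := LinearMap.id) (n := n) (fun i hi => ?_) P.2
  · exact Subtype.ext h
  · simp only [LinearMap.comp_apply, AlgHom.toLinearMap_apply, dehom_xyMonomial,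
      Submodule.subtype_apply, LinearMap.id_apply, coe_hom]
    rw [Finset.sum_eq_single_of_mem i (by simpa [Nat.lt_succ_iff] using hi)]
    · simp
    · intro j _ hj
      simp [coeff_X_pow, hj]

/-- The action of a matrix on dehomogenized polynomials of degree at most `n`. -/
def act (n : ℕ) (B : Matrix (Fin 2) (Fin 2) C) : C[X] →ₗ[C] C[X] :=
  ∑ i ∈ Finset.range (n + 1), (lcoeff C i).smulRight
    ((Polynomial.C (B 0 0) + Polynomial.C (B 1 0) * X) ^ (n - i) *
      (Polynomial.C (B 0 1) + Polynomial.C (B 1 1) * X) ^ i)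

theorem act_apply (n : ℕ) (B : Matrix (Fin 2) (Fin 2) C) (f : C[X]) :
    act n B f = ∑ i ∈ Finset.range (n + 1), Polynomial.C (f.coeff i) *
      ((Polynomial.C (B 0 0) + Polynomial.C (B 1 0) * X) ^ (n - i) *
        (Polynomial.C (B 0 1) + Polynomial.C (B 1 1) * X) ^ i) := by
  simp [act, smul_eq_C_mul]

theorem dehom_subst {n : ℕ} (B : Matrix (Fin 2) (Fin 2) C) {P : MvPolynomial (Fin 2) C}
    (hP : P ∈ Sym C n) : dehom (subst B P) = act n B (dehom P) := by
  refine eq_of_mem_sym (φ := dehom.toLinearMap ∘ₗ (subst B).toLinearMap)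
    (ψ := act n B ∘ₗ dehom.toLinearMap) (fun i hi => ?_) hP
  simp only [LinearMap.comp_apply, AlgHom.toLinearMap_apply, dehom_xyMonomial, act_apply]
  rw [Finset.sum_eq_single_of_mem i (by simpa [Nat.lt_succ_iff] using hi)]
  · simp [xyMonomial, subst, dehom]
  · intro j _ hj
    simp [coeff_X_pow, hj]

theorem act_coeff_zero {n : ℕ} (hn : n = 0) (B : Matrix (Fin 2) (Fin 2) C) (f : C[X]) :
    (act n B f).coeff 0 = f.coeff 0 := by
  simp [act_apply, hn]

theorem subst_X (A : Matrix (Fin 2) (Fin 2) C) (j : Fin 2) :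
    subst A (MvPolynomial.X j) =
      MvPolynomial.C (A 0 j) * MvPolynomial.X 0 + MvPolynomial.C (A 1 j) * MvPolynomial.X 1 := by
  simp [subst, Fin.sum_univ_two]

theorem subst_mul (A B : Matrix (Fin 2) (Fin 2) C) (P : MvPolynomial (Fin 2) C) :
    subst (A * B) P = subst A (subst B P) := by
  have h : ∀ c, subst A (MvPolynomial.C c) = MvPolynomial.C c := fun c => by simp [subst]
  have : subst (A * B) = (subst A).comp (subst B) := by
    refine MvPolynomial.algHom_ext fun j => ?_
    rw [AlgHom.comp_apply, subst_X, subst_X, map_add, map_mul, map_mul, h, h, subst_X, subst_X,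
      Matrix.mul_apply, Matrix.mul_apply, Fin.sum_univ_two, Fin.sum_univ_two]
    simp only [map_add, map_mul]
    ring
  rw [this, AlgHom.comp_apply]

theorem symMap_mul (n : ℕ) (A B : Matrix (Fin 2) (Fin 2) C) :
    symMap n (A * B) = symMap n A ∘ₗ symMap n B :=
  LinearMap.ext fun P => Subtype.ext (subst_mul A B P)

theorem symMap_smul (n : ℕ) (z : C) (B : Matrix (Fin 2) (Fin 2) C) :
    symMap n (z • B) = z ^ n • symMap n B := by
  refine LinearMap.ext fun P => Subtype.ext ?_
  refine eq_of_mem_sym (φ := (subst (z • B)).toLinearMap) (ψ := z ^ n • (subst B).toLinearMap)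
    (fun i hi => ?_) P.2
  have h : ∀ j, subst (z • B) (MvPolynomial.X j) = MvPolynomial.C z * subst B (MvPolynomial.X j) :=
    fun j => by
      rw [subst_X, subst_X]; simp; ring
  simp only [AlgHom.toLinearMap_apply, LinearMap.smul_apply, xyMonomial, map_mul, map_pow, h,
    mul_pow, MvPolynomial.smul_eq_C_mul]
  rw [← Nat.sub_add_cancel hi, pow_add, Nat.add_sub_cancel]
  ring

end Dehomogenization

section ActNorm

variable {C : Type*} [NormedField C]

theorem lift_eq_act (n : ℕ) (ω x : C) (f : C[X]) : lift n ω x f = act n !![ω, x; 0, 1] f := by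
  rw [lift, act_apply]
  refine Finset.sum_congr rfl fun i _ => ?_
  simp [add_comm, mul_assoc]

theorem shift_eq_act {n : ℕ} (ω x : C) {f : C[X]} (hf : f.natDegree ≤ n) :
    shift ω x f = act n !![1, -x; 0, ω] f := by
  rw [shift, act_apply]
  conv_lhs => rw [as_sum_range_C_mul_X_pow' f (Nat.lt_succ_of_le hf), Polynomial.sum_comp]
  refine Finset.sum_congr rfl fun i _ => ?_
  simp [sub_eq_neg_add]

variable [IsUltrametricDist C]

theorem Bdd.act {c : ℝ} {f : C[X]} (hf : Bdd c f) (n : ℕ) {B : Matrix (Fin 2) (Fin 2) C}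
    (hB : ∀ i j, ‖B i j‖ ≤ 1) : Bdd c (act n B f) := by
  have hlin : ∀ j, Bdd 1 (Polynomial.C (B 0 j) + Polynomial.C (B 1 j) * X) := fun j =>
    (bdd_C (hB 0 j)).add ((bdd_C (hB 1 j)).mul_one bdd_X)
  rw [act_apply]
  exact Bdd.sum hf.nonneg fun i _ =>
    (bdd_C (hf i)).mul_one (((hlin 0).pow _).mul_one ((hlin 1).pow _))

theorem bdd_dehom {P : MvPolynomial (Fin 2) C} (hP : ∀ m, P.coeff m ∈ ringOfInt C) :
    Bdd 1 (dehom P) := by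
  rw [dehom_eq_sum]
  exact Bdd.sum zero_le_one fun m _ => (bdd_C (hP m)).mul_one (bdd_X.pow _)

theorem coeff_hom_mem {n : ℕ} {f : C[X]} (hf : Bdd 1 f) (m : Fin 2 →₀ ℕ) :
    (hom n f : MvPolynomial (Fin 2) C).coeff m ∈ ringOfInt C := by
  rw [coe_hom, MvPolynomial.coeff_sum]
  refine sum_mem fun i _ => ?_
  rw [MvPolynomial.coeff_smul, smul_eq_mul]
  refine mul_mem (hf i) ?_
  have : xyMonomial C n i = MvPolynomial.monomial
      (Finsupp.single 0 (n - i) + Finsupp.single 1 i) 1 := by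
    rw [xyMonomial, MvPolynomial.X_pow_eq_monomial, MvPolynomial.X_pow_eq_monomial,
      MvPolynomial.monomial_mul, one_mul]
  classical
  rw [this, MvPolynomial.coeff_monomial]
  split_ifs
  exacts [one_mem _, zero_mem _]

end ActNorm

end BreuilSchneider

end

/-! ### Reduction of the tensor product to one embedding, and the action ρ -/

noncomputable section

namespace BreuilSchneider

open Polynomial

section Weight

variable {p : ℕ} [Fact p.Prime]
variable {F : Type*} [NormedField F] [NormedAlgebra ℚ_[p] F]
variable {C : Type*} [NormedField C] [NormedAlgebra ℚ_[p] C]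

/-- The endomorphism of `Wt k` given by a matrix for each embedding. -/
def wtMap (k : (F →ₐ[ℚ_[p]] C) → ℕ) (B : (F →ₐ[ℚ_[p]] C) → Matrix (Fin 2) (Fin 2) C) :
    Wt k →ₗ[C] Wt k :=
  PiTensorProduct.map fun τ => symMap (k τ) (B τ)

theorem wtMap_tprod (k : (F →ₐ[ℚ_[p]] C) → ℕ) (B : (F →ₐ[ℚ_[p]] C) → Matrix (Fin 2) (Fin 2) C)
    (P : ∀ τ, Sym C (k τ)) :
    wtMap k B (PiTensorProduct.tprod C P) =
      PiTensorProduct.tprod C fun τ => symMap (k τ) (B τ) (P τ) :=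
  PiTensorProduct.map_tprod _ _

theorem wtMap_mul (k : (F →ₐ[ℚ_[p]] C) → ℕ)
    (A B : (F →ₐ[ℚ_[p]] C) → Matrix (Fin 2) (Fin 2) C) :
    wtMap k (fun τ => A τ * B τ) = wtMap k A ∘ₗ wtMap k B := by
  rw [wtMap, wtMap, wtMap, ← PiTensorProduct.map_comp]
  simp only [symMap_mul]

variable [Fintype (F →ₐ[ℚ_[p]] C)]

theorem map_smul_univ (k : (F →ₐ[ℚ_[p]] C) → ℕ) (z : (F →ₐ[ℚ_[p]] C) → C)
    (φ : ∀ τ, Sym C (k τ) →ₗ[C] Sym C (k τ)) :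
    (PiTensorProduct.map fun τ => z τ • φ τ) = (∏ τ, z τ) • PiTensorProduct.map φ :=
  (PiTensorProduct.mapMultilinear C (fun τ => Sym C (k τ)) fun τ => Sym C (k τ)).map_smul_univ z φ

/-- The dehomogenization of the product of the factors of a tensor. -/
def ev (k : (F →ₐ[ℚ_[p]] C) → ℕ) : Wt k →ₗ[C] C[X] :=
  PiTensorProduct.lift ((MultilinearMap.mkPiAlgebra C (F →ₐ[ℚ_[p]] C) C[X]).compLinearMap
    fun τ => dehom.toLinearMap ∘ₗ (Sym C (k τ)).subtype)

theorem ev_tprod (k : (F →ₐ[ℚ_[p]] C) → ℕ) (P : ∀ τ, Sym C (k τ)) :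
    ev k (PiTensorProduct.tprod C P) = ∏ τ, dehom (P τ : MvPolynomial (Fin 2) C) := by
  rw [ev, PiTensorProduct.lift.tprod]
  simp

variable {k : (F →ₐ[ℚ_[p]] C) → ℕ} {σ : F →ₐ[ℚ_[p]] C} (hk : ∀ τ, τ ≠ σ → k τ = 0)
include hk

theorem prod_pow_weight (z : (F →ₐ[ℚ_[p]] C) → C) : ∏ τ, z τ ^ k τ = z σ ^ k σ :=
  Fintype.prod_eq_single σ fun τ hτ => by rw [hk τ hτ, pow_zero]

theorem wtMap_smul (z : (F →ₐ[ℚ_[p]] C) → C) (B : (F →ₐ[ℚ_[p]] C) → Matrix (Fin 2) (Fin 2) C) :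
    wtMap k (fun τ => z τ • B τ) = z σ ^ k σ • wtMap k B := by
  rw [wtMap]
  simp only [symMap_smul]
  rw [map_smul_univ, prod_pow_weight hk]
  rfl

theorem ev_tprod_eq [DecidableEq (F →ₐ[ℚ_[p]] C)] (P : ∀ τ, Sym C (k τ)) :
    ev k (PiTensorProduct.tprod C P) =
      Polynomial.C (∏ τ ∈ Finset.univ.erase σ, (dehom (P τ : MvPolynomial (Fin 2) C)).coeff 0) *
        dehom (P σ : MvPolynomial (Fin 2) C) := by
  rw [ev_tprod, ← Finset.mul_prod_erase _ _ (Finset.mem_univ σ), mul_comm, map_prod]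
  congr 1
  refine Finset.prod_congr rfl fun τ hτ => ?_
  have h := natDegree_dehom_le (P τ).2
  exact eq_C_of_natDegree_le_zero (h.trans (hk τ (Finset.ne_of_mem_erase hτ)).le)

theorem ev_wtMap (B : (F →ₐ[ℚ_[p]] C) → Matrix (Fin 2) (Fin 2) C) (t : Wt k) :
    ev k (wtMap k B t) = act (k σ) (B σ) (ev k t) := by
  classical
  induction t using PiTensorProduct.induction_on with
  | smul_tprod r P =>
    rw [map_smul, map_smul, map_smul, map_smul, wtMap_tprod, ev_tprod_eq hk, ev_tprod_eq hk,
      ← smul_eq_C_mul, ← smul_eq_C_mul, map_smul]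
    congr 2
    · refine Finset.prod_congr rfl fun τ hτ => ?_
      have h0 := hk τ (Finset.ne_of_mem_erase hτ)
      have h := dehom_subst (B τ) (P τ).2
      have h1 : ((symMap (k τ) (B τ) (P τ) : Sym C (k τ)) : MvPolynomial (Fin 2) C) =
        subst (B τ) (P τ : MvPolynomial (Fin 2) C) := rfl
      rw [h1, h, act_coeff_zero h0]
    · exact dehom_subst (B σ) (P σ).2
  | add x y hx hy => simp only [map_add, hx, hy]

theorem natDegree_ev_le (t : Wt k) : (ev k t).natDegree ≤ k σ := by
  classical
  induction t using PiTensorProduct.induction_on with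
  | smul_tprod r P =>
    rw [map_smul, ev_tprod_eq hk]
    exact (natDegree_smul_le _ _).trans ((natDegree_C_mul_le _ _).trans (natDegree_dehom_le (P σ).2))
  | add x y hx hy =>
    rw [map_add]
    exact (natDegree_add_le _ _).trans (max_le hx hy)

omit hk in
/-- A section of `ev`. -/
def evSection (k : (F →ₐ[ℚ_[p]] C) → ℕ) (σ : F →ₐ[ℚ_[p]] C) : C[X] →ₗ[C] Wt k :=
  open Classical in
  (PiTensorProduct.tprod C).toLinearMap (fun τ => hom (k τ) 1) σ ∘ₗ hom (k σ)

/-- At the embeddings other than σ the forms are constants and can be moved into the scalar, so `ev`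
forgets nothing. -/
theorem evSection_ev (t : Wt k) : evSection k σ (ev k t) = t := by
  classical
  induction t using PiTensorProduct.induction_on with
  | smul_tprod r P =>
    rw [map_smul, map_smul]
    congr 1
    have h1 : P = fun τ => (if τ = σ then 1 else (dehom (P τ : MvPolynomial (Fin 2) C)).coeff 0) •
        Function.update (fun τ => hom (k τ) 1) σ (P σ) τ := by
      funext τ
      rcases eq_or_ne τ σ with rfl | h
      · simp
      · rw [if_neg h, Function.update_of_ne h, ← map_smul]
        conv_lhs => rw [← hom_dehom (P τ)]
        congr 1
        rw [smul_eq_C_mul, mul_one]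
        exact eq_C_of_natDegree_le_zero ((natDegree_dehom_le (P τ).2).trans (hk τ h).le)
    rw [ev_tprod_eq hk, evSection, LinearMap.comp_apply, ← smul_eq_C_mul, map_smul, map_smul,
      hom_dehom]
    conv_rhs => rw [h1, MultilinearMap.map_smul_univ]
    congr 1
    · rw [← Finset.mul_prod_erase _ _ (Finset.mem_univ σ), if_pos rfl, one_mul]
      exact Finset.prod_congr rfl fun τ hτ => by rw [if_neg (Finset.ne_of_mem_erase hτ)]
  | add x y hx hy => simp only [map_add, hx, hy]

variable [IsUltrametricDist C]

/-- The section sends an integral polynomial to a pure tensor of integral forms, so the lattice is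
exactly the set of integral polynomials. -/
theorem mem_lattice_iff (t : Wt k) : t ∈ lattice k ↔ Bdd 1 (ev k t) := by
  classical
  constructor
  · intro h
    induction h using Submodule.span_induction with
    | mem x hx =>
      obtain ⟨P, hP, rfl⟩ := hx
      rw [ev_tprod]
      exact Bdd.prod fun τ _ => bdd_dehom (hP τ)
    | zero => rw [map_zero]; exact bdd_zero zero_le_one
    | add x y _ _ hx hy => rw [map_add]; exact hx.add hy
    | smul r x _ hx =>
      have : r • x = (r : C) • x := rfl
      rw [this, map_smul, smul_eq_C_mul]
      exact (bdd_C r.2).mul_one hx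
  · intro h
    rw [← evSection_ev hk t]
    refine Submodule.subset_span ⟨_, fun τ m => ?_, rfl⟩
    rcases eq_or_ne τ σ with rfl | hτ
    · rw [Function.update_self]
      exact coeff_hom_mem h m
    · rw [Function.update_of_ne hτ]
      exact coeff_hom_mem bdd_one m

end Weight

section Rho

variable {p : ℕ} [Fact p.Prime]
variable {F : Type*} [NormedField F] [NormedAlgebra ℚ_[p] F]
variable {C : Type*} [NormedField C] [NormedAlgebra ℚ_[p] C]
variable [Fintype (F →ₐ[ℚ_[p]] C)]
variable {k : (F →ₐ[ℚ_[p]] C) → ℕ} {σ : F →ₐ[ℚ_[p]] C} (hk : ∀ τ, τ ≠ σ → k τ = 0)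
variable {ϖ : Fˣ} {sq : (F →ₐ[ℚ_[p]] C) → C}
include hk

theorem rho_eq (g : GL (Fin 2) F) :
    rho ϖ sq k g = (sq σ ^ (-ordF ϖ (g : Matrix (Fin 2) (Fin 2) F).det * (k σ : ℤ))) •
      wtMap k fun τ => (g : Matrix (Fin 2) (Fin 2) F).map τ := by
  rw [rho, map_smul_univ, wtMap]
  congr 1
  refine Fintype.prod_eq_single σ fun τ hτ => ?_
  rw [hk τ hτ]
  simp

variable [IsUltrametricDist F] (hϖ : IsUniformizer ϖ) (hsq : ∀ τ, sq τ ^ 2 = τ ϖ)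
include hsq

omit hk [IsUltrametricDist F] [Fintype (F →ₐ[ℚ_[p]] C)] in
theorem sq_ne_zero (τ : F →ₐ[ℚ_[p]] C) : sq τ ≠ 0 := by
  intro h
  have := hsq τ
  rw [h, zero_pow two_ne_zero] at this
  exact ϖ.ne_zero ((map_eq_zero τ).mp this.symm)

include hϖ in
theorem rho_mul (g h : GL (Fin 2) F) : rho ϖ sq k (g * h) = rho ϖ sq k g ∘ₗ rho ϖ sq k h := by
  have hdet : ∀ x : GL (Fin 2) F, (x : Matrix (Fin 2) (Fin 2) F).det ≠ 0 := fun x =>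
    ((Matrix.isUnit_iff_isUnit_det _).mp x.isUnit).ne_zero
  rw [rho_eq hk, rho_eq hk, rho_eq hk, LinearMap.comp_smul, LinearMap.smul_comp, smul_smul,
    ← wtMap_mul, Matrix.GeneralLinearGroup.coe_mul, Matrix.det_mul, hϖ.ordF_mul (hdet g) (hdet h),
    neg_add, add_mul, zpow_add₀ (sq_ne_zero hsq σ), mul_comm]
  congr 2
  funext τ
  exact Matrix.map_mul (f := (τ : F →+* C))

omit hk [IsUltrametricDist F] [Fintype (F →ₐ[ℚ_[p]] C)] in
theorem norm_sq_sq [FiniteDimensional ℚ_[p] F] (τ : F →ₐ[ℚ_[p]] C) :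
    ‖sq τ‖ ^ 2 = ‖(ϖ : F)‖ := by
  rw [← norm_pow, hsq, norm_algHom]

include hϖ in
-- Write κ as c times an integral matrix: c contributes |c|^k, and the power of the square root of
-- σ(ϖ) in ρ has norm |c|^(-k).
theorem rho_mem_lattice [FiniteDimensional ℚ_[p] F] [IsUltrametricDist C] {κ : GL (Fin 2) F}
    (hκ : κ ∈ KZ F) {t : Wt k} (ht : t ∈ lattice k) : rho ϖ sq k κ t ∈ lattice k := by
  obtain ⟨c, hc, h, hdet⟩ := mem_KZ_iff.mp hκ
  have hc0 : 0 < ‖c‖ := norm_pos_iff.mpr hc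
  have hdet0 : (κ : Matrix (Fin 2) (Fin 2) F).det ≠ 0 :=
    norm_pos_iff.mp (hdet ▸ pow_pos hc0 2)
  rw [mem_lattice_iff hk] at ht ⊢
  have e : (fun τ : F →ₐ[ℚ_[p]] C => (κ : Matrix (Fin 2) (Fin 2) F).map τ) =
      fun τ : F →ₐ[ℚ_[p]] C => τ c • ((c⁻¹ • (κ : Matrix (Fin 2) (Fin 2) F)).map τ) := by
    funext τ
    ext i j
    simp [mul_inv_cancel_left₀ ((map_ne_zero τ).mpr hc)]
  rw [rho_eq hk, e, wtMap_smul hk (fun τ => τ c), smul_smul, LinearMap.smul_apply, map_smul,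
    ev_wtMap hk, smul_eq_C_mul]
  refine (bdd_C (le_of_eq ?_)).mul_one (ht.act _ fun i j => ?_)
  · have h1 : ‖sq σ ^ (-ordF ϖ (κ : Matrix (Fin 2) (Fin 2) F).det)‖ = ‖c‖⁻¹ := by
      rw [← pow_left_inj₀ (norm_nonneg _) (inv_nonneg.mpr hc0.le) two_ne_zero, norm_zpow,
        ← zpow_natCast, ← zpow_mul, mul_comm, zpow_mul, zpow_natCast, norm_sq_sq hsq, zpow_neg,
        ← hϖ.norm_eq_zpow_ordF hdet0, hdet, inv_pow]
    rw [zpow_mul, zpow_natCast, ← mul_pow, norm_pow, norm_mul, h1, norm_algHom,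
      inv_mul_cancel₀ hc0.ne', one_pow]
  · rw [Matrix.map_apply, norm_algHom, Matrix.smul_apply, smul_eq_mul, norm_mul, norm_inv,
      inv_mul_eq_div, div_le_one hc0]
    exact h i j

include hϖ in
-- The matrix diag(ϖ, 1) defining U is ϖ α⁻¹, so U and ρ(α⁻¹) differ by a scalar.
theorem heckeU_eq : heckeU ϖ k = sq σ ^ k σ • rho ϖ sq k (alpha ϖ)⁻¹ := by
  have hval := coe_alpha_inv_pow ϖ 1
  rw [pow_one, pow_one] at hval
  have hord : ordF ϖ ((alpha ϖ)⁻¹ : GL (Fin 2) F).1.det = -1 := by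
    refine hϖ.ordF_eq ?_
    rw [hval, Matrix.det_fin_two_of]
    simp
  have e : (fun τ : F →ₐ[ℚ_[p]] C => !![τ ϖ, 0; 0, 1]) =
      fun τ : F →ₐ[ℚ_[p]] C => τ (ϖ : F) • (((alpha ϖ)⁻¹ : GL (Fin 2) F).1.map τ) := by
    funext τ
    rw [hval]
    have := (map_ne_zero τ).mpr ϖ.ne_zero
    ext i j
    fin_cases i <;> fin_cases j <;> simp [this]
  have h1 : heckeU ϖ k = wtMap k (fun τ : F →ₐ[ℚ_[p]] C => !![τ ϖ, 0; 0, 1]) := rfl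
  rw [h1, e, wtMap_smul hk (fun τ => τ (ϖ : F)), rho_eq hk, hord, smul_smul, neg_neg, one_mul,
    zpow_natCast, ← mul_pow, ← pow_two, hsq]

include hϖ in
-- As U is a multiple of ρ(α⁻¹), ψ is the same multiple of ρ on its support; in particular the
-- chosen decomposition is irrelevant.
theorem heckePsi_eq {g κ₁ κ₂ : GL (Fin 2) F} (h₁ : κ₁ ∈ KZ F) (h₂ : κ₂ ∈ KZ F)
    (hg : g = κ₁ * (alpha ϖ)⁻¹ * κ₂) : heckePsi ϖ sq k g = sq σ ^ k σ • rho ϖ sq k g := by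
  have h : ∃ κ : KZ F × KZ F, g = κ.1 * (alpha ϖ)⁻¹ * κ.2 := ⟨(⟨κ₁, h₁⟩, ⟨κ₂, h₂⟩), hg⟩
  rw [heckePsi, dif_pos h, heckeU_eq hk hϖ hsq, LinearMap.smul_comp, LinearMap.comp_smul,
    ← LinearMap.comp_assoc, ← rho_mul hk hϖ hsq, ← rho_mul hk hϖ hsq, ← h.choose_spec]

include hϖ in
theorem ev_rho_childMatrix (x : F) (t : Wt k) :
    ev k (sq σ ^ k σ • rho ϖ sq k (childMatrix ϖ x) t) = lift (k σ) (σ ϖ) (σ x) (ev k t) := by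
  have hord : ordF ϖ (childMatrix ϖ x : Matrix (Fin 2) (Fin 2) F).det = 1 := by
    refine hϖ.ordF_eq ?_
    rw [coe_childMatrix, Matrix.det_fin_two_of]
    simp
  rw [rho_eq hk, hord, LinearMap.smul_apply, smul_smul, neg_one_mul, zpow_neg, zpow_natCast,
    mul_inv_cancel₀ (pow_ne_zero _ (sq_ne_zero hsq σ)), one_smul, ev_wtMap hk, lift_eq_act]
  congr 1
  congr 1
  rw [coe_childMatrix]
  ext i j
  fin_cases i <;> fin_cases j <;> simp

include hϖ in
theorem ev_rho_childMatrix_inv (x : F) (t : Wt k) :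
    ev k (sq σ ^ k σ • rho ϖ sq k (childMatrix ϖ x)⁻¹ t) = shift (σ ϖ) (σ x) (ev k t) := by
  have hord : ordF ϖ ((childMatrix ϖ x)⁻¹ : GL (Fin 2) F).1.det = -1 := by
    refine hϖ.ordF_eq ?_
    rw [coe_childMatrix_inv, Matrix.det_fin_two_of]
    simp
  rw [rho_eq hk, hord, LinearMap.smul_apply, smul_smul, neg_neg, one_mul, zpow_natCast, ← mul_pow,
    ← pow_two, hsq, ← LinearMap.smul_apply, ← wtMap_smul hk (fun τ => τ (ϖ : F)), ev_wtMap hk,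
    shift_eq_act _ _ (natDegree_ev_le hk t)]
  congr 1
  congr 1
  rw [coe_childMatrix_inv]
  have := (map_ne_zero σ).mpr ϖ.ne_zero
  ext i j
  fin_cases i <;> fin_cases j <;> simp [this, mul_left_comm _ (σ x)]

end Rho

end BreuilSchneider

end

/-! ### The Hecke operator on the tree of words -/

noncomputable section

namespace BreuilSchneider

open Polynomial IsLocalRing

section Hecke

variable {p : ℕ} [Fact p.Prime]
variable {F : Type*} [NormedField F] [NormedAlgebra ℚ_[p] F] [IsUltrametricDist F]
variable {C : Type*} [NormedField C] [NormedAlgebra ℚ_[p] C]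
variable {k : (F →ₐ[ℚ_[p]] C) → ℕ}
variable {ϖ : Fˣ} {sq : (F →ₐ[ℚ_[p]] C) → C}

theorem indicator_mem_cInd {f : GL (Fin 2) F → Wt k} (hf : f ∈ cInd ϖ sq k) {X : Set (GL (Fin 2) F)}
    [DecidablePred (· ∈ X)] (hX : ∀ g, ∀ κ ∈ KZ F, g ∈ X → g * κ ∈ X) (z : C) :
    (fun g => if g⁻¹ ∈ X then z • f g else 0) ∈ cInd ϖ sq k := by
  obtain ⟨h1, s, hs, h2⟩ := hf
  refine ⟨fun κ hκ g => ?_, s, hs, fun g hg => h2 g fun h => hg ?_⟩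
  · have hiff : (κ * g)⁻¹ ∈ X ↔ g⁻¹ ∈ X := by
      rw [mul_inv_rev]
      refine ⟨fun h => ?_, hX _ _ (inv_mem hκ)⟩
      have := hX _ _ hκ h
      rwa [inv_mul_cancel_right] at this
    by_cases h : g⁻¹ ∈ X
    · simp only [if_pos h, if_pos (hiff.mpr h), h1 κ hκ, map_smul]
    · simp only [if_neg h, if_neg (mt hiff.mp h), map_zero]
  · simp only [h, smul_zero, ite_self]

variable [Fintype (F →ₐ[ℚ_[p]] C)] {σ : F →ₐ[ℚ_[p]] C} (hk : ∀ τ, τ ≠ σ → k τ = 0)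
variable (hϖ : IsUniformizer ϖ) (hsq : ∀ τ, sq τ ^ 2 = τ ϖ)
include hk hϖ hsq

/-- Equivariance of f makes the summand independent of the representative, so the arbitrary `out`
can be replaced by a convenient y. -/
theorem heckePsi_out {f : GL (Fin 2) F → Wt k}
    (hf : ∀ κ ∈ KZ F, ∀ g, f (κ * g) = rho ϖ sq k κ (f g)) {y : GL (Fin 2) F}
    (hy : ∃ κ₁ ∈ KZ F, ∃ κ₂ ∈ KZ F, y = κ₁ * (alpha ϖ)⁻¹ * κ₂) (g : GL (Fin 2) F) :
    heckePsi ϖ sq k (y : GL (Fin 2) F ⧸ KZ F).out (f ((y : GL (Fin 2) F ⧸ KZ F).out⁻¹ * g)) =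
      sq σ ^ k σ • rho ϖ sq k y (f (y⁻¹ * g)) := by
  obtain ⟨κ₁, h₁, κ₂, h₂, rfl⟩ := hy
  set y := κ₁ * (alpha ϖ)⁻¹ * κ₂ with hy
  obtain ⟨κ, hκ⟩ := QuotientGroup.mk_out_eq_mul (KZ F) y
  rw [hκ, heckePsi_eq hk hϖ hsq h₁ (mul_mem h₂ κ.2) (by rw [hy]; group), LinearMap.smul_apply,
    rho_mul hk hϖ hsq, LinearMap.comp_apply, ← hf κ κ.2]
  congr 3
  group

/-- The sum runs over the q + 1 neighbours of a vertex: the coset of α leads to the parent u, and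
the cosets of the `childMatrix` to the children. -/
theorem heckeT_vertex {Λ : Type*} [Fintype Λ] {τ : Λ → F} (hτ : ∀ l, ‖τ l‖ ≤ 1)
    (hsub : ∀ l m, ‖τ l - τ m‖ < 1 → l = m) (hrep : ∀ x : F, ‖x‖ ≤ 1 → ∃ l, ‖x - τ l‖ < 1)
    {f : GL (Fin 2) F → Wt k} (hf : ∀ κ ∈ KZ F, ∀ g, f (κ * g) = rho ϖ sq k κ (f g))
    (m : Λ) (u : List Λ) :
    heckeT ϖ sq k f (vertex ϖ τ (m :: u))⁻¹ =
      sq σ ^ k σ • rho ϖ sq k (childMatrix ϖ (τ m))⁻¹ (f (vertex ϖ τ u)⁻¹) +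
      ∑ l, sq σ ^ k σ • rho ϖ sq k (childMatrix ϖ (τ l)) (f (vertex ϖ τ (l :: m :: u))⁻¹) := by
  set g := (vertex ϖ τ (m :: u))⁻¹ with hg
  let e : Option Λ → GL (Fin 2) F ⧸ KZ F := fun o => o.elim (alpha ϖ) fun l => childMatrix ϖ (τ l)
  have he : Function.Injective e := by
    have h1 : ∀ l, ((alpha ϖ : GL (Fin 2) F) : GL (Fin 2) F ⧸ KZ F) ≠ childMatrix ϖ (τ l) :=
      fun l h => hϖ.alpha_inv_mul_childMatrix_notMem (τ l) (QuotientGroup.eq.mp h)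
    rintro (_ | l) (_ | m) h
    · rfl
    · exact absurd h (h1 m)
    · exact absurd h.symm (h1 l)
    · exact congrArg some
        (hsub m l (hϖ.norm_sub_lt_one_of_inv_mul_mem (QuotientGroup.eq.mp h))).symm
  set φ : GL (Fin 2) F ⧸ KZ F → Wt k := fun x => heckePsi ϖ sq k x.out (f (x.out⁻¹ * g)) with hφ
  have hsupp : ∀ x, φ x ≠ 0 → x ∈ Set.range e := by
    intro x hx
    by_cases h : ∃ κ : KZ F × KZ F, x.out = κ.1 * (alpha ϖ)⁻¹ * κ.2
    · obtain ⟨⟨κ₁, κ₂⟩, hκ⟩ := h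
      rw [← QuotientGroup.out_eq' x]
      rcases hϖ.exists_mem_KZ hrep κ₁.2 κ₂.2 hκ with h | ⟨l, h⟩
      · exact ⟨none, QuotientGroup.eq.mpr h⟩
      · exact ⟨some l, QuotientGroup.eq.mpr h⟩
    · refine absurd ?_ hx
      simp only [hφ, heckePsi, dif_neg h, LinearMap.zero_apply]
  have hsum : heckeT ϖ sq k f g = φ (alpha ϖ : GL (Fin 2) F) + ∑ l, φ (childMatrix ϖ (τ l)) := by
    calc heckeT ϖ sq k f g = ∑ᶠ x ∈ (Set.univ : Set (GL (Fin 2) F ⧸ KZ F)), φ x := by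
          rw [finsum_mem_univ]; rfl
      _ = ∑ᶠ x ∈ Set.range e, φ x :=
          finsum_mem_inter_support_eq' _ _ _ fun x hx => ⟨fun _ => hsupp x hx, fun _ => Set.mem_univ x⟩
      _ = ∑ᶠ o, φ (e o) := finsum_mem_range he
      _ = _ := by rw [finsum_eq_sum_of_fintype, Fintype.sum_option]; rfl
  rw [hsum]
  congr 1
  · have h1 := heckePsi_out hk hϖ hsq hf exists_eq_alpha_mul g
    -- Going up undoes the last edge: `childMatrix ϖ (τ m) * alpha ϖ` lies in KZ, so equivariance
    -- moves the value to the vertex u.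
    have h2 : (alpha ϖ)⁻¹ * g = (childMatrix ϖ (τ m) * alpha ϖ)⁻¹ * (vertex ϖ τ u)⁻¹ := by
      rw [hg, vertex]; group
    rw [h2, hf _ (inv_mem (childMatrix_mul_alpha_mem (hτ m))), ← LinearMap.comp_apply,
      ← rho_mul hk hϖ hsq, mul_inv_rev, mul_inv_cancel_left] at h1
    exact h1
  · refine Finset.sum_congr rfl fun l _ => ?_
    have h1 := heckePsi_out hk hϖ hsq hf (exists_eq_childMatrix_mul (hτ l)) g
    rw [hg, ← mul_inv_rev] at h1
    exact h1

/-- Division by z makes the error h integral, and b vanishes at m :: u, which has length greater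
than N; what remains is the equation of `IsSol`. -/
theorem isSol_of_heckeT [FiniteDimensional ℚ_[p] F] [IsUltrametricDist C] {Λ : Type*} [Fintype Λ]
    (S : TreeData C Λ) {τ : Λ → F} (hSϖ : S.ϖ = σ ϖ) (hSτ : ∀ l, S.τ l = σ (τ l))
    (hτ : ∀ l, ‖τ l‖ ≤ 1)
    (hsub : ∀ l m, ‖τ l - τ m‖ < 1 → l = m) (hrep : ∀ x : F, ‖x‖ ≤ 1 → ∃ l, ‖x - τ l‖ < 1)
    {f b h : GL (Fin 2) F → Wt k} (hf : f ∈ cInd ϖ sq k) {N : ℕ}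
    (hb : b ∈ supportedOn ϖ sq k (ball ϖ N)) {z a : C} (hz : z ≠ 0)
    (hh : h ∈ scaledLattice ϖ sq k z) (heq : heckeT ϖ sq k f - a • f = b + h) :
    S.IsSol N (k σ) a fun v => Polynomial.C z⁻¹ * ev k (f (vertex ϖ τ v)⁻¹) where
  natDegree_le v := (natDegree_C_mul_le _ _).trans (natDegree_ev_le hk _)
  finite := by
    obtain ⟨-, s, hs, h2⟩ := hf
    choose M hM using fun x => hϖ.exists_length_lt τ x
    refine ⟨∑ x ∈ hs.toFinset, M x, fun v hv => ?_⟩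
    by_contra hne
    obtain ⟨κ, hκ, x, hx, h⟩ := h2 (vertex ϖ τ v)⁻¹ fun h => hne (by rw [h, map_zero, mul_zero])
    have h3 := hM x v κ hκ h
    have h4 := Finset.single_le_sum (f := M) (fun _ _ => Nat.zero_le _) (hs.mem_toFinset.mpr hx)
    omega
  eqn := by
    intro m u hu
    obtain ⟨h', -, hlat, rfl⟩ := hh
    have h1 := congrFun heq (vertex ϖ τ (m :: u))⁻¹
    have hb0 : b (vertex ϖ τ (m :: u))⁻¹ = 0 := by
      by_contra hne
      have := hb.2 _ hne
      rw [inv_inv] at this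
      exact hϖ.vertex_notMem_ball τ (by simp; omega) this
    rw [Pi.add_apply, hb0, zero_add, Pi.sub_apply, Pi.smul_apply, Pi.smul_apply,
      heckeT_vertex hk hϖ hsq hτ hsub hrep hf.1] at h1
    have h2 := congrArg (ev k) h1
    rw [map_sub, map_add, map_sum, ev_rho_childMatrix_inv hk hϖ hsq, map_smul, map_smul] at h2
    simp only [ev_rho_childMatrix hk hϖ hsq] at h2
    have h3 := (mem_lattice_iff hk _).mp (hlat (vertex ϖ τ (m :: u))⁻¹)
    convert h3 using 1
    have h4 := congrArg (fun g => Polynomial.C z⁻¹ * g) h2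
    simp only [smul_eq_C_mul, ← mul_assoc, ← C_mul, inv_mul_cancel₀ hz, map_one, one_mul] at h4
    rw [← h4, TreeData.low, shift_C_mul, hSϖ, hSτ, mul_sub, mul_add, Finset.mul_sum]
    simp only [lift_C_mul, hSτ]
    rw [mul_left_comm]

end Hecke

end BreuilSchneider

end

/-! ### Valuations, and from bounded solutions to separatedness -/

noncomputable section

namespace BreuilSchneider

open Polynomial IsLocalRing

section Valuation

variable {F : Type*} [NormedField F] [IsUltrametricDist F] {ϖ : Fˣ} (hϖ : IsUniformizer ϖ)
variable {C : Type*} [NormedField C]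
include hϖ

theorem IsUniformizer.exists_vF_eq {a : C} (ha : a ≠ 0) :
    ∃ x : ℝ, vF ϖ a = x ∧ ‖a‖ = ‖(ϖ : F)‖ ^ x := by
  have hlog : Real.log ‖(ϖ : F)‖ ≠ 0 :=
    (Real.log_neg (norm_uniformizer_pos ϖ) hϖ.norm_lt_one).ne
  refine ⟨_, by rw [vF, if_neg ha], ?_⟩
  rw [Real.rpow_def_of_pos (norm_uniformizer_pos ϖ), mul_div_cancel₀ _ hlog,
    Real.exp_log (norm_pos_iff.mpr ha)]

theorem IsUniformizer.norm_le_rpow_iff {x y : ℝ} :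
    ‖(ϖ : F)‖ ^ x ≤ ‖(ϖ : F)‖ ^ y ↔ y ≤ x :=
  Real.rpow_le_rpow_left_iff_of_base_lt_one (norm_uniformizer_pos ϖ) hϖ.norm_lt_one

theorem IsUniformizer.norm_le_of_le_vF {a : C} {d : ℕ} (h : ((d : ℝ) : EReal) ≤ vF ϖ a) :
    ‖a‖ ≤ ‖(ϖ : F)‖ ^ d := by
  rcases eq_or_ne a 0 with rfl | ha
  · rw [norm_zero]; positivity
  · obtain ⟨x, hx, hax⟩ := hϖ.exists_vF_eq ha
    rw [hx, EReal.coe_le_coe_iff] at h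
    rw [hax, ← Real.rpow_natCast, hϖ.norm_le_rpow_iff]
    exact h

theorem IsUniformizer.le_norm_of_vF_le {a : C} {d : ℕ} (h : vF ϖ a ≤ ((d : ℝ) : EReal)) :
    ‖(ϖ : F)‖ ^ d ≤ ‖a‖ := by
  rcases eq_or_ne a 0 with rfl | ha
  · rw [vF, if_pos rfl, top_le_iff] at h
    exact absurd h (EReal.coe_ne_top _)
  · obtain ⟨x, hx, hax⟩ := hϖ.exists_vF_eq ha
    rw [hx, EReal.coe_le_coe_iff] at h
    rw [hax, ← Real.rpow_natCast, hϖ.norm_le_rpow_iff]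
    exact h

theorem IsUniformizer.pow_succ_le_of_two_mul_vF_le {a : C} (ha : a ≠ 0) {r : ℕ}
    (h : 2 * vF ϖ a - 1 ≤ ((r : ℝ) : EReal)) : ‖(ϖ : F)‖ ^ (r + 1) ≤ ‖a‖ * ‖a‖ := by
  obtain ⟨x, hx, hax⟩ := hϖ.exists_vF_eq ha
  have h1 : 2 * x - 1 ≤ r := by
    have e : ((2 * x - 1 : ℝ) : EReal) = 2 * (x : EReal) - 1 := by
      rw [EReal.coe_sub, EReal.coe_mul]; rfl
    rwa [hx, ← e, EReal.coe_le_coe_iff] at h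
  rw [hax, ← Real.rpow_add (norm_uniformizer_pos ϖ), ← Real.rpow_natCast, hϖ.norm_le_rpow_iff]
  push_cast
  linarith

end Valuation

section RamIndex

variable (p : ℕ) [Fact p.Prime]
variable {F : Type*} [NormedField F] [NormedAlgebra ℚ_[p] F] [IsUltrametricDist F] {ϖ : Fˣ}

theorem IsUniformizer.norm_prime_le (hϖ : IsUniformizer ϖ) :
    ‖(p : F)‖ ≤ ‖(ϖ : F)‖ ^ ramIndex p F := by
  have key : ∀ n, (p : ringOfInt F) ∈ maximalIdeal (ringOfInt F) ^ n →
      ‖(p : F)‖ ≤ ‖(ϖ : F)‖ ^ n := by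
    intro n hn
    obtain ⟨h, he⟩ := hϖ
    rw [he, Ideal.span_singleton_pow, Ideal.mem_span_singleton] at hn
    exact norm_le_pow_of_pow_dvd h hn
  have h0 : (p : ringOfInt F) ∈ maximalIdeal (ringOfInt F) ^ 0 := by
    rw [pow_zero, Ideal.one_eq_top]; trivial
  refine key _ (Nat.sSup_mem (s := {n | (p : ringOfInt F) ∈ maximalIdeal (ringOfInt F) ^ n})
    ⟨0, h0⟩ ?_)
  -- The exponents must be bounded for the supremum to be attained; `sSup` of an unbounded set of
  -- naturals would be 0.
  obtain ⟨M, hM⟩ := exists_pow_lt_of_lt_one (norm_prime_pos p (F := F)) hϖ.norm_lt_one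
  refine ⟨M, fun n hn => ?_⟩
  have h1 := hM.trans_le (key n hn)
  exact ((pow_lt_pow_iff_right_of_lt_one₀ (norm_uniformizer_pos ϖ) hϖ.norm_lt_one).mp h1).le

end RamIndex

section Separated

variable {p : ℕ} [Fact p.Prime]
variable {F : Type*} [NormedField F] [NormedAlgebra ℚ_[p] F] [IsUltrametricDist F]
  [FiniteDimensional ℚ_[p] F]
variable {C : Type*} [NormedField C] [NormedAlgebra ℚ_[p] C] [IsUltrametricDist C]
variable {k : (F →ₐ[ℚ_[p]] C) → ℕ}
variable {ϖ : Fˣ} {sq : (F →ₐ[ℚ_[p]] C) → C}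
variable [Fintype (F →ₐ[ℚ_[p]] C)] {σ : F →ₐ[ℚ_[p]] C} (hk : ∀ τ, τ ≠ σ → k τ = 0)
variable (hϖ : IsUniformizer ϖ) (hsq : ∀ τ, sq τ ^ 2 = τ ϖ)
include hk hϖ hsq

/-- A function supported on the half tree whose values far from the origin are divisible by `z` is
the sum of a function supported on a ball and of a multiple of `z`. -/
theorem exists_eq_add_of_vertex {Λ : Type*} {τ : Λ → F}
    (hrep : ∀ x : F, ‖x‖ ≤ 1 → ∃ l, ‖x - τ l‖ < 1) {f : GL (Fin 2) F → Wt k}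
    (hf : f ∈ supportedOn ϖ sq k (half0 ϖ)) {z : C} (hz : z ≠ 0) {N : ℕ}
    (h : ∀ v : List Λ, N < v.length → z⁻¹ • f (vertex ϖ τ v)⁻¹ ∈ lattice k) :
    ∃ b ∈ supportedOn ϖ sq k (ball ϖ N), ∃ h ∈ scaledLattice ϖ sq k z, f = b + h := by
  classical
  have hX : ∀ g, ∀ κ ∈ KZ F, g ∈ ball ϖ N → g * κ ∈ ball ϖ N := fun g κ hκ hg => mul_mem_ball hg hκ
  have hXc : ∀ g, ∀ κ ∈ KZ F, g ∈ (ball ϖ N)ᶜ → g * κ ∈ (ball ϖ N)ᶜ := fun g κ hκ hg hgκ => by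
    have := mul_mem_ball hgκ (inv_mem hκ)
    rw [mul_inv_cancel_right] at this
    exact hg this
  -- f is cut into its restrictions to the ball and to the complement, both stable under KZ. Off the
  -- ball each point of the support is equivalent to a word of length above N, and ρ preserves the
  -- lattice.
  refine ⟨_, ⟨indicator_mem_cInd hf.1 hX 1, fun g hg => ?_⟩, z • _,
    ⟨_, indicator_mem_cInd hf.1 hXc z⁻¹, fun g => ?_, rfl⟩, ?_⟩
  · by_contra hne
    exact hg (if_neg hne)
  · by_cases hg : g⁻¹ ∈ (ball ϖ N)ᶜ
    · simp only [if_pos hg]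
      by_cases h0 : f g = 0
      · rw [h0, smul_zero]; exact zero_mem _
      obtain ⟨m, hm⟩ := hf.2 g h0
      have hNm : N < m := by
        by_contra! hle
        exact hg (Or.inl ⟨m, hle, hm⟩)
      obtain ⟨v, rfl, κ, hκ, he⟩ := hϖ.exists_eq_vertex_mul hrep hm
      have hge : g = κ⁻¹ * (vertex ϖ τ v)⁻¹ := by rw [← mul_inv_rev, ← he, inv_inv]
      rw [hge, hf.1.1 _ (inv_mem hκ), ← map_smul]
      exact rho_mem_lattice hk hϖ hsq (inv_mem hκ) (h v hNm)
    · simp only [if_neg hg]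
      exact zero_mem _
  · funext g
    by_cases hg : g⁻¹ ∈ ball ϖ N
    · simp [hg]
    · simp [hg, smul_smul, hz]

theorem isSeparated_of_exists_bdd {Λ : Type*} [Fintype Λ] (S : TreeData C Λ) {τ : Λ → F}
    (hSϖ : S.ϖ = σ ϖ) (hSτ : ∀ l, S.τ l = σ (τ l)) (hτ : ∀ l, ‖τ l‖ ≤ 1)
    (hsub : ∀ l m, ‖τ l - τ m‖ < 1 → l = m) (hrep : ∀ x : F, ‖x‖ ≤ 1 → ∃ l, ‖x - τ l‖ < 1)
    (ι : F →ₐ[ℚ_[p]] C) {a : C}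
    (hbdd : ∃ c, ∀ N f, S.IsSol N (k σ) a f → ∀ v, N ≤ v.length → Bdd c (f v)) :
    IsSeparated ϖ sq ι k a := by
  obtain ⟨c, hc⟩ := hbdd
  have hpos := norm_uniformizer_pos ϖ
  -- ϖ^ε absorbs the uniform bound c. It depends neither on n nor on N, so every N ≥ 1 will do:
  -- words outside the ball of radius N - 1 have length at least N, where the bound holds.
  obtain ⟨ε, hε⟩ := exists_pow_lt_of_lt_one (show 0 < (max c 1)⁻¹ by positivity) hϖ.norm_lt_one
  refine ⟨1, fun N hN _ => ⟨ε, fun n f hf hb => ?_⟩⟩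
  obtain ⟨b, hb, h, hh, heq⟩ := hb
  have hι : ι (ϖ : F) ≠ 0 := (map_ne_zero ι).mpr ϖ.ne_zero
  have hsol := hc N _ (isSol_of_heckeT hk hϖ hsq S hSϖ hSτ hτ hsub hrep hf.1 hb
    (pow_ne_zero n hι) hh heq)
  refine exists_eq_add_of_vertex hk hϖ hsq hrep hf (zpow_ne_zero _ hι) fun v hv => ?_
  rw [mem_lattice_iff hk, map_smul, smul_eq_C_mul]
  have h1 := (hsol v (by omega)).C_mul (ι ϖ ^ ε)
  rw [← mul_assoc, ← C_mul] at h1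
  have h2 : (ι (ϖ : F) ^ ((n : ℤ) - ε))⁻¹ = ι ϖ ^ ε * (ι ϖ ^ n)⁻¹ := by
    rw [zpow_sub₀ hι, zpow_natCast, zpow_natCast, inv_div, div_eq_mul_inv]
  rw [h2]
  refine h1.mono ?_
  rw [norm_pow, norm_algHom]
  calc _ ≤ (max c 1)⁻¹ * max c 1 := by
        gcongr
        · exact (hsol v (by omega)).nonneg
        · exact le_max_left _ _
    _ = 1 := inv_mul_cancel₀ (by positivity)

end Separated

end BreuilSchneider

end

/-! ### The theorem -/

open BreuilSchneider in
theorem mainTheorem2 (p : ℕ) [Fact p.Prime]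
    (F : Type*) [NormedField F] [NormedAlgebra ℚ_[p] F] [IsUltrametricDist F]
    [FiniteDimensional ℚ_[p] F]
    (C : Type*) [NormedField C] [NormedAlgebra ℚ_[p] C] [IsUltrametricDist C]
    [FiniteDimensional ℚ_[p] C]
    (hS : Nat.card (F →ₐ[ℚ_[p]] C) = Module.finrank ℚ_[p] F)
    (ϖ : Fˣ) (hϖ : BreuilSchneider.IsUniformizer ϖ)
    (sq : (F →ₐ[ℚ_[p]] C) → C) (hsq : ∀ τ : F →ₐ[ℚ_[p]] C, sq τ ^ 2 = τ ϖ)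
    (ι : F →ₐ[ℚ_[p]] C)
    (k : (F →ₐ[ℚ_[p]] C) → ℕ)
    (a : C) (ha : a ∈ BreuilSchneider.ringOfInt C)
    (σ : F →ₐ[ℚ_[p]] C) (hσ : {τ : F →ₐ[ℚ_[p]] C | k τ ≠ 0} = {σ})
    (q : ℕ) (hq : q = BreuilSchneider.residueCard F)
    (d r : ℕ) (hk : k σ = d * q + r) (hr : r < q)
    (h : ((k σ : ℝ) ≤ 1 / 2 * (q : ℝ) ^ 2 ∧ (r : ℝ) < (q : ℝ) - (d : ℝ) ∧
          0 ≤ BreuilSchneider.vF ϖ a ∧ BreuilSchneider.vF ϖ a ≤ 1) ∨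
        ((k σ : ℝ) ≤ 1 / 2 * (q : ℝ) ^ 2 ∧
          2 * BreuilSchneider.vF ϖ a - 1 ≤ ((r : ℝ) : EReal) ∧ (r : ℝ) < (q : ℝ) - (d : ℝ) ∧
          1 ≤ BreuilSchneider.vF ϖ a ∧
          BreuilSchneider.vF ϖ a ≤ ((BreuilSchneider.ramIndex p F : ℝ) : EReal)) ∨
        ((k σ : ℝ) ≤ min ((p : ℝ) * (q : ℝ) - 1) (1 / 2 * (q : ℝ) ^ 2) ∧
          (d : ℝ) - 1 ≤ (r : ℝ) ∧ ((d : ℝ) : EReal) ≤ BreuilSchneider.vF ϖ a)) :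
    BreuilSchneider.IsSeparated ϖ sq ι k a := by
  have hfinS : Finite (F →ₐ[ℚ_[p]] C) := Nat.finite_of_card_ne_zero (by
    rw [hS]; exact (Module.finrank_pos (R := ℚ_[p]) (M := F)).ne')
  have : Fintype (F →ₐ[ℚ_[p]] C) := Fintype.ofFinite _
  -- `Nat.card` of an infinite type is 0, so r < q already forces the residue field to be finite.
  have hfin : Finite (IsLocalRing.ResidueField (ringOfInt F)) := Nat.finite_of_card_ne_zero (by
    rw [← residueCard, ← hq]; omega)
  have : Fintype (IsLocalRing.ResidueField (ringOfInt F)) := Fintype.ofFinite _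
  have hk0 : ∀ τ, τ ≠ σ → k τ = 0 := fun τ hτ => by
    by_contra hne
    have : τ ∈ ({σ} : Set (F →ₐ[ℚ_[p]] C)) := hσ ▸ hne
    exact hτ this
  obtain rfl : q = Fintype.card (IsLocalRing.ResidueField (ringOfInt F)) := by
    rw [hq, residueCard, Nat.card_eq_fintype_card]
  obtain ⟨S, τ, hSp, hSϖ, hSτ, hτ, hfrob⟩ := hϖ.exists_treeData σ d
  refine isSeparated_of_exists_bdd hk0 hϖ hsq S hSϖ hSτ (fun l => (τ l).2) (fun l m hlm => ?_)
    (fun x hx => ⟨IsLocalRing.residue (ringOfInt F) ⟨x, hx⟩, ?_⟩) ι ?_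
  · rw [← hτ l, ← hτ m]
    exact residue_eq_iff.mpr hlm
  · exact (residue_eq_iff (x := ⟨x, hx⟩)).mp (hτ _).symm
  have hnϖ : ‖S.ϖ‖ = ‖(ϖ : F)‖ := by rw [hSϖ, norm_algHom]
  have hkq : 2 * k σ ≤ Fintype.card (IsLocalRing.ResidueField (ringOfInt F)) ^ 2 := by
    have : (k σ : ℝ) ≤ 1 / 2 * (Fintype.card (IsLocalRing.ResidueField (ringOfInt F)) : ℝ) ^ 2 := by
      rcases h with h | h | h
      · exact h.1
      · exact h.1
      · exact h.1.trans (min_le_right _ _)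
    rify
    linarith
  refine S.exists_bdd_of_isSol hk hr ha hkq hfrob ?_
  rw [hnϖ, hSp]
  rcases h with ⟨-, hdr, -, h1⟩ | ⟨-, h2, hdr, h1, he⟩ | ⟨hk1, hdr, hd⟩
  · refine Or.inl ⟨by rify; linarith, ?_⟩
    simpa using hϖ.le_norm_of_vF_le (d := 1) (by simpa using h1)
  -- v_F(0) = ∞ exceeds the ramification index.
  · have ha0 : a ≠ 0 := by
      rintro rfl
      rw [vF, if_pos rfl, top_le_iff] at he
      exact EReal.coe_ne_top _ he
    refine Or.inr (Or.inl ⟨by rify; linarith, hϖ.pow_succ_le_of_two_mul_vF_le ha0 h2, ?_, ?_⟩)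
    · simpa using hϖ.norm_le_of_le_vF (d := 1) (by simpa using h1)
    · refine le_trans (le_of_eq ?_) ((hϖ.norm_prime_le p).trans (hϖ.le_norm_of_vF_le he))
      exact (norm_natCast_eq_padic (p := p) p).trans (norm_natCast_eq_padic p).symm
  · refine Or.inr (Or.inr ⟨?_, ?_, hϖ.norm_le_of_le_vF hd⟩)
    · have := hk1.trans (min_le_left _ _)
      rify
      linarith
    · rify
      linarith
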